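/- All Banach spaces are over a fixed scalar field $\mathbb K\in\{\mathbb R,\mathbb C\}$, and $B_X$ denotes the closed unit ball of $X$. For a bounded subset $A$ of a Banach space $X$ put $$\widehat{\mathrm d}(A,B)=\sup_{a\in A}\inf_{b\in B}\|a-b\|,\qquad \mathrm{wk}_X(A)=\widehat{\mathrm d}\big(\overline{A}^{\,w^*},X\big),\qquad \omega(A)=\inf\{\widehat{\mathrm d}(A,K):\emptyset\ne K\subset X\text{ weakly compact}\},$$ where $\overline{A}^{\,w^*}$ is the weak$^*$ closure of $A$ in $X^{**}\supset X$. For a bounded linear operator $T:X\to Y$ with adjoint $T^*:Y^*\to X^*$ put $\mathrm{wk}_Y(T)=\mathrm{wk}_Y(T(B_X))$, $\omega(T)=\omega(T(B_X))$ (and likewise for $T^*$), and $$\mathrm{cc}(T)=\sup\Big\{\inf_{N}\sup_{k,l\ge N}\|Tx_k-Tx_l\| : (x_k)\text{ a weakly Cauchy sequence in }B_X\Big\}.$$ A Banach space $X$ has the direct quantitative Dunford-Pettis property if there is $C>0$ such that $\mathrm{cc}(T)\le C\,\mathrm{wk}_{X^*}(T^*)$ for every Banach space $Y$ and every bounded linear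 operator $T:X\to Y$. **Theorem 7.1.** Let $X$ be an $L^1$ predual, i.e., a Banach space such that $X^*$ is isometrically isomorphic to $L^1(\mu)$ for some (arbitrary) nonnegative $\sigma$-additive measure $\mu$. Then for every Banach space $Y$ and every bounded linear operator $T:X\to Y$, $$\mathrm{wk}_Y(T)\le 2\,\mathrm{wk}_{X^*}(T^*)\le 2\,\omega(T^*)=2\,\mathrm{wk}_{X^*}(T^*)\le 4\,\mathrm{wk}_Y(T)\le 4\,\omega(T),$$ $$\mathrm{cc}(T)\le 2\,\omega(T^*)=2\,\mathrm{wk}_{X^*}(T^*).$$ In particular, $X$ has the direct quantitative Dunford-Pettis property. Moreover, the following are $L^1$ preduals, so that all of this applies to them: the space $C_0(\Omega)$ of continuous $\mathbb K$-valued functions vanishing at infinity on a locally compact Hausdorff space $\Omega$; and the space $A(K)$ of continuous affine $\mathbb K$-valued functions on a Choquet simplex $K$, i.e., on a compact convex subset $K$ of a Hausdorff locally convex real vector space $E$ such that the cone $\{(tx,t):t\ge0,\ x\in K\}\subset E\times\mathbb R$ is a lattice in its own order. -/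

import Mathlib

open scoped ENNReal NNReal ZeroAtInfty

noncomputable section

namespace QuantDP

/-! All quantities below are suprema and infima of distances. They take values in `ℝ≥0∞`, so that
no supremum or infimum is a junk value; on bounded sets and bounded operators they are finite. -/

section Sets

/-- The nonsymmetric Hausdorff distance `sup_{a ∈ A} dist(a, B)`. -/
def excess {Z : Type*} [PseudoEMetricSpace Z] (A B : Set Z) : ℝ≥0∞ :=
  ⨆ a ∈ A, Metric.infEDist a B

variable (𝕜 : Type*) [RCLike 𝕜] {X : Type*} [NormedAddCommGroup X] [NormedSpace 𝕜 X]

/-- The set `K` is compact in the weak topology of `X`. -/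
def IsWeaklyCompact (K : Set X) : Prop :=
  IsCompact (toWeakSpace 𝕜 X '' K)

/-- The weak* closure in the bidual of the canonical copy of `A ⊆ X`. -/
def bidualWeakStarClosure (A : Set X) : Set (StrongDual 𝕜 (StrongDual 𝕜 X)) :=
  {z | StrongDual.toWeakDual z ∈
    closure ((fun x : X => StrongDual.toWeakDual (NormedSpace.inclusionInDoubleDual 𝕜 X x)) '' A)}

/-- `wk(A)`: how far points of the weak* closure of `A` in the bidual may be from `X`. -/
def wk (A : Set X) : ℝ≥0∞ :=
  excess (bidualWeakStarClosure 𝕜 A) (Set.range (NormedSpace.inclusionInDoubleDual 𝕜 X))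

/-- The de Blasi measure of weak noncompactness `ω(A)`. -/
def deBlasi (A : Set X) : ℝ≥0∞ :=
  ⨅ (K : Set X) (_ : K.Nonempty) (_ : IsWeaklyCompact 𝕜 K), excess A K

end Sets

section Sequences

/-- `ca(x)`: the infimum over `N` of the diameter of the tail `{x n : n ≥ N}`; it measures how far
the sequence is from being norm Cauchy. -/
def ca {Z : Type*} [PseudoEMetricSpace Z] (x : ℕ → Z) : ℝ≥0∞ :=
  ⨅ N : ℕ, ⨆ (m : ℕ) (_ : N ≤ m) (n : ℕ) (_ : N ≤ n), edist (x m) (x n)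

/-- The sequence `x` is weakly Cauchy. -/
def IsWeaklyCauchySeq (𝕜 : Type*) [RCLike 𝕜] {X : Type*} [NormedAddCommGroup X] [NormedSpace 𝕜 X]
    (x : ℕ → X) : Prop :=
  ∀ f : StrongDual 𝕜 X, CauchySeq fun n => f (x n)

end Sequences

section Operators

variable {𝕜 : Type*} [RCLike 𝕜] {X : Type*} [NormedAddCommGroup X] [NormedSpace 𝕜 X]
  {Y : Type*} [NormedAddCommGroup Y] [NormedSpace 𝕜 Y]

/-- The Banach space adjoint `T* : Y* → X*`, `T* f = f ∘ T`. -/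
def dualOp (T : X →L[𝕜] Y) : StrongDual 𝕜 Y →L[𝕜] StrongDual 𝕜 X :=
  (ContinuousLinearMap.compL 𝕜 X Y 𝕜).flip T

/-- `wk(T) = wk(T(B_X))`. -/
def wkOp (T : X →L[𝕜] Y) : ℝ≥0∞ :=
  wk 𝕜 (T '' Metric.closedBall (0 : X) 1)

/-- `ω(T) = ω(T(B_X))`. -/
def deBlasiOp (T : X →L[𝕜] Y) : ℝ≥0∞ :=
  deBlasi 𝕜 (T '' Metric.closedBall (0 : X) 1)

/-- `cc(T)`: the supremum of `ca(T x_k)` over the weakly Cauchy sequences `(x_k)` in `B_X`. -/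
def cc (T : X →L[𝕜] Y) : ℝ≥0∞ :=
  ⨆ (x : ℕ → X) (_ : ∀ k, x k ∈ Metric.closedBall (0 : X) 1) (_ : IsWeaklyCauchySeq 𝕜 x),
    ca fun k => T (x k)

end Operators

section Spaces

/-- `X` is an `L¹` predual: a Banach space whose dual is isometrically isomorphic to `L¹(μ)` for
some (arbitrary, not necessarily `σ`-finite) measure `μ`. -/
structure IsL1Predual.{w, v, u} (𝕜 : Type v) [RCLike 𝕜] (X : Type u) [NormedAddCommGroup X]
    [NormedSpace 𝕜 X] : Prop where
  complete : CompleteSpace X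
  dual_isometric : ∃ (α : Type w) (_ : MeasurableSpace α) (μ : MeasureTheory.Measure α),
    Nonempty (StrongDual 𝕜 X ≃ₗᵢ[𝕜] MeasureTheory.Lp 𝕜 1 μ)

/-- The direct quantitative Dunford-Pettis property: for some constant `C > 0`,
`cc(T) ≤ C wk(T*)` for every bounded operator `T` from `X` to a Banach space. -/
def HasDirectQuantDPP.{w, v, u} (𝕜 : Type v) [RCLike 𝕜] (X : Type u) [NormedAddCommGroup X]
    [NormedSpace 𝕜 X] : Prop :=
  ∃ C : ℝ≥0, 0 < C ∧ ∀ (Y : Type w) [NormedAddCommGroup Y] [NormedSpace 𝕜 Y] [CompleteSpace Y]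
    (T : X →L[𝕜] Y), cc T ≤ C * wkOp (dualOp T)

/-- The cone `{(t x, t) : t ≥ 0, x ∈ K}` in `E × ℝ` with base `K × {1}`. -/
def coneOver {E : Type*} [AddCommGroup E] [Module ℝ E] (K : Set E) : Set (E × ℝ) :=
  {p | ∃ t : ℝ, 0 ≤ t ∧ ∃ x ∈ K, p = (t • x, t)}

/-- The convex set `K` is a simplex: the cone over `K` is a lattice in its own order
`p ≤ q ↔ q - p ∈ coneOver K`. (It is enough to ask for suprema: if `s` is the supremum of `p` and
`q`, then `p + q - s` is their infimum.) A Choquet simplex is a compact simplex in a Hausdorff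
locally convex space. -/
structure IsSimplex {E : Type*} [AddCommGroup E] [Module ℝ E] (K : Set E) : Prop where
  convex : Convex ℝ K
  exists_sup : ∀ p ∈ coneOver K, ∀ q ∈ coneOver K, ∃ s ∈ coneOver K,
    s - p ∈ coneOver K ∧ s - q ∈ coneOver K ∧
      ∀ r ∈ coneOver K, r - p ∈ coneOver K → r - q ∈ coneOver K → r - s ∈ coneOver K

/-- The space `A(K)` of continuous affine `𝕜`-valued functions on `K`, as a subspace of `C(K, 𝕜)`
(with the supremum norm when `K` is compact). -/
def affineFunctions (𝕜 : Type*) [RCLike 𝕜] {E : Type*} [AddCommGroup E] [Module ℝ E]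
    [TopologicalSpace E] (K : Set E) : Submodule 𝕜 C(K, 𝕜) where
  carrier := {f | ∀ (x y z : K) (a b : ℝ), 0 ≤ a → 0 ≤ b → a + b = 1 →
    (z : E) = a • (x : E) + b • (y : E) → f z = (a : 𝕜) * f x + (b : 𝕜) * f y}
  zero_mem' := by
    intro x y z a b _ _ _ _
    simp
  add_mem' := by
    intro f g hf hg x y z a b ha hb hab h
    simp only [ContinuousMap.add_apply, hf x y z a b ha hb hab h, hg x y z a b ha hb hab h]
    ring
  smul_mem' := by
    intro c f hf x y z a b ha hb hab h
    simp only [ContinuousMap.smul_apply, smul_eq_mul, hf x y z a b ha hb hab h]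
    ring

end Spaces

end QuantDP

end

open QuantDP

universe v u w z

/-!
The inequalities between `wk(T)`, `wk(T*)` and `ω` that hold for all operators come from the bidual.
By the theorems of Goldstine and Alaoglu, the weak* closure of `T(B_X)` is `T**(B_{X**})`; this gives
the quantitative Gantmacher theorem `wkOp_dualOp_le`, `wkOp_le_dualOp`, and `wk ≤ ω` is
`wk_le_deBlasi`.

The rest rests on one quantity for a bounded set `A` in `L¹(μ)`: the infimum, over integrable
`h ≥ 0`, of `sup_{f ∈ A} ∫ (|f| - h)⁺ dμ`, the excess of `A` over the order interval `[-h, h]`.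

* It is at least `ω(A)`, as the order interval lies in the image of a ball of `L²` under
  `g ↦ √h g`, which is weakly compact (`deBlasi_le_intervalExcess`).
* It is at most `wk(A)`. If it is `c`, one picks inductively elements of `A` that stick out by about
  `c` of large multiples of what was picked before. They concentrate with mass `c` on disjoint sets
  (`exists_disjoint_concentration`), and a weak* cluster point of such a sequence is at distance `c`
  from `L¹` (`le_wk_of_concentration`). Together, `ω = wk` on bounded subsets of `L¹`.
* If `L¹(μ) = X*` and `A = T*(B_{Y*})`, twice this quantity bounds `cc(T)`. This is the
  Dunford–Pettis property of `X`: weakly null sequences of `X` tend to zero uniformly on images of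
  balls of `L²` under `g ↦ √h g` (`tendsto_norm_comp_mulLTwo`). Elements of `X` act on `h dμ` as
  bounded functions, and countably many of these are given at almost every point by evaluation at
  one functional in the unit ball of `X*` (`ae_exists_functional_eq`), so that dominated convergence
  applies. No localizability of `μ` is needed.

For the examples, let a self-adjoint subspace `V` of `C(B)`, with `B` compact, have a *selection*
of representing measures (`MeasureSelection`): each positive functional that a measure on `B`
induces on `V` is represented by exactly one selected measure, the selection is additive and does
not increase the mass, and measures below selected ones are selected. Then
`MeasureSelection.exists_dual_isometric` shows that `V*` is an `L¹` space, namely that of the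
disjoint union of a maximal family of pairwise singular selected measures. Every functional extends
to `C(B)` by the Hahn–Banach theorem, and is a combination of measures with almost no excess mass;
passing to the selected measures does not increase the mass, and makes the representation unique.
Maximality of the family makes every selected measure a sum of measures that are absolutely
continuous with respect to its members.

For `C₀(Ω)`, `B` is the one-point compactification and the selected measures are those without mass
at infinity. For `A(K)` on a simplex `K`, they are the maximal measures. The lattice property of the
cone over `K` gives the Riesz decomposition property, by which the upper envelope of a convex
function is additive on the cone (`decompSup_add`), and as a function of the convex function
(`decompSup_add_fun`). Hence each element of the cone is the resultant of exactly one measure whose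
integrals of convex functions are the values of the upper envelopes
(`exists_measure_eq_decompSup`, `measure_ext_of_convex`).
-/

open QuantDP
open Metric NormedSpace Filter Topology MeasureTheory

/-! ### Weak* closures in the bidual and the quantitative Gantmacher theorem -/

section Bidual

variable {𝕜 : Type*} [RCLike 𝕜] {X : Type*} [NormedAddCommGroup X] [NormedSpace 𝕜 X]
  {Y : Type*} [NormedAddCommGroup Y] [NormedSpace 𝕜 Y]

/-- Hahn–Banach separation in a weak topology, whose continuous functionals are given by the
pairing. -/
theorem WeakBilin.exists_re_lt_of_notMem_closure {E F : Type*} [AddCommGroup E] [Module 𝕜 E]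
    [AddCommGroup F] [Module 𝕜 F] (B : E →ₗ[𝕜] F →ₗ[𝕜] 𝕜) [Module ℝ E] [IsScalarTower ℝ 𝕜 E]
    {s : Set E} (hs : Convex ℝ s) {z : E} (hz : z ∉ closure (X := WeakBilin B) s) :
    ∃ (x : F) (u : ℝ), (∀ w ∈ s, RCLike.re (B w x) < u) ∧ u < RCLike.re (B z x) := by
  have : IsScalarTower ℝ 𝕜 (WeakBilin B) := inferInstanceAs (IsScalarTower ℝ 𝕜 E)
  have := IsScalarTower.continuousSMul (M := ℝ) (α := WeakBilin B) 𝕜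
  have hs' : Convex ℝ (closure (X := WeakBilin B) s) := Convex.closure (E := WeakBilin B) hs
  obtain ⟨f, u, hf, hu⟩ := RCLike.geometric_hahn_banach_closed_point (𝕜 := 𝕜) hs'
    isClosed_closure hz
  obtain ⟨x, hx⟩ := LinearMap.dualEmbedding_surjective B f
  have : ∀ w, f w = B w x := fun w => by rw [← hx]; rfl
  simp only [this] at hf hu
  exact ⟨x, u, fun w hw => hf w (subset_closure hw), hu.trans_eq (congrArg _ (this z))⟩

/-- **Goldstine's theorem**. -/
theorem mem_bidualWeakStarClosure_closedBall {z : StrongDual 𝕜 (StrongDual 𝕜 X)} (hz : ‖z‖ ≤ 1) :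
    z ∈ bidualWeakStarClosure 𝕜 (closedBall (0 : X) 1) := by
  by_contra hcon
  let : NormedSpace ℝ X := NormedSpace.restrictScalars ℝ 𝕜 X
  have hconv : Convex ℝ (inclusionInDoubleDual 𝕜 X '' closedBall (0 : X) 1) := by
    have : LinearMap.CompatibleSMul X (StrongDual 𝕜 (StrongDual 𝕜 X)) ℝ 𝕜 :=
      ⟨fun f r x => by
        have h : r • x = (r : 𝕜) • x := rfl
        rw [h, map_smul]
        exact (RCLike.real_smul_eq_coe_smul r (f x)).symm⟩
    exact (convex_closedBall (0 : X) 1).linear_image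
      ((inclusionInDoubleDual 𝕜 X).toLinearMap.restrictScalars ℝ)
  have hcon' : z ∉ closure (X := WeakBilin (topDualPairing 𝕜 (StrongDual 𝕜 X)))
      (inclusionInDoubleDual 𝕜 X '' closedBall (0 : X) 1) := hcon
  have : IsScalarTower ℝ 𝕜 (StrongDual 𝕜 (StrongDual 𝕜 X)) := inferInstance
  have h := WeakBilin.exists_re_lt_of_notMem_closure
    (E := StrongDual 𝕜 (StrongDual 𝕜 X)) (F := StrongDual 𝕜 X) (z := z)
    (topDualPairing 𝕜 (StrongDual 𝕜 X)) hconv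
  replace h := h hcon'
  clear hcon hcon' hconv
  obtain ⟨φ, u, hball, hu⟩ := h
  rw [Set.forall_mem_image] at hball
  replace hball : ∀ x ∈ closedBall (0 : X) 1, RCLike.re (φ x) < u := fun x hx => hball hx
  change u < RCLike.re (z φ) at hu
  have hu0 : 0 < u := by simpa using hball 0 (by simp)
  have hnorm : ‖φ‖ ≤ u := by
    refine φ.opNorm_le_of_unit_norm hu0.le fun x hx => ?_
    obtain ⟨c, hc, hcx⟩ := RCLike.exists_norm_eq_mul_self (φ x)
    have := hball (c • x) (by simp [norm_smul, hc, hx])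
    rw [map_smul, smul_eq_mul, ← hcx, RCLike.ofReal_re] at this
    exact this.le
  have : RCLike.re (z φ) ≤ ‖φ‖ := (RCLike.re_le_norm _).trans
    ((z.le_opNorm φ).trans (by nlinarith [norm_nonneg φ]))
  exact absurd (hu.trans_le this) (by linarith)

/-- The bidual operator is weak*-continuous. -/
theorem continuous_dualOp_weakDual (T : X →L[𝕜] Y) :
    Continuous fun w : WeakDual 𝕜 Y => StrongDual.toWeakDual (dualOp T (WeakDual.toStrongDual w)) :=
  WeakDual.continuous_of_continuous_eval fun x => WeakDual.eval_continuous (T x)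

/-- By the theorems of Banach–Alaoglu and Goldstine, the weak* closure of `T(B_X)` in the bidual
is the image of the unit ball of `X**` under `T**`. -/
theorem bidualWeakStarClosure_image_closedBall (T : X →L[𝕜] Y) :
    bidualWeakStarClosure 𝕜 (T '' closedBall (0 : X) 1) =
      dualOp (dualOp T) '' closedBall 0 1 := by
  have hc := continuous_dualOp_weakDual (dualOp T)
  apply Set.Subset.antisymm
  · intro z hz
    have hK : IsClosed ((fun w : WeakDual 𝕜 (StrongDual 𝕜 X) =>
        StrongDual.toWeakDual (dualOp (dualOp T) (WeakDual.toStrongDual w))) ''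
          (WeakDual.toStrongDual ⁻¹' closedBall 0 1)) :=
      ((WeakDual.isCompact_closedBall 0 1).image hc).isClosed
    obtain ⟨w, hw, hwz⟩ := closure_minimal (s := ((fun y : Y =>
      StrongDual.toWeakDual (inclusionInDoubleDual 𝕜 Y y)) '' (T '' closedBall (0 : X) 1))) (by
        rintro _ ⟨_, ⟨x, hx, rfl⟩, rfl⟩
        refine ⟨StrongDual.toWeakDual (inclusionInDoubleDual 𝕜 X x), ?_, rfl⟩
        exact (mem_closedBall_zero_iff (E := StrongDual 𝕜 (StrongDual 𝕜 X))).2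
          ((double_dual_bound 𝕜 X x).trans (by simpa using hx))) hK hz
    exact ⟨WeakDual.toStrongDual w, hw, StrongDual.toWeakDual.injective hwz⟩
  · rintro _ ⟨w, hw, rfl⟩
    have h1 : w ∈ bidualWeakStarClosure 𝕜 (closedBall (0 : X) 1) :=
      mem_bidualWeakStarClosure_closedBall (by simpa using hw)
    have h2 := image_closure_subset_closure_image hc ⟨_, h1, rfl⟩
    rw [Set.image_image] at h2
    change StrongDual.toWeakDual (dualOp (dualOp T) w) ∈ closure _
    rw [Set.image_image]
    exact h2

theorem infEDist_le_wk {A : Set X} {z : StrongDual 𝕜 (StrongDual 𝕜 X)}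
    (hz : z ∈ bidualWeakStarClosure 𝕜 A) :
    infEDist z (Set.range (inclusionInDoubleDual 𝕜 X)) ≤ wk 𝕜 A :=
  le_iSup₂ (f := fun a (_ : a ∈ bidualWeakStarClosure 𝕜 A) =>
    infEDist a (Set.range (inclusionInDoubleDual 𝕜 X))) z hz

theorem exists_norm_sub_incl_lt {A : Set X} {z : StrongDual 𝕜 (StrongDual 𝕜 X)}
    (hz : z ∈ bidualWeakStarClosure 𝕜 A) {r : ℝ} (hr : wk 𝕜 A < ENNReal.ofReal r) :
    ∃ x : X, ‖z - inclusionInDoubleDual 𝕜 X x‖ < r := by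
  obtain ⟨_, ⟨x, rfl⟩, hx⟩ := infEDist_lt_iff.1 ((infEDist_le_wk hz).trans_lt hr)
  refine ⟨x, ?_⟩
  rwa [edist_dist, ENNReal.ofReal_lt_ofReal_iff_of_nonneg dist_nonneg, dist_eq_norm] at hx

/-- Norm-closed balls of the bidual are weak*-closed, so a weakly compact set absorbs weak*
limits up to the distance. -/
theorem wk_le_deBlasi (A : Set X) : wk 𝕜 A ≤ deBlasi 𝕜 A := by
  refine le_iInf₂ fun K _ => le_iInf fun hKc => ?_
  refine iSup₂_le fun z hz => ?_
  refine ENNReal.le_of_forall_pos_le_add fun ε hε hfin => ?_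
  obtain ⟨r, hr⟩ : ∃ r : ℝ, r = (excess A K).toReal + ε := ⟨_, rfl⟩
  have hr0 : 0 ≤ r := by rw [hr]; positivity
  have hrE : ENNReal.ofReal r = excess A K + ε := by
    rw [hr, ENNReal.ofReal_add ENNReal.toReal_nonneg ε.coe_nonneg, ENNReal.ofReal_toReal hfin.ne,
      ENNReal.ofReal_coe_nnreal]
  -- the weak* compact set `K + r B_{X**}` contains `A`, hence the weak* closure of `A`
  have hKw : IsCompact ((inclusionInDoubleDualWeak 𝕜 X) '' (toWeakSpace 𝕜 X '' K)) :=
    hKc.image (inclusionInDoubleDualWeak 𝕜 X).continuous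
  have hsum := (hKw.add (WeakDual.isCompact_closedBall (𝕜 := 𝕜)
    (0 : StrongDual 𝕜 (StrongDual 𝕜 X)) r)).isClosed
  have hmem := closure_minimal (s := (fun x : X =>
      StrongDual.toWeakDual (inclusionInDoubleDual 𝕜 X x)) '' A) (by
    rintro _ ⟨a, ha, rfl⟩
    have hlt : infEDist a K < ENNReal.ofReal r := by
      refine (le_iSup₂ (f := fun a (_ : a ∈ A) => infEDist a K) a ha).trans_lt ?_
      rw [hrE]
      exact ENNReal.lt_add_right hfin.ne (by simpa using hε.ne')
    obtain ⟨k, hk, hak⟩ := infEDist_lt_iff.1 hlt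
    refine ⟨_, ⟨_, ⟨k, hk, rfl⟩, rfl⟩,
      StrongDual.toWeakDual (inclusionInDoubleDual 𝕜 X (a - k)), ?_, ?_⟩
    · have : ‖a - k‖ ≤ r := by
        rw [← dist_eq_norm]
        rw [edist_dist] at hak
        exact (ENNReal.ofReal_le_ofReal_iff hr0).1 hak.le
      simpa using (double_dual_bound 𝕜 X (a - k)).trans this
    · refine DFunLike.ext _ _ fun φ => ?_
      change φ k + φ (a - k) = φ a
      simp) hsum hz
  obtain ⟨_, ⟨_, ⟨k, hk, rfl⟩, rfl⟩, w, hw, hwz⟩ := hmem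
  have hz' : z = inclusionInDoubleDual 𝕜 X k + WeakDual.toStrongDual w :=
    StrongDual.toWeakDual.injective hwz.symm
  refine (infEDist_le_edist_of_mem (Set.mem_range_self k)).trans ?_
  have hw' : z - inclusionInDoubleDual 𝕜 X k = WeakDual.toStrongDual w := by
    rw [hz']; exact add_sub_cancel_left (G := StrongDual 𝕜 (StrongDual 𝕜 X)) _ _
  rw [edist_dist, dist_eq_norm, hw', ← hrE]
  exact ENNReal.ofReal_le_ofReal (by simpa using hw)

theorem ENNReal.le_of_forall_ofReal {a b : ℝ≥0∞} (h : ∀ r : ℝ, 0 ≤ r → b < ENNReal.ofReal r →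
    a ≤ ENNReal.ofReal r) : a ≤ b := by
  refine le_of_forall_gt_imp_ge_of_dense fun c hc => ?_
  by_cases hct : c = ∞
  · simp [hct]
  · have := h c.toReal ENNReal.toReal_nonneg (by rwa [ENNReal.ofReal_toReal hct])
    rwa [ENNReal.ofReal_toReal hct] at this

/-- One half of the quantitative Gantmacher theorem. A point of `cl T*(B_{Y*})` is `T***φ`, and its
distance to `X*` is at most that to `T*(φ|_Y)`. -/
theorem wkOp_dualOp_le (T : X →L[𝕜] Y) : wkOp (dualOp T) ≤ 2 * wkOp T := by
  have key : ∀ r : ℝ, 0 ≤ r → wkOp T < ENNReal.ofReal r →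
      wkOp (dualOp T) ≤ 2 * ENNReal.ofReal r := by
    intro r hr0 hr
    refine iSup₂_le fun w hw => ?_
    rw [bidualWeakStarClosure_image_closedBall] at hw
    obtain ⟨φ, hφ, rfl⟩ := hw
    rw [mem_closedBall_zero_iff] at hφ
    let y' : StrongDual 𝕜 Y := φ.comp (inclusionInDoubleDual 𝕜 Y)
    have hy' : ‖y'‖ ≤ 1 := by
      refine y'.opNorm_le_bound zero_le_one fun y => ?_
      refine (φ.le_opNorm _).trans ?_
      exact mul_le_mul hφ (double_dual_bound 𝕜 Y y) (norm_nonneg _) zero_le_one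
    refine (infEDist_le_edist_of_mem (Set.mem_range_self (dualOp T y'))).trans ?_
    rw [edist_dist, dist_eq_norm]
    have h2 : (2 : ℝ≥0∞) * ENNReal.ofReal r = ENNReal.ofReal (2 * r) := by
      rw [ENNReal.ofReal_mul zero_le_two]; simp
    rw [h2]
    refine ENNReal.ofReal_le_ofReal ?_
    refine ContinuousLinearMap.opNorm_le_of_unit_norm (by positivity) fun x'' hx'' => ?_
    set z := dualOp (dualOp T) x'' with hz
    have hzc : z ∈ bidualWeakStarClosure 𝕜 (T '' closedBall (0 : X) 1) := by
      rw [bidualWeakStarClosure_image_closedBall]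
      exact ⟨x'', by simp [hx''], rfl⟩
    obtain ⟨y, hy⟩ := exists_norm_sub_incl_lt hzc hr
    have hval : (dualOp (dualOp (dualOp T)) φ - inclusionInDoubleDual 𝕜 _ (dualOp T y')) x'' =
        φ (z - inclusionInDoubleDual 𝕜 Y y) - (z - inclusionInDoubleDual 𝕜 Y y) y' := by
      rw [map_sub]
      change φ z - z y' = φ z - y' y - (z y' - y' y)
      ring
    rw [hval]
    refine (norm_sub_le _ _).trans ?_
    have h1 := φ.le_opNorm (z - inclusionInDoubleDual 𝕜 Y y)
    have h3 := (z - inclusionInDoubleDual 𝕜 Y y).le_opNorm y'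
    nlinarith [norm_nonneg (z - inclusionInDoubleDual 𝕜 Y y), norm_nonneg φ, norm_nonneg y']
  have h2 : (2 : ℝ≥0∞) ≠ 0 := by simp
  rw [mul_comm, ← ENNReal.div_le_iff h2 (by simp)]
  refine ENNReal.le_of_forall_ofReal fun r hr0 hr => ?_
  rw [ENNReal.div_le_iff h2 (by simp), mul_comm]
  exact key r hr0 hr

/-- A functional of norm at most one that vanishes on a complete subspace and takes the value
`dist(z, p)` at `z`. -/
theorem exists_dual_vanishing {Z : Type*} [NormedAddCommGroup Z] [NormedSpace 𝕜 Z]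
    (p : Submodule 𝕜 Z) (hp : IsClosed (p : Set Z)) (z : Z) :
    ∃ φ : StrongDual 𝕜 Z, ‖φ‖ ≤ 1 ∧ (∀ y ∈ p, φ y = 0) ∧ ‖φ z‖ = infDist z p := by
  have : IsClosed (p.toAddSubgroup : Set Z) := hp
  obtain ⟨g, hg, hgz⟩ := exists_dual_vector'' 𝕜 (p.mkQ z : Z ⧸ p)
  have hq : ∀ y, ‖(p.mkQ y : Z ⧸ p)‖ ≤ ‖y‖ := Submodule.Quotient.norm_mk_le p
  refine ⟨g.comp (p.mkQL), ?_, fun y hy => ?_, ?_⟩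
  · refine ContinuousLinearMap.opNorm_le_bound _ zero_le_one fun y => ?_
    exact (g.le_opNorm _).trans (mul_le_mul hg (hq y) (norm_nonneg _) zero_le_one)
  · change g (p.mkQ y) = 0
    rw [Submodule.mkQ_apply, (Submodule.Quotient.mk_eq_zero p).2 hy, map_zero]
  · change ‖g (p.mkQ z)‖ = _
    rw [hgz, RCLike.norm_ofReal, abs_norm]
    exact QuotientAddGroup.norm_mk (S := p.toAddSubgroup) z

/-- The other half of the quantitative Gantmacher theorem. A functional `φ` on the bidual of `Y`
that vanishes on `Y` has `T***φ` vanishing on `X`, so that an approximation of `T***φ` by an element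
of `X*` must be small. -/
theorem wkOp_le_dualOp [CompleteSpace Y] (T : X →L[𝕜] Y) : wkOp T ≤ 2 * wkOp (dualOp T) := by
  have key : ∀ r : ℝ, 0 ≤ r → wkOp (dualOp T) < ENNReal.ofReal r →
      wkOp T ≤ 2 * ENNReal.ofReal r := by
    intro r hr0 hr
    refine iSup₂_le fun z hz => ?_
    rw [bidualWeakStarClosure_image_closedBall] at hz
    obtain ⟨x'', hx'', rfl⟩ := hz
    rw [mem_closedBall_zero_iff] at hx''
    have hclosed : IsClosed (Set.range (inclusionInDoubleDual 𝕜 Y)) := by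
      have := (inclusionInDoubleDualLi 𝕜 (E := Y)).isometry.isUniformInducing.isComplete_range
      exact this.isClosed
    obtain ⟨φ, hφ, hφ0, hφz⟩ := exists_dual_vanishing (𝕜 := 𝕜)
      (inclusionInDoubleDual 𝕜 Y).range hclosed (dualOp (dualOp T) x'')
    have hmem : dualOp (dualOp (dualOp T)) φ ∈
        bidualWeakStarClosure 𝕜 (dualOp T '' closedBall 0 1) := by
      rw [bidualWeakStarClosure_image_closedBall]
      exact ⟨φ, by simpa using hφ, rfl⟩
    obtain ⟨x', hx'⟩ := exists_norm_sub_incl_lt hmem hr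
    set w := dualOp (dualOp (dualOp T)) φ with hw
    have hnx : ‖x'‖ ≤ r := by
      refine x'.opNorm_le_bound hr0 fun x => ?_
      have h0 : w (inclusionInDoubleDual 𝕜 X x) = 0 :=
        hφ0 (inclusionInDoubleDual 𝕜 Y (T x)) ⟨T x, rfl⟩
      have h1 : x' x = -((w - inclusionInDoubleDual 𝕜 _ x') (inclusionInDoubleDual 𝕜 X x)) := by
        rw [_root_.sub_apply, h0]
        simp
      rw [h1, norm_neg]
      refine (ContinuousLinearMap.le_opNorm _ _).trans ?_
      exact mul_le_mul hx'.le (double_dual_bound 𝕜 X x) (norm_nonneg _) hr0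
    have hval : ‖φ (dualOp (dualOp T) x'')‖ ≤ 2 * r := by
      have h1 : φ (dualOp (dualOp T) x'') = (w - inclusionInDoubleDual 𝕜 _ x') x'' + x'' x' := by
        change w x'' = w x'' - x'' x' + x'' x'
        ring
      rw [h1]
      refine (norm_add_le _ _).trans ?_
      have h2 := (w - inclusionInDoubleDual 𝕜 _ x').le_opNorm x''
      have h3 := x''.le_opNorm x'
      nlinarith [norm_nonneg (w - inclusionInDoubleDual 𝕜 _ x'), norm_nonneg x'', norm_nonneg x']
    rw [hφz] at hval
    have h2 : (2 : ℝ≥0∞) * ENNReal.ofReal r = ENNReal.ofReal (2 * r) := by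
      rw [ENNReal.ofReal_mul zero_le_two]; simp
    rw [h2]
    have hne : infEDist (dualOp (dualOp T) x'') (Set.range (inclusionInDoubleDual 𝕜 Y)) ≠ ∞ :=
      infEDist_ne_top (Set.range_nonempty _)
    rw [← ENNReal.ofReal_toReal hne]
    exact ENNReal.ofReal_le_ofReal hval
  have h2 : (2 : ℝ≥0∞) ≠ 0 := by simp
  rw [mul_comm, ← ENNReal.div_le_iff h2 (by simp)]
  refine ENNReal.le_of_forall_ofReal fun r hr0 hr => ?_
  rw [ENNReal.div_le_iff h2 (by simp), mul_comm]
  exact key r hr0 hr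

end Bidual

/-! ### Order intervals in `L¹` and the measure of weak noncompactness -/

section LOne

variable {𝕜 : Type*} [RCLike 𝕜] {Z : Type*} [NormedAddCommGroup Z] [NormedSpace 𝕜 Z]

/-- By reflexivity, bounded linear images of balls of a Hilbert space are weakly compact. -/
theorem isWeaklyCompact_image_closedBall {H : Type*} [NormedAddCommGroup H] [InnerProductSpace 𝕜 H]
    [CompleteSpace H] (S : H →L[𝕜] Z) (r : ℝ) : IsWeaklyCompact 𝕜 (S '' closedBall 0 r) := by
  let F : WeakDual 𝕜 H → WeakSpace 𝕜 Z := fun w =>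
    toWeakSpace 𝕜 Z (S ((InnerProductSpace.toDual 𝕜 H).symm (WeakDual.toStrongDual w)))
  have hF : Continuous F := by
    refine WeakBilin.continuous_of_continuous_eval _ fun φ => ?_
    let ξ := (InnerProductSpace.toDual 𝕜 H).symm (φ.comp S)
    have : ∀ w : WeakDual 𝕜 H, φ (S ((InnerProductSpace.toDual 𝕜 H).symm
        (WeakDual.toStrongDual w))) = starRingEnd 𝕜 (w ξ) := fun w => by
      have h1 : φ (S ((InnerProductSpace.toDual 𝕜 H).symm (WeakDual.toStrongDual w))) =
          inner 𝕜 ξ ((InnerProductSpace.toDual 𝕜 H).symm (WeakDual.toStrongDual w)) :=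
        (InnerProductSpace.toDual_symm_apply (y := φ.comp S)).symm
      rw [h1, ← inner_conj_symm, InnerProductSpace.toDual_symm_apply]
      rfl
    exact (RCLike.continuous_conj.comp (WeakDual.eval_continuous ξ)).congr fun w => (this w).symm
  have h := (WeakDual.isCompact_closedBall (𝕜 := 𝕜) (0 : StrongDual 𝕜 H) r).image hF
  unfold IsWeaklyCompact
  convert h using 1
  ext z
  constructor
  · rintro ⟨_, ⟨x, hx, rfl⟩, rfl⟩
    refine ⟨StrongDual.toWeakDual (InnerProductSpace.toDual 𝕜 H x), ?_, ?_⟩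
    · simpa using hx
    · simp [F]
  · rintro ⟨w, hw, rfl⟩
    refine ⟨_, ⟨(InnerProductSpace.toDual 𝕜 H).symm (WeakDual.toStrongDual w), ?_, rfl⟩, rfl⟩
    simpa using hw

variable {α : Type*} [MeasurableSpace α] {μ : Measure α}

/-- Multiplication by a fixed square integrable function, from `L²` to `L¹`. -/
noncomputable def mulLTwo (s : Lp 𝕜 2 μ) : Lp 𝕜 2 μ →L[𝕜] Lp 𝕜 1 μ :=
  (ContinuousLinearMap.mul 𝕜 𝕜).holderL μ 2 2 1 s

theorem coeFn_mulLTwo (s g : Lp 𝕜 2 μ) : mulLTwo s g =ᵐ[μ] fun x => s x * g x :=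
  (ContinuousLinearMap.mul 𝕜 𝕜).coeFn_holder s g

/-- How far the elements of `A ⊆ Z ≅ L¹(μ)` stick out of the order interval `[-h, h]`. -/
noncomputable def intervalExcess (e : Z ≃ₗᵢ[𝕜] Lp 𝕜 1 μ) (A : Set Z) (h : α → ℝ≥0∞) : ℝ≥0∞ :=
  ⨆ z ∈ A, ∫⁻ x, (‖e z x‖ₑ - h x) ∂μ

/-- A pointwise square root of an integrable function, as an element of `L²`. (Infinite values of
`h`, which occur on a null set only, become `0`.) -/
theorem exists_sqrt_lTwo {h : α → ℝ≥0∞} (hm : Measurable h) (hi : ∫⁻ x, h x ∂μ ≠ ∞) :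
    ∃ s : Lp 𝕜 2 μ, ∀ᵐ x ∂μ, s x = ((Real.sqrt (h x).toReal : ℝ) : 𝕜) := by
  have hmeas : Measurable fun x => ((Real.sqrt (h x).toReal : ℝ) : 𝕜) :=
    RCLike.measurable_ofReal.comp hm.ennreal_toReal.sqrt
  have : MemLp (fun x => ((Real.sqrt (h x).toReal : ℝ) : 𝕜)) 2 μ := by
    rw [← integrable_norm_rpow_iff hmeas.aestronglyMeasurable (by simp) (by simp)]
    refine (integrable_toReal_of_lintegral_ne_top hm.aemeasurable hi).congr (ae_of_all _ fun x => ?_)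
    simp [Real.sq_sqrt ENNReal.toReal_nonneg, abs_of_nonneg (Real.sqrt_nonneg _)]
  exact ⟨this.toLp _, this.coeFn_toLp⟩

/-- Truncation to the order interval `[-h, h]`, which lies in the image under `g ↦ √h g` of a ball
of `L²`. -/
theorem exists_truncation {h : α → ℝ≥0∞} (hi : ∀ᵐ x ∂μ, h x < ∞) {s : Lp 𝕜 2 μ}
    (hs : ∀ᵐ x ∂μ, s x = ((Real.sqrt (h x).toReal : ℝ) : 𝕜)) (f : Lp 𝕜 1 μ) :
    ∃ g : Lp 𝕜 2 μ, ‖g‖ ≤ ‖s‖ ∧ ‖f - mulLTwo s g‖ₑ ≤ ∫⁻ x, (‖f x‖ₑ - h x) ∂μ := by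
  let g₀ : α → 𝕜 := fun x => f x * ((‖s x‖ / max ‖f x‖ (‖s x‖ ^ 2) : ℝ) : 𝕜)
  have hg₀ : AEStronglyMeasurable g₀ μ := by
    refine (Lp.aestronglyMeasurable f).mul ?_
    refine RCLike.continuous_ofReal.comp_aestronglyMeasurable ?_
    have h1 := (Lp.aestronglyMeasurable s).norm
    have h2 := (Lp.aestronglyMeasurable f).norm
    exact (h1.aemeasurable.div (h2.sup (h1.pow 2)).aemeasurable).aestronglyMeasurable
  have hle : ∀ x, ‖g₀ x‖ ≤ ‖s x‖ := fun x => by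
    have h0 : 0 ≤ ‖s x‖ / max ‖f x‖ (‖s x‖ ^ 2) := by positivity
    rw [norm_mul, RCLike.norm_of_nonneg h0, mul_div_assoc', mul_comm, mul_div_assoc]
    refine mul_le_of_le_one_right (norm_nonneg _) (div_le_one_of_le₀ (le_max_left _ _) ?_)
    positivity
  have hmem : MemLp g₀ 2 μ := (Lp.memLp s).mono hg₀ (ae_of_all _ hle)
  refine ⟨hmem.toLp g₀, ?_, ?_⟩
  · refine Lp.norm_le_norm_of_ae_le ?_
    filter_upwards [hmem.coeFn_toLp] with x hx
    rw [hx]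
    exact hle x
  · rw [Lp.enorm_def, eLpNorm_one_eq_lintegral_enorm]
    refine lintegral_mono_ae ?_
    filter_upwards [Lp.coeFn_sub f (mulLTwo s (hmem.toLp g₀)), coeFn_mulLTwo s (hmem.toLp g₀),
      hmem.coeFn_toLp, hs, hi] with x h1 h2 h3 h4 h5
    rw [h1, Pi.sub_apply, h2, h3]
    have hsn : ‖s x‖ ^ 2 = (h x).toReal := by
      rw [h4, RCLike.norm_of_nonneg (Real.sqrt_nonneg _), Real.sq_sqrt ENNReal.toReal_nonneg]
    have hss : s x * g₀ x = f x * (((h x).toReal / max ‖f x‖ (h x).toReal : ℝ) : 𝕜) := by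
      simp only [g₀]
      have : s x = ((‖s x‖ : ℝ) : 𝕜) := by
        rw [h4, RCLike.norm_of_nonneg (Real.sqrt_nonneg _)]
      nth_rw 1 [this]
      rw [← hsn]
      push_cast
      ring
    rw [hss]
    set t := (h x).toReal with ht
    have ht0 : 0 ≤ t := ENNReal.toReal_nonneg
    have hht : h x = ENNReal.ofReal t := (ENNReal.ofReal_toReal h5.ne).symm
    rw [hht, ← ofReal_norm, ← ofReal_norm, ← ENNReal.ofReal_sub _ ht0]
    have hfac : f x - f x * ((t / max ‖f x‖ t : ℝ) : 𝕜) =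
        f x * ((1 - t / max ‖f x‖ t : ℝ) : 𝕜) := by push_cast; ring
    have h01 : 0 ≤ 1 - t / max ‖f x‖ t :=
      sub_nonneg.2 (div_le_one_of_le₀ (le_max_right _ _) (ht0.trans (le_max_right _ _)))
    rw [hfac, norm_mul, RCLike.norm_of_nonneg h01]
    rcases le_or_gt ‖f x‖ t with hle' | hlt
    · rw [max_eq_right hle']
      rcases eq_or_lt_of_le ht0 with h0 | h0
      · have : ‖f x‖ = 0 := le_antisymm (h0 ▸ hle') (norm_nonneg _)
        simp [this]
      · simp [div_self h0.ne']
    · rw [max_eq_left hlt.le]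
      have : 0 < ‖f x‖ := ht0.trans_lt hlt
      refine ENNReal.ofReal_le_ofReal (le_of_eq ?_)
      field_simp

/-- The image of a ball of `L²` under `g ↦ √h g` is a weakly compact set in a space isometric to
`L¹(μ)`, and each element is at most as far from it as from the order interval `[-h, h]`. -/
theorem deBlasi_le_intervalExcess (e : Z ≃ₗᵢ[𝕜] Lp 𝕜 1 μ) (A : Set Z) {h : α → ℝ≥0∞}
    (hm : Measurable h) (hi : ∫⁻ x, h x ∂μ ≠ ∞) : deBlasi 𝕜 A ≤ intervalExcess e A h := by
  obtain ⟨s, hs⟩ := exists_sqrt_lTwo (𝕜 := 𝕜) hm hi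
  have hfin : ∀ᵐ x ∂μ, h x < ∞ := ae_lt_top hm hi
  let S : Lp 𝕜 2 μ →L[𝕜] Z := (e.symm : Lp 𝕜 1 μ →L[𝕜] Z).comp (mulLTwo s)
  refine (iInf₂_le (S '' closedBall 0 ‖s‖) ⟨_, ⟨0, by simp, rfl⟩⟩).trans ?_
  refine (iInf_le _ (isWeaklyCompact_image_closedBall S ‖s‖)).trans ?_
  refine iSup₂_mono fun z hz => ?_
  obtain ⟨g, hg, hzg⟩ := exists_truncation hfin hs (e z)
  have hmem : S g ∈ S '' closedBall 0 ‖s‖ := ⟨g, by simpa using hg, rfl⟩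
  refine (infEDist_le_edist_of_mem hmem).trans ?_
  refine le_trans (le_of_eq ?_) hzg
  have : z = e.symm (e z) := by simp
  conv_lhs => rw [this]
  change edist (e.symm (e z)) (e.symm (mulLTwo s g)) = _
  rw [e.symm.isometry.edist_eq, edist_eq_enorm_sub]

end LOne

/-! ### The Dunford–Pettis property of `L¹` preduals -/

section DunfordPettis

variable {𝕜 : Type*} [RCLike 𝕜] {X : Type*} [NormedAddCommGroup X] [NormedSpace 𝕜 X]
  {α : Type*} [MeasurableSpace α] {μ : Measure α}

/-- The functional on `X` that corresponds to the function `|s|² 1_A` in `L¹`, which is the product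
of `s` and of the conjugate of `s` on `A`; its norm is the integral of `|s|²` over `A`. -/
theorem exists_functional_indicator (e : StrongDual 𝕜 X ≃ₗᵢ[𝕜] Lp 𝕜 1 μ) (s : Lp 𝕜 2 μ) {A : Set α}
    (hA : MeasurableSet A) :
    ∃ g : Lp 𝕜 2 μ, (g =ᵐ[μ] A.indicator fun x => starRingEnd 𝕜 (s x)) ∧
      ‖e.symm (mulLTwo s g)‖ₑ = (μ.withDensity fun x => ((‖s x‖₊ ^ 2 : ℝ≥0) : ℝ≥0∞)) A := by
  have hm : MemLp (A.indicator fun x => starRingEnd 𝕜 (s x)) 2 μ :=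
    MemLp.indicator hA ((Lp.memLp s).of_le (RCLike.continuous_conj.comp_aestronglyMeasurable
      (Lp.aestronglyMeasurable s)) (ae_of_all _ fun x => by simp))
  refine ⟨hm.toLp _, hm.coeFn_toLp, ?_⟩
  have : ‖e.symm (mulLTwo s (hm.toLp _))‖ₑ = ‖mulLTwo s (hm.toLp _)‖ₑ := by
    rw [← ofReal_norm, ← ofReal_norm, e.symm.norm_map]
  rw [this, Lp.enorm_def, eLpNorm_one_eq_lintegral_enorm, withDensity_apply _ hA,
    ← lintegral_indicator hA]
  refine lintegral_congr_ae ?_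
  filter_upwards [coeFn_mulLTwo s (hm.toLp _), hm.coeFn_toLp] with x h1 h2
  rw [h1, h2]
  by_cases hx : x ∈ A
  · simp [hx, enorm_eq_nnnorm, sq]
  · simp [hx]

/-- Let `X* ≅ L¹(μ)` and let elements `u n` of `X` act on `|s|² dμ` through functions `w n`. Almost
every point `x` gives rise to a functional in the unit ball of `X*` that takes at each `u n` the
value `w n x`: a weak* cluster point of averages over the sets where `w 0, …, w m` are close to
their values at `x`. -/
theorem ae_exists_functional_eq (e : StrongDual 𝕜 X ≃ₗᵢ[𝕜] Lp 𝕜 1 μ) (s : Lp 𝕜 2 μ) (u : ℕ → X)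
    (w : ℕ → α → 𝕜) (hw : ∀ n, Measurable (w n))
    (hint : ∀ n, Integrable (w n) (μ.withDensity fun x => ((‖s x‖₊ ^ 2 : ℝ≥0) : ℝ≥0∞)))
    (hu : ∀ (n : ℕ) (A : Set α), MeasurableSet A → ∀ g : Lp 𝕜 2 μ,
      (g =ᵐ[μ] A.indicator fun x => starRingEnd 𝕜 (s x)) → e.symm (mulLTwo s g) (u n) =
        ∫ x in A, w n x ∂(μ.withDensity fun x => ((‖s x‖₊ ^ 2 : ℝ≥0) : ℝ≥0∞))) :
    ∀ᵐ x ∂(μ.withDensity fun x => ((‖s x‖₊ ^ 2 : ℝ≥0) : ℝ≥0∞)),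
      ∃ φ : StrongDual 𝕜 X, ‖φ‖ ≤ 1 ∧ ∀ n, φ (u n) = w n x := by
  set ν := μ.withDensity fun x => ((‖s x‖₊ ^ 2 : ℝ≥0) : ℝ≥0∞) with hν
  have hfin : IsFiniteMeasure ν := by
    refine isFiniteMeasure_withDensity ?_
    have := (Lp.memLp s).eLpNorm_lt_top
    rw [eLpNorm_lt_top_iff_lintegral_rpow_enorm_lt_top (by simp) (by simp)] at this
    simpa [enorm_eq_nnnorm] using this.ne
  let W : α → ℕ → 𝕜 := fun x n => w n x
  have hW : Measurable W := measurable_pi_lambda _ hw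
  have hsupp : ∀ᵐ x ∂ν, W x ∈ (ν.map W).support := ae_of_ae_map hW.aemeasurable
    Measure.support_mem_ae
  filter_upwards [hsupp] with x hx
  -- Let `φ m` be the average over the set where `w 0, …, w m` are close to their values at `x`. That
  -- set is not null since `W x` lies in the support of the distribution of `W`.
  let U : ℕ → Set (ℕ → 𝕜) := fun m =>
    {y | ∀ n ∈ Finset.range (m + 1), dist (y n) (w n x) < 1 / (m + 1)}
  have hUo : ∀ m, IsOpen (U m) := fun m => by
    simp only [U, Set.ofPred_forall]
    refine isOpen_biInter_finset fun n _ => ?_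
    exact isOpen_lt (by fun_prop) continuous_const
  have hpos : ∀ m, 0 < ν (W ⁻¹' U m) := fun m => by
    rw [← Measure.map_apply hW (hUo m).measurableSet]
    refine (Measure.mem_support_iff_forall _).1 hx _ ((hUo m).mem_nhds fun n _ => ?_)
    simp only [W, dist_self]
    positivity
  have hmeas : ∀ m, MeasurableSet (W ⁻¹' U m) := fun m => hW (hUo m).measurableSet
  choose g hg hgn using fun m => exists_functional_indicator e s (hmeas m)
  let φ : ℕ → StrongDual 𝕜 X := fun m =>
    (((ν (W ⁻¹' U m)).toReal⁻¹ : ℝ) : 𝕜) • e.symm (mulLTwo s (g m))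
  have hposr : ∀ m, 0 < (ν (W ⁻¹' U m)).toReal := fun m =>
    ENNReal.toReal_pos (hpos m).ne' (measure_ne_top _ _)
  have hφ1 : ∀ m, ‖φ m‖ ≤ 1 := fun m => by
    have : ‖e.symm (mulLTwo s (g m))‖ = (ν (W ⁻¹' U m)).toReal := by
      rw [← hgn m, toReal_enorm]
    rw [norm_smul, this, RCLike.norm_of_nonneg (inv_nonneg.2 (hposr m).le),
      inv_mul_cancel₀ (hposr m).ne']
  have hφu : ∀ n m, n ≤ m → dist (φ m (u n)) (w n x) ≤ 1 / (m + 1) := fun n m hnm => by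
    have h1 : φ m (u n) = (((ν (W ⁻¹' U m)).toReal⁻¹ : ℝ) : 𝕜) * ∫ y in W ⁻¹' U m, w n y ∂ν := by
      rw [← hu n _ (hmeas m) (g m) (hg m)]
      rfl
    have h2 : φ m (u n) - w n x =
        (((ν (W ⁻¹' U m)).toReal⁻¹ : ℝ) : 𝕜) * ∫ y in W ⁻¹' U m, (w n y - w n x) ∂ν := by
      rw [integral_sub (hint n).integrableOn (integrable_const _), setIntegral_const, h1,
        mul_sub, Measure.real, RCLike.real_smul_eq_coe_mul, ← mul_assoc, ← RCLike.ofReal_mul,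
        inv_mul_cancel₀ (hposr m).ne', RCLike.ofReal_one, one_mul]
    rw [dist_eq_norm, h2, norm_mul, RCLike.norm_of_nonneg (inv_nonneg.2 (hposr m).le)]
    have h3 : ‖∫ y in W ⁻¹' U m, (w n y - w n x) ∂ν‖ ≤ 1 / (m + 1) * ν.real (W ⁻¹' U m) := by
      refine norm_setIntegral_le_of_norm_le_const (measure_lt_top _ _) fun y hy => ?_
      rw [← dist_eq_norm]
      exact (hy n (by simpa [Nat.lt_succ_iff] using hnm)).le
    rw [inv_mul_le_iff₀ (hposr m), mul_comm]
    exact h3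
  obtain ⟨ψ, hψ, hlim⟩ := (WeakDual.isCompact_closedBall (𝕜 := 𝕜) (0 : StrongDual 𝕜 X)
    1).ultrafilter_le_nhds ((hyperfilter ℕ).map fun m => StrongDual.toWeakDual (φ m)) (by
      rw [le_principal_iff]
      exact Filter.mem_map.2 (Eventually.of_forall fun m => by simpa using hφ1 m))
  refine ⟨WeakDual.toStrongDual ψ, by simpa using hψ, fun n => ?_⟩
  have h1 : Tendsto (fun m => φ m (u n)) (hyperfilter ℕ : Filter ℕ) (𝓝 (ψ (u n))) :=
    ((WeakDual.eval_continuous (u n)).tendsto ψ).comp hlim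
  have h2 : Tendsto (fun m => φ m (u n)) (hyperfilter ℕ : Filter ℕ) (𝓝 (w n x)) := by
    refine Tendsto.mono_left ?_ Nat.hyperfilter_le_atTop
    refine tendsto_iff_dist_tendsto_zero.2 (squeeze_zero' (Eventually.of_forall fun _ => dist_nonneg)
      ?_ tendsto_one_div_add_atTop_nhds_zero_nat)
    filter_upwards [eventually_ge_atTop n] with m hm using hφu n m hm
  exact tendsto_nhds_unique h1 h2

/-- The Dunford–Pettis property of an `L¹` predual, in the form that is needed: a bounded weakly
null sequence of `X` converges to zero uniformly on the image in `X* ≅ L¹(μ)` of a ball of `L²`.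
On this image an element of `X` acts as a function on the measure `|s|² dμ`, with norm that of
`L²`; by `ae_exists_functional_eq` the functions that come from the sequence are bounded and
converge to zero almost everywhere, so that dominated convergence applies. -/
theorem tendsto_norm_comp_mulLTwo (e : StrongDual 𝕜 X ≃ₗᵢ[𝕜] Lp 𝕜 1 μ) (s : Lp 𝕜 2 μ) (u : ℕ → X)
    {C : ℝ} (hC : ∀ n, ‖u n‖ ≤ C)
    (hu : ∀ φ : StrongDual 𝕜 X, Tendsto (fun n => φ (u n)) atTop (𝓝 0)) :
    Tendsto (fun n => ‖(inclusionInDoubleDual 𝕜 X (u n)).comp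
      ((e.symm : Lp 𝕜 1 μ →L[𝕜] StrongDual 𝕜 X).comp (mulLTwo s))‖) atTop (𝓝 0) := by
  set R : ℕ → StrongDual 𝕜 (Lp 𝕜 2 μ) := fun n => (inclusionInDoubleDual 𝕜 X (u n)).comp
      ((e.symm : Lp 𝕜 1 μ →L[𝕜] StrongDual 𝕜 X).comp (mulLTwo s)) with hR
  have hRapp : ∀ n g, R n g = e.symm (mulLTwo s g) (u n) := fun n g => rfl
  set ν := μ.withDensity fun x => ((‖s x‖₊ ^ 2 : ℝ≥0) : ℝ≥0∞) with hν
  have hsm : Measurable fun x => ‖s x‖₊ ^ 2 := (Lp.stronglyMeasurable s).measurable.nnnorm.pow_const 2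
  -- `v n` is the Riesz representative of `R n`, and `w n` the density `conj (v n) / s`, which is `0`
  -- where `s` vanishes
  let v : ℕ → Lp 𝕜 2 μ := fun n => (InnerProductSpace.toDual 𝕜 (Lp 𝕜 2 μ)).symm (R n)
  have hv : ∀ n g, R n g = ∫ x, g x * starRingEnd 𝕜 (v n x) ∂μ := fun n g => by
    rw [← InnerProductSpace.toDual_symm_apply (y := R n), L2.inner_def]
    simp [v, RCLike.inner_apply]
  have hnv : ∀ n, ‖R n‖ = ‖v n‖ := fun n => by simp [v]
  let w : ℕ → α → 𝕜 := fun n x => starRingEnd 𝕜 (v n x) / s x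
  have hw : ∀ n, Measurable (w n) := fun n =>
    ((RCLike.continuous_conj.measurable).comp (Lp.stronglyMeasurable (v n)).measurable).div
      (Lp.stronglyMeasurable s).measurable
  have hwv : ∀ n x, ((‖s x‖₊ ^ 2 : ℝ≥0)) • w n x = starRingEnd 𝕜 (s x) * starRingEnd 𝕜 (v n x) := by
    intro n x
    rw [NNReal.smul_def, RCLike.real_smul_eq_coe_mul]
    by_cases h0 : s x = 0
    · simp [h0]
    · have : ((((‖s x‖₊ ^ 2 : ℝ≥0) : ℝ)) : 𝕜) = starRingEnd 𝕜 (s x) * s x := by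
        rw [RCLike.conj_mul]; simp
      rw [this]
      simp only [w]
      field_simp
  have hsv : ∀ n, Integrable (fun x => starRingEnd 𝕜 (s x) * starRingEnd 𝕜 (v n x)) μ := fun n => by
    have h1 : MemLp (fun x => starRingEnd 𝕜 (s x)) 2 μ := (Lp.memLp s).star
    have h2 : MemLp (fun x => starRingEnd 𝕜 (v n x)) 2 μ := (Lp.memLp (v n)).star
    exact h1.integrable_mul h2
  have hint : ∀ n, Integrable (w n) ν := fun n => by
    rw [hν, integrable_withDensity_iff_integrable_smul hsm]
    simpa only [hwv] using hsv n
  have hev := ae_exists_functional_eq e s u w hw hint (fun n A hA g hg => by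
    rw [setIntegral_withDensity_eq_setIntegral_smul hsm _ hA]
    simp only [hwv]
    rw [← hRapp, hv, ← integral_indicator hA]
    refine integral_congr_ae ?_
    filter_upwards [hg] with x hx
    rw [hx]
    by_cases hxA : x ∈ A <;> simp [hxA])
  -- `w n → 0` boundedly, and the norm of `R n` is at most that of `w n` in `L²(ν)`
  have hlim : Tendsto (fun n => ∫ x, ‖w n x‖ ^ 2 ∂ν) atTop (𝓝 (∫ _, (0 : ℝ) ∂ν)) := by
    have hfin : IsFiniteMeasure ν := by
      refine isFiniteMeasure_withDensity ?_
      have := (Lp.memLp s).eLpNorm_lt_top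
      rw [eLpNorm_lt_top_iff_lintegral_rpow_enorm_lt_top (by simp) (by simp)] at this
      simpa [enorm_eq_nnnorm] using this.ne
    refine tendsto_integral_of_dominated_convergence (fun _ => C ^ 2)
      (fun n => ((hw n).norm.pow_const 2).aestronglyMeasurable) (integrable_const _) (fun n => ?_) ?_
    · filter_upwards [hev] with x ⟨φ, hφ, hφu⟩
      rw [← hφu n, Real.norm_of_nonneg (by positivity)]
      refine pow_le_pow_left₀ (norm_nonneg _) ?_ 2
      exact (φ.le_of_opNorm_le hφ (u n)).trans (by simpa using hC n)
    · filter_upwards [hev] with x ⟨φ, hφ, hφu⟩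
      have := ((hu φ).norm).pow 2
      simpa [hφu] using this
  rw [integral_zero] at hlim
  have hnorm : ∀ n, ‖R n‖ ^ 2 ≤ ∫ x, ‖w n x‖ ^ 2 ∂ν := fun n => by
    have hA : MeasurableSet {x | s x ≠ 0} :=
      ((Lp.stronglyMeasurable s).measurable (measurableSet_singleton 0)).compl
    have hm : MemLp ({x | s x ≠ 0}.indicator (v n)) 2 μ := (Lp.memLp (v n)).indicator hA
    -- `R n` does not see the values of a function where `s` vanishes
    have h1 : mulLTwo s (hm.toLp _) = mulLTwo s (v n) := by
      refine Lp.ext ?_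
      filter_upwards [coeFn_mulLTwo s (hm.toLp _), coeFn_mulLTwo s (v n), hm.coeFn_toLp]
        with x h1 h2 h3
      rw [h1, h2, h3]
      by_cases hx : s x = 0 <;> simp [hx]
    have h2 : ((‖v n‖ ^ 2 : ℝ) : 𝕜) = R n (v n) := by
      rw [← InnerProductSpace.toDual_symm_apply (y := R n)]
      push_cast
      exact (inner_self_eq_norm_sq_to_K (v n)).symm
    have h3 : R n (v n) = ((∫ x, ‖w n x‖ ^ 2 ∂ν : ℝ) : 𝕜) := by
      rw [hRapp, ← h1, ← hRapp, hv, hν, integral_withDensity_eq_integral_smul hsm,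
        ← integral_ofReal]
      refine integral_congr_ae ?_
      filter_upwards [hm.coeFn_toLp] with x hx
      rw [hx]
      by_cases h0 : s x = 0
      · simp [h0]
      · have : ‖s x‖ ≠ 0 := norm_ne_zero_iff.2 h0
        simp only [Set.indicator, Set.mem_ofPred_eq, h0, not_false_eq_true, if_true, ne_eq, w,
          RCLike.mul_conj, NNReal.smul_def, norm_div, RCLike.norm_conj, smul_eq_mul]
        push_cast
        have h' : ((‖s x‖ : ℝ) : 𝕜) ≠ 0 := by exact_mod_cast this
        field_simp
    rw [h3] at h2
    rw [hnv]
    exact (RCLike.ofReal_injective h2).le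
  have hsq : Tendsto (fun n => ‖R n‖ ^ 2) atTop (𝓝 0) :=
    squeeze_zero (fun n => by positivity) hnorm hlim
  have := hsq.sqrt
  simp only [Real.sqrt_sq (norm_nonneg _), Real.sqrt_zero] at this
  exact this

variable {Y : Type*} [NormedAddCommGroup Y] [NormedSpace 𝕜 Y]

/-- Differences `u k` of far terms of a weakly Cauchy sequence in the unit ball have norm at most `2`
and are weakly null. A functional `y'` that norms `T (u k)` satisfies `T* y' ≈ √h g` up to the
excess over `[-h, h]`, and `√h g` is small at `u k` by the Dunford–Pettis property. -/
theorem cc_le_intervalExcess (e : StrongDual 𝕜 X ≃ₗᵢ[𝕜] Lp 𝕜 1 μ) (T : X →L[𝕜] Y)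
    {h : α → ℝ≥0∞} (hm : Measurable h) (hi : ∫⁻ x, h x ∂μ ≠ ∞) :
    cc T ≤ 2 * intervalExcess e (dualOp T '' closedBall 0 1) h := by
  obtain ⟨s, hs⟩ := exists_sqrt_lTwo (𝕜 := 𝕜) hm hi
  have hfin : ∀ᵐ x ∂μ, h x < ∞ := ae_lt_top hm hi
  refine iSup₂_le fun x hx => iSup_le fun hxc => ?_
  by_contra hcon
  rw [not_le] at hcon
  obtain ⟨c, hc1, hc2⟩ := exists_between hcon
  have hcfin : c ≠ ∞ := (hc2.trans_le le_top).ne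
  have hex : ∀ N, ∃ m, N ≤ m ∧ ∃ n, N ≤ n ∧ c < edist (T (x m)) (T (x n)) := fun N => by
    have := hc2.trans_le (iInf_le _ N)
    simpa only [lt_iSup_iff, exists_prop] using this
  choose m hm' n hn' hmn using hex
  let u : ℕ → X := fun k => x (m k) - x (n k)
  have hu2 : ∀ k, ‖u k‖ ≤ 2 := fun k => by
    have h1 := mem_closedBall_zero_iff.1 (hx (m k))
    have h2 := mem_closedBall_zero_iff.1 (hx (n k))
    exact (norm_sub_le _ _).trans (by linarith)
  have hu0 : ∀ φ : StrongDual 𝕜 X, Tendsto (fun k => φ (u k)) atTop (𝓝 0) := fun φ => by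
    obtain ⟨a, ha⟩ := cauchySeq_tendsto_of_complete (hxc φ)
    have h1 := ha.comp (tendsto_atTop_mono hm' tendsto_id)
    have h2 := ha.comp (tendsto_atTop_mono hn' tendsto_id)
    simpa [u, Function.comp_def] using h1.sub h2
  have hlim := tendsto_norm_comp_mulLTwo e s u hu2 hu0
  set θ := intervalExcess e (dualOp T '' closedBall 0 1) h with hθ
  have hθfin : θ ≠ ∞ := by
    intro htop
    rw [htop] at hc1
    simp at hc1
  have hbound : ∀ k, ‖T (u k)‖ ≤ 2 * θ.toReal + ‖(inclusionInDoubleDual 𝕜 X (u k)).comp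
      ((e.symm : Lp 𝕜 1 μ →L[𝕜] StrongDual 𝕜 X).comp (mulLTwo s))‖ * ‖s‖ := fun k => by
    obtain ⟨y', hy', hyT⟩ := exists_dual_vector'' 𝕜 (T (u k))
    obtain ⟨g, hg, hgs⟩ := exists_truncation hfin hs (e (dualOp T y'))
    have h1 : ‖e (dualOp T y') - mulLTwo s g‖ₑ ≤ θ := hgs.trans
      (le_iSup₂ (f := fun z (_ : z ∈ dualOp T '' closedBall 0 1) =>
        ∫⁻ x, (‖e z x‖ₑ - h x) ∂μ) _ ⟨y', by simpa using hy', rfl⟩)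
    have h2 : ‖dualOp T y' - e.symm (mulLTwo s g)‖ ≤ θ.toReal := by
      rw [← e.norm_map, map_sub, e.apply_symm_apply, ← toReal_enorm]
      exact ENNReal.toReal_mono hθfin h1
    have h3 : ((‖T (u k)‖ : ℝ) : 𝕜) = (dualOp T y' - e.symm (mulLTwo s g)) (u k) +
        ((inclusionInDoubleDual 𝕜 X (u k)).comp
      ((e.symm : Lp 𝕜 1 μ →L[𝕜] StrongDual 𝕜 X).comp (mulLTwo s))) g := by
      rw [← hyT]
      change y' (T (u k)) = y' (T (u k)) - _ + _
      exact (sub_add_cancel _ _).symm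
    have h4 : ‖T (u k)‖ = ‖((‖T (u k)‖ : ℝ) : 𝕜)‖ := by simp
    rw [h4, h3]
    refine (norm_add_le _ _).trans (add_le_add ?_ ?_)
    · refine (ContinuousLinearMap.le_of_opNorm_le_of_le _ h2 (hu2 k)).trans (le_of_eq (mul_comm _ _))
    · exact ContinuousLinearMap.le_opNorm_of_le _ hg
  have hc' : ∀ k, c.toReal ≤ ‖T (u k)‖ := fun k => by
    have := hmn k
    rw [edist_dist, dist_eq_norm, ← map_sub] at this
    exact ENNReal.toReal_le_of_le_ofReal (norm_nonneg _) this.le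
  have h5 : c.toReal ≤ 2 * θ.toReal + 0 * ‖s‖ :=
    ge_of_tendsto (tendsto_const_nhds.add (hlim.mul_const _))
      (Eventually.of_forall fun k => (hc' k).trans (hbound k))
  have h6 : (2 * θ).toReal < c.toReal := (ENNReal.toReal_lt_toReal
    (ENNReal.mul_ne_top (by simp) hθfin) hcfin).2 hc1
  rw [ENNReal.toReal_mul] at h6
  simp at h5 h6
  linarith

end DunfordPettis

/-! ### Concentration on disjoint sets -/

section Concentration

variable {α : Type*} [MeasurableSpace α] {μ : Measure α}

/-- Let the functions `b i` stick out of every order interval `[0, G]` by at least `c - ε` for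
some `i`, but out of `[0, h]` by at most `c + ε` for all `i`. Then some sequence of them has mass
about `c` on disjoint sets `D k`, and hardly any mass on the other `D j`. The index `i k` is chosen
so as to stick out of a large multiple of `h + b (i 0) + ⋯ + b (i (k - 1))`. -/
theorem exists_disjoint_concentration {ι : Type*} (b : ι → α → ℝ≥0∞) (hb : ∀ i, Measurable (b i))
    {M : ℝ≥0∞} (hM : M ≠ ∞) (hbM : ∀ i, ∫⁻ x, b i x ∂μ ≤ M) {c ε : ℝ≥0∞} (hε : ε ≠ 0)
    {h : α → ℝ≥0∞} (hm : Measurable h) (hi : ∫⁻ x, h x ∂μ ≠ ∞)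
    (hle : ∀ i, ∫⁻ x, (b i x - h x) ∂μ ≤ c + ε)
    (hge : ∀ G : α → ℝ≥0∞, Measurable G → ∫⁻ x, G x ∂μ ≠ ∞ →
      ∃ i, c ≤ ∫⁻ x, (b i x - G x) ∂μ + ε) :
    ∃ (i : ℕ → ι) (D : ℕ → Set α), (∀ k, MeasurableSet (D k)) ∧
      Pairwise (Function.onFun Disjoint D) ∧
      (∀ k, c ≤ ∫⁻ x in D k, b (i k) x ∂μ + 2 * ε) ∧
      ∀ k, ∫⁻ x in ⋃ j ∈ {j | j ≠ k}, D j, b (i k) x ∂μ ≤ 4 * ε := by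
  obtain ⟨δ, hδ0, hδ⟩ := ENNReal.exists_pos_sum_of_countable' hε ℕ
  -- The factor `N k` is so large that the set `E k` where `b (i k)` exceeds `N k * G k` carries at
  -- most the mass `δ k` of `G k`. The set `D k` is `E k` without the later sets `E j`.
  let N : ℕ → ℝ≥0∞ := fun k => max 1 ((M + 1) / δ k)
  have hNfin : ∀ k, N k ≠ ∞ := fun k => by
    simp only [N, ne_eq, max_eq_top, ENNReal.one_ne_top, false_or]
    exact ENNReal.div_ne_top (by finiteness) (hδ0 k).ne'
  let State := {G : α → ℝ≥0∞ // Measurable G ∧ ∫⁻ x, G x ∂μ ≠ ∞}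
  have hpick : ∀ (k : ℕ) (G : State), ∃ i, c ≤ ∫⁻ x, (b i x - N k * G.1 x) ∂μ + ε := fun k G =>
    hge _ (G.2.1.const_mul _) (by
      rw [lintegral_const_mul _ G.2.1]
      exact ENNReal.mul_ne_top (hNfin k) G.2.2)
  choose pick hpick using hpick
  let next : ℕ → State → State := fun k G => ⟨fun x => G.1 x + b (pick k G) x,
    G.2.1.add (hb _), by
      rw [lintegral_add_left G.2.1]
      exact ENNReal.add_ne_top.2 ⟨G.2.2, ((hbM _).trans_lt hM.lt_top).ne⟩⟩
  let G : ℕ → State := fun k => Nat.rec ⟨h, hm, hi⟩ next k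
  let i : ℕ → ι := fun k => pick k (G k)
  have hG0 : (G 0).1 = h := rfl
  have hGs : ∀ k x, (G (k + 1)).1 x = (G k).1 x + b (i k) x := fun k x => rfl
  have hGmono : ∀ x, Monotone fun k => (G k).1 x := fun x =>
    monotone_nat_of_le_succ fun k => by rw [hGs]; exact le_self_add
  have hGm : ∀ k, Measurable (G k).1 := fun k => (G k).2.1
  have hhG : ∀ k x, h x ≤ (G k).1 x := fun k x => hGmono x (Nat.zero_le k)
  have hbG : ∀ j k, j < k → ∀ x, b (i j) x ≤ (G k).1 x := fun j k hjk x =>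
    le_trans (le_add_self.trans_eq (hGs j x).symm) (hGmono x (Nat.succ_le_of_lt hjk))
  let E : ℕ → Set α := fun k => {x | N k * (G k).1 x < b (i k) x}
  have hE : ∀ k, MeasurableSet (E k) := fun k => measurableSet_lt ((hGm k).const_mul _) (hb _)
  have hEG : ∀ k, ∫⁻ x in E k, (G k).1 x ∂μ ≤ δ k := fun k => by
    have h1 : (M + 1) / δ k * ∫⁻ x in E k, (G k).1 x ∂μ ≤ M + 1 := by
      calc (M + 1) / δ k * ∫⁻ x in E k, (G k).1 x ∂μ ≤ N k * ∫⁻ x in E k, (G k).1 x ∂μ := by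
            gcongr; exact le_max_right _ _
        _ = ∫⁻ x in E k, N k * (G k).1 x ∂μ := (lintegral_const_mul _ (hGm k)).symm
        _ ≤ ∫⁻ x in E k, b (i k) x ∂μ := setLIntegral_mono (hb _) fun x hx => le_of_lt hx
        _ ≤ M := (setLIntegral_le_lintegral _ _).trans (hbM _)
        _ ≤ M + 1 := le_self_add
    by_cases hd : δ k = ∞
    · simp [hd]
    have h2 : (M + 1) / δ k ≠ 0 := (ENNReal.div_pos (by simp) hd).ne'
    have h3 : (M + 1) / δ k ≠ ∞ := ENNReal.div_ne_top (by finiteness) (hδ0 k).ne'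
    calc ∫⁻ x in E k, (G k).1 x ∂μ ≤ (M + 1) / ((M + 1) / δ k) :=
          (ENNReal.le_div_iff_mul_le (Or.inl h2) (Or.inl h3)).2 (by rwa [mul_comm])
      _ = δ k := ENNReal.div_div_cancel (by simp) (by finiteness)
  -- the part of `b (i k)` above `N k * G k` lives on `E k`
  have hsplit : ∀ k, ∫⁻ x, (b (i k) x - N k * (G k).1 x) ∂μ =
      ∫⁻ x in E k, (b (i k) x - N k * (G k).1 x) ∂μ := fun k => by
    rw [← lintegral_add_compl _ (hE k)]
    have : ∫⁻ x in (E k)ᶜ, (b (i k) x - N k * (G k).1 x) ∂μ = ∫⁻ x in (E k)ᶜ, 0 ∂μ :=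
      setLIntegral_congr_fun (hE k).compl fun x hx => tsub_eq_zero_of_le (not_lt.1 hx)
    rw [this, lintegral_zero, add_zero]
  have hcE : ∀ k, c ≤ ∫⁻ x in E k, b (i k) x ∂μ + ε := fun k =>
    (hpick k (G k)).trans
      (add_le_add ((hsplit k).trans_le (lintegral_mono fun x => tsub_le_self)) le_rfl)
  have hcompl : ∀ k, ∫⁻ x in (E k)ᶜ, (b (i k) x - h x) ∂μ ≤ 2 * ε := fun k => by
    have h1 : ∫⁻ x in E k, (b (i k) x - N k * (G k).1 x) ∂μ ≤
        ∫⁻ x in E k, (b (i k) x - h x) ∂μ := by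
      refine lintegral_mono fun x => tsub_le_tsub_left ?_ _
      calc h x ≤ 1 * (G k).1 x := by rw [one_mul]; exact hhG k x
        _ ≤ N k * (G k).1 x := by gcongr; exact le_max_left _ _
    have h2 : ∫⁻ x in E k, (b (i k) x - h x) ∂μ ≠ ∞ :=
      ((lintegral_mono fun x => tsub_le_self).trans
        ((setLIntegral_le_lintegral _ _).trans (hbM _))).trans_lt hM.lt_top |>.ne
    refine (ENNReal.add_le_add_iff_left h2).1 ?_
    calc ∫⁻ x in E k, (b (i k) x - h x) ∂μ + ∫⁻ x in (E k)ᶜ, (b (i k) x - h x) ∂μ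
        = ∫⁻ x, (b (i k) x - h x) ∂μ := lintegral_add_compl _ (hE k)
      _ ≤ c + ε := hle _
      _ ≤ (∫⁻ x in E k, (b (i k) x - h x) ∂μ + ε) + ε := by
          gcongr
          exact (hpick k (G k)).trans (add_le_add ((hsplit k).trans_le h1) le_rfl)
      _ = ∫⁻ x in E k, (b (i k) x - h x) ∂μ + 2 * ε := by ring
  let V : ℕ → Set α := fun k => ⋃ j ∈ {j | k < j}, E j
  have hV : ∀ k, MeasurableSet (V k) := fun k =>
    MeasurableSet.biUnion (Set.to_countable _) fun j _ => hE j
  -- a function that `G j` dominates for all `j` in `J` has small mass on the union of these `E j`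
  have hsum : ∀ (J : Set ℕ) (q : α → ℝ≥0∞), (∀ j ∈ J, ∀ x, q x ≤ (G j).1 x) →
      ∫⁻ x in ⋃ j ∈ J, E j, q x ∂μ ≤ ε := fun J q hq => by
    rw [Set.biUnion_eq_iUnion]
    calc ∫⁻ x in ⋃ j : J, E j, q x ∂μ ≤ ∑' j : J, ∫⁻ x in E j, q x ∂μ := lintegral_iUnion_le _ _
      _ ≤ ∑' j : J, δ j := ENNReal.tsum_le_tsum fun j =>
          (lintegral_mono fun x => hq j j.2 x).trans (hEG j)
      _ ≤ ∑' j, δ j := ENNReal.tsum_comp_le_tsum_of_injective Subtype.val_injective _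
      _ ≤ ε := hδ.le
  have hVb : ∀ k, ∫⁻ x in V k, b (i k) x ∂μ ≤ ε := fun k => hsum _ _ fun j hj x => hbG k j hj x
  refine ⟨i, fun k => E k \ V k, fun k => (hE k).diff (hV k), ?_, fun k => ?_, fun k => ?_⟩
  · have key : ∀ j k, j < k → Disjoint (E j \ V j) (E k \ V k) := fun j k hjk =>
      Set.disjoint_left.2 fun x hx hx' => hx.2 (Set.mem_biUnion (show k ∈ {l | j < l} from hjk) hx'.1)
    intro j k hjk
    rcases lt_or_gt_of_ne hjk with hlt | hlt
    · exact key j k hlt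
    · exact (key k j hlt).symm
  · calc c ≤ ∫⁻ x in E k, b (i k) x ∂μ + ε := hcE k
      _ ≤ (∫⁻ x in E k \ V k, b (i k) x ∂μ + ∫⁻ x in V k, b (i k) x ∂μ) + ε := by
          gcongr
          refine (lintegral_mono_set ?_).trans (lintegral_union_le _ _ _)
          exact fun x hx => by by_cases hxV : x ∈ V k <;> simp [hx, hxV]
      _ ≤ (∫⁻ x in E k \ V k, b (i k) x ∂μ + ε) + ε := by gcongr; exact hVb k
      _ = _ := by ring
  · have hsub : (⋃ j ∈ {j | j ≠ k}, E j \ V j) ⊆ V k ∪ ((E k)ᶜ ∩ ⋃ j ∈ Set.univ, E j) := by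
      intro x hx
      simp only [Set.mem_iUnion, exists_prop] at hx
      obtain ⟨j, hj, hxj⟩ := hx
      rcases lt_or_gt_of_ne hj with hlt | hlt
      · refine Or.inr ⟨fun hxk => hxj.2 (Set.mem_biUnion (show k ∈ {l | j < l} from hlt) hxk), ?_⟩
        exact Set.mem_biUnion (Set.mem_univ j) hxj.1
      · exact Or.inl (Set.mem_biUnion (show j ∈ {l | k < l} from hlt) hxj.1)
    calc ∫⁻ x in ⋃ j ∈ {j | j ≠ k}, E j \ V j, b (i k) x ∂μ
        ≤ ∫⁻ x in V k, b (i k) x ∂μ + ∫⁻ x in (E k)ᶜ ∩ ⋃ j ∈ Set.univ, E j, b (i k) x ∂μ :=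
          (lintegral_mono_set hsub).trans (lintegral_union_le _ _ _)
      _ ≤ ε + (∫⁻ x in (E k)ᶜ, (b (i k) x - h x) ∂μ + ∫⁻ x in ⋃ j ∈ Set.univ, E j, h x ∂μ) := by
          gcongr
          · exact hVb k
          · calc ∫⁻ x in (E k)ᶜ ∩ ⋃ j ∈ Set.univ, E j, b (i k) x ∂μ
                ≤ ∫⁻ x in (E k)ᶜ ∩ ⋃ j ∈ Set.univ, E j, ((b (i k) x - h x) + h x) ∂μ :=
                  lintegral_mono fun x => le_tsub_add
              _ = ∫⁻ x in (E k)ᶜ ∩ ⋃ j ∈ Set.univ, E j, (b (i k) x - h x) ∂μ +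
                  ∫⁻ x in (E k)ᶜ ∩ ⋃ j ∈ Set.univ, E j, h x ∂μ := lintegral_add_right _ hm
              _ ≤ _ := add_le_add (lintegral_mono_set Set.inter_subset_left)
                  (lintegral_mono_set Set.inter_subset_right)
      _ ≤ ε + (2 * ε + ε) := by
          gcongr
          · exact hcompl k
          · exact hsum _ _ fun j _ x => hhG j x
      _ = 4 * ε := by ring

end Concentration

/-! ### The equality of both measures of weak noncompactness in `L¹` -/

section WkEqDeBlasi

variable {𝕜 : Type*} [RCLike 𝕜] {Z : Type*} [NormedAddCommGroup Z] [NormedSpace 𝕜 Z]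
  {α : Type*} [MeasurableSpace α] {μ : Measure α}

/-- Integration against a measurable function bounded by one is a continuous functional on `L¹`. -/
theorem exists_lOne_functional {s : α → 𝕜} (hs : Measurable s) (hs1 : ∀ x, ‖s x‖ ≤ 1) :
    ∃ Φ : StrongDual 𝕜 (Lp 𝕜 1 μ), ∀ f, Φ f = ∫ x, s x * f x ∂μ := by
  have hint : ∀ f : Lp 𝕜 1 μ, Integrable (fun x => s x * f x) μ := fun f =>
    (L1.integrable_coeFn f).bdd_mul hs.aestronglyMeasurable (ae_of_all _ hs1)
  let L : Lp 𝕜 1 μ →ₗ[𝕜] 𝕜 :=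
    { toFun := fun f => ∫ x, s x * f x ∂μ
      map_add' := fun f g => by
        rw [← integral_add (hint f) (hint g)]
        refine integral_congr_ae ?_
        filter_upwards [Lp.coeFn_add f g] with x hx
        rw [hx, Pi.add_apply, mul_add]
      map_smul' := fun r f => by
        rw [RingHom.id_apply, smul_eq_mul, ← integral_const_mul]
        refine integral_congr_ae ?_
        filter_upwards [Lp.coeFn_smul r f] with x hx
        rw [hx, Pi.smul_apply, smul_eq_mul]
        ring }
  refine ⟨L.mkContinuous 1 fun f => ?_, fun f => rfl⟩
  rw [one_mul, L1.norm_eq_integral_norm]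
  refine norm_integral_le_of_norm_le (L1.integrable_coeFn f).norm (ae_of_all _ fun x => ?_)
  rw [norm_mul]
  exact mul_le_of_le_one_left (norm_nonneg _) (hs1 x)

theorem lintegral_enorm_lOne (f : Lp 𝕜 1 μ) : ∫⁻ x, ‖f x‖ₑ ∂μ = ‖f‖ₑ := by
  rw [Lp.enorm_def, eLpNorm_one_eq_lintegral_enorm]

theorem enorm_functional_le {s : α → 𝕜} (hs1 : ∀ x, ‖s x‖ ≤ 1) {B : Set α} (hB : MeasurableSet B)
    (hsB : ∀ x ∉ B, s x = 0) (f : Lp 𝕜 1 μ) :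
    ‖∫ x, s x * f x ∂μ‖ₑ ≤ ∫⁻ x in B, ‖f x‖ₑ ∂μ := by
  refine (enorm_integral_le_lintegral_enorm _).trans ?_
  rw [← lintegral_indicator hB]
  refine lintegral_mono fun x => ?_
  by_cases hx : x ∈ B
  · rw [Set.indicator_of_mem hx, enorm_mul]
    refine mul_le_of_le_one_left zero_le ?_
    rw [← ofReal_norm, ← ENNReal.ofReal_one]
    exact ENNReal.ofReal_le_ofReal (hs1 x)
  · simp [hsB x hx]

/-- If a sequence in `A` concentrates with mass about `c` on disjoint sets, then a weak* cluster
point of it in the bidual has distance about `c` from `Z`: if `s` is the conjugate sign of the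
`k`-th term on the `k`-th set, integration against `s` over the sets from the `N`-th on takes values
about `c` at the cluster point for all `N`, but tends to zero at elements of `Z`. -/
theorem le_wk_of_concentration (e : Z ≃ₗᵢ[𝕜] Lp 𝕜 1 μ) {A : Set Z} {M : ℝ} (hA : ∀ z ∈ A, ‖z‖ ≤ M)
    {c ε : ℝ≥0∞} (hε : ε ≠ ∞) (z : ℕ → Z) (hz : ∀ k, z k ∈ A) {D : ℕ → Set α}
    (hD : ∀ k, MeasurableSet (D k)) (hdisj : Pairwise (Function.onFun Disjoint D))
    (hc : ∀ k, c ≤ ∫⁻ x in D k, ‖e (z k) x‖ₑ ∂μ + 2 * ε)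
    (hoff : ∀ k, ∫⁻ x in ⋃ j ∈ {j | j ≠ k}, D j, ‖e (z k) x‖ₑ ∂μ ≤ 4 * ε) :
    c ≤ wk 𝕜 A + 6 * ε := by
  -- `s` is the conjugate sign of `e (z k)` on `D k`
  let sg : 𝕜 → 𝕜 := fun y => starRingEnd 𝕜 y / ((‖y‖ : ℝ) : 𝕜)
  have hsgm : Measurable sg := (RCLike.continuous_conj.measurable).div
    (RCLike.measurable_ofReal.comp measurable_norm)
  have hsg1 : ∀ y, ‖sg y‖ ≤ 1 := fun y => by
    simp only [sg, norm_div, RCLike.norm_conj, RCLike.norm_ofReal, abs_norm]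
    exact div_self_le_one _
  have hsgmul : ∀ y, sg y * y = ((‖y‖ : ℝ) : 𝕜) := fun y => by
    by_cases hy : y = 0
    · simp [hy]
    · have : ((‖y‖ : ℝ) : 𝕜) ≠ 0 := by simpa using hy
      simp only [sg]
      field_simp
      rw [RCLike.conj_mul]
  obtain ⟨s₀, hs₀m, hs₀⟩ := exists_measurable_piecewise D hD
    (fun k x => sg (e (z k) x)) (fun k => hsgm.comp (Lp.stronglyMeasurable (e (z k))).measurable)
    (fun j k hjk x hx => ((hdisj hjk).le_bot hx).elim)
  let B : ℕ → Set α := fun N => ⋃ k ∈ {k | N ≤ k}, D k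
  have hBm : ∀ N, MeasurableSet (B N) := fun N =>
    MeasurableSet.biUnion (Set.to_countable _) fun k _ => hD k
  let s : ℕ → α → 𝕜 := fun N => (B N).indicator s₀
  have hsm : ∀ N, Measurable (s N) := fun N => hs₀m.indicator (hBm N)
  have hs1 : ∀ N x, ‖s N x‖ ≤ 1 := fun N x => by
    by_cases hx : x ∈ B N
    · simp only [s, Set.indicator_of_mem hx]
      obtain ⟨k, -, hk⟩ := Set.mem_iUnion₂.1 hx
      rw [hs₀ k hk]
      exact hsg1 _
    · simp [s, hx]
  choose Φ hΦ using fun N => exists_lOne_functional (μ := μ) (hsm N) (hs1 N)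
  let Ψ : ℕ → StrongDual 𝕜 Z := fun N => (Φ N).comp (e : Z →L[𝕜] Lp 𝕜 1 μ)
  have hΨ : ∀ N y, Ψ N y = ∫ x, s N x * e y x ∂μ := fun N y => hΦ N (e y)
  have hΨ1 : ∀ N, ‖Ψ N‖ ≤ 1 := fun N => by
    refine ContinuousLinearMap.opNorm_le_bound _ zero_le_one fun y => ?_
    have h1 := enorm_functional_le (hs1 N) MeasurableSet.univ (fun x hx => (hx trivial).elim) (e y)
    rw [Measure.restrict_univ, lintegral_enorm_lOne, ← hΨ] at h1
    rw [one_mul, ← e.norm_map y]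
    simpa [← toReal_enorm] using ENNReal.toReal_mono (by finiteness) h1
  have hbig : ∀ N k, N ≤ k → c ≤ ‖Ψ N (z k)‖ₑ + 6 * ε := fun N k hNk => by
    have hkB : D k ⊆ B N := fun x hx => Set.mem_biUnion (show k ∈ {l | N ≤ l} from hNk) hx
    have hint : Integrable (fun x => s N x * e (z k) x) μ :=
      (L1.integrable_coeFn _).bdd_mul (hsm N).aestronglyMeasurable (ae_of_all _ (hs1 N))
    have hA1 : ‖∫ x in D k, s N x * e (z k) x ∂μ‖ₑ = ∫⁻ x in D k, ‖e (z k) x‖ₑ ∂μ := by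
      have h1 : ∫ x in D k, s N x * e (z k) x ∂μ = ((∫ x in D k, ‖e (z k) x‖ ∂μ : ℝ) : 𝕜) := by
        rw [← integral_ofReal]
        refine setIntegral_congr_fun (hD k) fun x hx => ?_
        simp only [s, Set.indicator_of_mem (hkB hx), hs₀ k hx, hsgmul]
      rw [h1, ← ofReal_norm, RCLike.norm_of_nonneg (integral_nonneg fun x => norm_nonneg _),
        ofReal_integral_norm_eq_lintegral_enorm (L1.integrable_coeFn _).integrableOn]
    have hA2 : ‖∫ x in (D k)ᶜ, s N x * e (z k) x ∂μ‖ₑ ≤ 4 * ε := by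
      refine le_trans ?_ (hoff k)
      refine (enorm_integral_le_lintegral_enorm _).trans ?_
      have hU : MeasurableSet (⋃ j ∈ {j | j ≠ k}, D j) :=
        MeasurableSet.biUnion (Set.to_countable _) fun j _ => hD j
      rw [← lintegral_indicator (hD k).compl, ← lintegral_indicator hU]
      refine lintegral_mono fun x => ?_
      by_cases hx : x ∈ D k
      · simp [hx]
      rw [Set.indicator_of_mem (show x ∈ (D k)ᶜ from hx)]
      by_cases hxB : x ∈ B N
      · obtain ⟨j, -, hj⟩ := Set.mem_iUnion₂.1 hxB
        have hjk : j ≠ k := fun h => hx (h ▸ hj)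
        rw [Set.indicator_of_mem (Set.mem_biUnion (show j ∈ {l | l ≠ k} from hjk) hj), enorm_mul]
        refine mul_le_of_le_one_left zero_le ?_
        rw [← ofReal_norm, ← ENNReal.ofReal_one]
        exact ENNReal.ofReal_le_ofReal (hs1 N x)
      · simp [s, hxB]
    have hsplit := integral_add_compl (hD k) hint
    rw [hΨ, ← hsplit]
    calc c ≤ ‖∫ x in D k, s N x * e (z k) x ∂μ‖ₑ + 2 * ε := by rw [hA1]; exact hc k
      _ ≤ (‖(∫ x in D k, s N x * e (z k) x ∂μ) + ∫ x in (D k)ᶜ, s N x * e (z k) x ∂μ‖ₑ +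
          4 * ε) + 2 * ε := by
        gcongr
        refine le_trans ?_ (add_le_add le_rfl hA2)
        refine le_trans (le_of_eq ?_) (enorm_sub_le (E := 𝕜))
        rw [add_sub_cancel_right]
      _ = _ := by ring
  -- a weak* cluster point of the sequence
  obtain ⟨ζ, hζ, hlim⟩ := (WeakDual.isCompact_closedBall (𝕜 := 𝕜)
    (0 : StrongDual 𝕜 (StrongDual 𝕜 Z)) M).ultrafilter_le_nhds ((hyperfilter ℕ).map fun k =>
      StrongDual.toWeakDual (inclusionInDoubleDual 𝕜 Z (z k))) (by
      rw [le_principal_iff]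
      exact Filter.mem_map.2 (Eventually.of_forall fun k =>
        (mem_closedBall_zero_iff (E := StrongDual 𝕜 (StrongDual 𝕜 Z))).2
          ((double_dual_bound 𝕜 Z (z k)).trans (hA _ (hz k)))))
  have hζcl : ζ ∈ closure ((fun y : Z => StrongDual.toWeakDual (inclusionInDoubleDual 𝕜 Z y)) '' A) :=
    mem_closure_of_tendsto hlim
      (Filter.mem_map.2 (Eventually.of_forall fun k => ⟨z k, hz k, rfl⟩))
  have hζA : WeakDual.toStrongDual ζ ∈ bidualWeakStarClosure 𝕜 A := hζcl
  have hζΨ : ∀ N, c ≤ ‖ζ (Ψ N)‖ₑ + 6 * ε := fun N => by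
    have h1 : Tendsto (fun k => Ψ N (z k)) (hyperfilter ℕ : Filter ℕ) (𝓝 (ζ (Ψ N))) :=
      ((WeakDual.eval_continuous (Ψ N)).tendsto ζ).comp hlim
    refine ge_of_tendsto (h1.enorm.add_const _) ?_
    exact Nat.hyperfilter_le_atTop (eventually_ge_atTop N |>.mono fun k hk => hbig N k hk)
  have hdist : ∀ y : Z, c ≤ edist (WeakDual.toStrongDual ζ) (inclusionInDoubleDual 𝕜 Z y) +
      6 * ε := fun y => by
    have hy : Tendsto (fun N => ∫⁻ x in B N, ‖e y x‖ₑ ∂μ) atTop (𝓝 0) := by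
      have hanti : Antitone B := fun N N' hNN' => Set.biUnion_subset_biUnion_left
        fun k (hk : N' ≤ k) => hNN'.trans hk
      have hempty : ⋂ N, B N = ∅ := by
        refine Set.eq_empty_of_forall_notMem fun x hx => ?_
        rw [Set.mem_iInter] at hx
        obtain ⟨k, -, hk⟩ := Set.mem_iUnion₂.1 (hx 0)
        obtain ⟨j, hj, hxj⟩ := Set.mem_iUnion₂.1 (hx (k + 1))
        have hjk : k ≠ j := fun h => by
          simp only [Set.mem_ofPred_eq] at hj; omega
        exact (hdisj hjk).le_bot ⟨hk, hxj⟩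
      have hν : IsFiniteMeasure (μ.withDensity fun x => ‖e y x‖ₑ) :=
        isFiniteMeasure_withDensity (by rw [lintegral_enorm_lOne]; finiteness)
      have h1 := tendsto_measure_iInter_atTop (μ := μ.withDensity fun x => ‖e y x‖ₑ)
        (fun N => (hBm N).nullMeasurableSet) hanti ⟨0, measure_ne_top _ _⟩
      rw [hempty, measure_empty] at h1
      refine h1.congr fun N => withDensity_apply _ (hBm N)
    have hle : ∀ N, c ≤ (edist (WeakDual.toStrongDual ζ) (inclusionInDoubleDual 𝕜 Z y) +
        ∫⁻ x in B N, ‖e y x‖ₑ ∂μ) + 6 * ε := fun N => by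
      refine (hζΨ N).trans ?_
      gcongr
      have h1 : ζ (Ψ N) = (WeakDual.toStrongDual ζ - inclusionInDoubleDual 𝕜 Z y) (Ψ N) + Ψ N y := by
        change ζ (Ψ N) = (ζ (Ψ N) - Ψ N y) + Ψ N y
        ring
      rw [h1]
      refine (enorm_add_le _ _).trans (add_le_add ?_ ?_)
      · rw [edist_eq_enorm_sub, ← ofReal_norm, ← ofReal_norm]
        refine ENNReal.ofReal_le_ofReal ?_
        refine (ContinuousLinearMap.le_opNorm_of_le _ (hΨ1 N)).trans (by rw [mul_one])
      · rw [hΨ]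
        exact enorm_functional_le (hs1 N) (hBm N) (fun x hx => by simp [s, hx]) (e y)
    have h2 := (tendsto_const_nhds (x := edist (WeakDual.toStrongDual ζ)
      (inclusionInDoubleDual 𝕜 Z y))).add hy |>.add_const (6 * ε)
    rw [add_zero] at h2
    exact ge_of_tendsto h2 (Eventually.of_forall hle)
  have h6 : 6 * ε ≠ ∞ := by finiteness
  refine le_trans ?_ (add_le_add (infEDist_le_wk hζA) le_rfl)
  rw [← tsub_le_iff_right, le_infEDist]
  rintro _ ⟨y, rfl⟩
  exact tsub_le_iff_right.2 (hdist y)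

/-- In a space isometric to `L¹(μ)`, order intervals do the best that is possible: the infimum over
`h` of the excess over `[-h, h]` is at most `wk(A)`. Indeed, with this infimum as `c`, the set `A`
satisfies the hypotheses of `exists_disjoint_concentration`. -/
theorem iInf_intervalExcess_le_wk (e : Z ≃ₗᵢ[𝕜] Lp 𝕜 1 μ) {A : Set Z} {M : ℝ}
    (hA : ∀ z ∈ A, ‖z‖ ≤ M) :
    ⨅ (h : α → ℝ≥0∞) (_ : Measurable h) (_ : ∫⁻ x, h x ∂μ ≠ ∞), intervalExcess e A h ≤ wk 𝕜 A := by
  set c := ⨅ (h : α → ℝ≥0∞) (_ : Measurable h) (_ : ∫⁻ x, h x ∂μ ≠ ∞), intervalExcess e A h with hc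
  have hbM : ∀ z : A, ∫⁻ x, ‖e z x‖ₑ ∂μ ≤ ENNReal.ofReal M := fun z => by
    rw [lintegral_enorm_lOne, ← ofReal_norm, e.norm_map]
    exact ENNReal.ofReal_le_ofReal (hA z z.2)
  have hcM : c ≤ ENNReal.ofReal M :=
    (iInf₂_le (fun _ => 0) measurable_const).trans ((iInf_le _ (by simp)).trans
      (iSup₂_le fun z hz => by simpa using hbM ⟨z, hz⟩))
  have hcfin : c ≠ ∞ := (hcM.trans_lt ENNReal.ofReal_lt_top).ne
  by_cases hc0 : c = 0
  · rw [hc0]; exact zero_le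
  refine ENNReal.le_of_forall_pos_le_add fun ε' hε' _ => ?_
  obtain ⟨ε, hε0, hε⟩ : ∃ ε : ℝ≥0∞, ε ≠ 0 ∧ 6 * ε = ε' :=
    ⟨ε' / 6, by simpa using hε'.ne', ENNReal.mul_div_cancel (by simp) (by simp)⟩
  have hεfin : ε ≠ ∞ := by rintro rfl; simp at hε
  obtain ⟨h, hm, hi, hlt⟩ : ∃ h : α → ℝ≥0∞, Measurable h ∧ ∫⁻ x, h x ∂μ ≠ ∞ ∧
      intervalExcess e A h < c + ε := by
    have := ENNReal.lt_add_right hcfin hε0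
    conv_lhs at this => rw [hc]
    simpa only [iInf_lt_iff, exists_prop] using this
  obtain ⟨i, D, hD, hdisj, h1, h2⟩ := exists_disjoint_concentration (μ := μ) (c := c)
    (fun (z : A) x => ‖e z x‖ₑ) (fun z => (Lp.stronglyMeasurable _).measurable.enorm)
    ENNReal.ofReal_ne_top hbM hε0 hm hi
    (fun z => (le_iSup₂ (f := fun z (_ : z ∈ A) => ∫⁻ x, (‖e z x‖ₑ - h x) ∂μ) z.1 z.2).trans hlt.le)
    (fun G hGm hGi => by
      have hcG : c ≤ intervalExcess e A G :=
        (iInf₂_le G hGm).trans (iInf_le _ hGi)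
      have : c - ε < intervalExcess e A G := (ENNReal.sub_lt_self hcfin hc0 hε0).trans_le hcG
      simp only [intervalExcess, lt_iSup_iff] at this
      obtain ⟨z, hz, hlt⟩ := this
      exact ⟨⟨z, hz⟩, tsub_le_iff_right.1 hlt.le⟩)
  rw [← hε]
  exact le_wk_of_concentration e hA hεfin (fun k => (i k).1) (fun k => (i k).2) hD hdisj h1 h2

end WkEqDeBlasi

/-! ### The inequalities for operators on `L¹` preduals -/

section Predual

variable {𝕜 : Type v} [RCLike 𝕜] {X : Type u} [NormedAddCommGroup X] [NormedSpace 𝕜 X]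
  {Y : Type w} [NormedAddCommGroup Y] [NormedSpace 𝕜 Y]

theorem norm_le_of_mem_image_dualOp (T : X →L[𝕜] Y) :
    ∀ f ∈ dualOp T '' closedBall 0 1, ‖f‖ ≤ ‖dualOp T‖ := by
  rintro _ ⟨g, hg, rfl⟩
  exact (dualOp T).unit_le_opNorm g (by simpa using hg)

/-- Both quantities are equal to the least excess of `T*(B_{Y*})` over order intervals. -/
theorem QuantDP.IsL1Predual.deBlasiOp_dualOp (hX : IsL1Predual.{z} 𝕜 X) (T : X →L[𝕜] Y) :
    deBlasiOp (dualOp T) = wkOp (dualOp T) := by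
  obtain ⟨α, _, μ, ⟨e⟩⟩ := hX.dual_isometric
  refine le_antisymm ?_ (wk_le_deBlasi _)
  refine le_trans ?_ (iInf_intervalExcess_le_wk e (norm_le_of_mem_image_dualOp T))
  exact le_iInf fun h => le_iInf₂ fun hm hi => deBlasi_le_intervalExcess e _ hm hi

theorem QuantDP.IsL1Predual.cc_le (hX : IsL1Predual.{z} 𝕜 X) (T : X →L[𝕜] Y) :
    cc T ≤ 2 * deBlasiOp (dualOp T) := by
  obtain ⟨α, _, μ, ⟨e⟩⟩ := hX.dual_isometric
  rw [hX.deBlasiOp_dualOp, mul_comm, ← ENNReal.div_le_iff (by simp) (by simp)]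
  refine le_trans ?_ (iInf_intervalExcess_le_wk e (norm_le_of_mem_image_dualOp T))
  refine le_iInf fun h => le_iInf₂ fun hm hi => ?_
  rw [ENNReal.div_le_iff (by simp) (by simp), mul_comm]
  exact cc_le_intervalExcess e T hm hi

theorem QuantDP.IsL1Predual.hasDirectQuantDPP (hX : IsL1Predual.{z} 𝕜 X) :
    HasDirectQuantDPP.{w} 𝕜 X :=
  ⟨2, by simp, fun Y _ _ _ T => by
    rw [← hX.deBlasiOp_dualOp]
    exact hX.cc_le T⟩

theorem QuantDP.IsL1Predual.quantitative_inequalities [CompleteSpace Y]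
    (hX : IsL1Predual.{z} 𝕜 X) (T : X →L[𝕜] Y) :
    wkOp T ≤ 2 * wkOp (dualOp T) ∧
    2 * wkOp (dualOp T) ≤ 2 * deBlasiOp (dualOp T) ∧
    2 * deBlasiOp (dualOp T) = 2 * wkOp (dualOp T) ∧
    2 * wkOp (dualOp T) ≤ 4 * wkOp T ∧
    4 * wkOp T ≤ 4 * deBlasiOp T ∧
    cc T ≤ 2 * deBlasiOp (dualOp T) := by
  have h4 : (4 : ℝ≥0∞) = 2 * 2 := by norm_num
  refine ⟨wkOp_le_dualOp T, mul_le_mul_right (wk_le_deBlasi _) _, by rw [hX.deBlasiOp_dualOp],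
    ?_, mul_le_mul_right (wk_le_deBlasi _) _, hX.cc_le T⟩
  rw [h4, mul_assoc]
  exact mul_le_mul_right (wkOp_dualOp_le T) _

end Predual

/-! ### Regular measures and functionals on spaces of continuous functions -/

section RegularMeasures

variable {B : Type*} [TopologicalSpace B] [CompactSpace B] [T2Space B] [MeasurableSpace B]
  [BorelSpace B]

/-- The Riesz-Markov-Kakutani theorem on a compact space, for functionals on all of `C(B, ℝ)`. -/
theorem exists_regular_measure_of_nonneg (g : C(B, ℝ) →ₗ[ℝ] ℝ) (hg : ∀ f, 0 ≤ f → 0 ≤ g f) :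
    ∃ m : Measure B, IsFiniteMeasure m ∧ m.Regular ∧ ∀ f : C(B, ℝ), ∫ x, f x ∂m = g f := by
  let Λ : CompactlySupportedContinuousMap B ℝ →ₚ[ℝ] ℝ :=
    { toFun := fun f => g f.toContinuousMap
      map_add' := fun f f' => g.map_add f.toContinuousMap f'.toContinuousMap
      map_smul' := fun c f => g.map_smul c f.toContinuousMap
      monotone' := fun f f' h => by
        have := hg (f'.toContinuousMap - f.toContinuousMap) (sub_nonneg.2 h)
        rwa [map_sub, sub_nonneg] at this }
  refine ⟨RealRMK.rieszMeasure Λ, inferInstance, inferInstance, fun f => ?_⟩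
  exact RealRMK.integral_rieszMeasure Λ ⟨f, HasCompactSupport.of_compactSpace f⟩

/-- Finite regular measures on a compact space are determined by their integrals. -/
theorem MeasureTheory.Measure.ext_of_integral_continuousMap {m n : Measure B} [IsFiniteMeasure m]
    [IsFiniteMeasure n] [m.Regular] [n.Regular]
    (h : ∀ f : C(B, ℝ), ∫ x, f x ∂m = ∫ x, f x ∂n) : m = n :=
  Measure.ext_of_integral_eq_on_compactlySupported fun f => h f.toContinuousMap

omit [CompactSpace B] in
theorem regular_of_le {m n : Measure B} [IsFiniteMeasure m] [m.Regular] (h : n ≤ m) :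
    n.Regular := by
  have := isFiniteMeasure_of_le m h
  have : n.InnerRegularCompactLTTop := by
    refine ⟨fun A hA r hr => ?_⟩
    obtain ⟨δ, hδ0, hδ⟩ := exists_between (tsub_pos_of_lt hr)
    obtain ⟨K, hKA, hK, hKm⟩ := hA.1.exists_isCompact_sdiff_lt (measure_ne_top m A) hδ0.ne'
    refine ⟨K, hKA, hK, ?_⟩
    have h1 : n A ≤ n K + n (A \ K) := by
      calc n A ≤ n (K ∪ A \ K) := measure_mono (by simp)
        _ ≤ _ := measure_union_le _ _
    have h2 : n (A \ K) < n A - r := ((h _).trans_lt hKm).trans hδ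
    by_contra! h3
    have h4 : n A < r + (n A - r) := by
      calc n A ≤ n K + n (A \ K) := h1
        _ < r + (n A - r) := ENNReal.add_lt_add_of_le_of_lt
          (measure_ne_top n K) h3 h2
    rw [add_tsub_cancel_of_le hr.le] at h4
    exact lt_irrefl _ h4
  infer_instance

omit [CompactSpace B] in
theorem regular_add {m n : Measure B} [IsFiniteMeasure m] [m.Regular] [IsFiniteMeasure n]
    [n.Regular] : (m + n).Regular := by
  have : (m + n).InnerRegularCompactLTTop := by
    refine ⟨fun A hA r hr => ?_⟩
    obtain ⟨δ, hδ0, hδ⟩ := exists_between (tsub_pos_of_lt hr)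
    have hδ2 : δ / 2 ≠ 0 := by simp [hδ0.ne']
    obtain ⟨K, hKA, hK, hKm⟩ := hA.1.exists_isCompact_sdiff_lt (measure_ne_top m A) hδ2
    obtain ⟨L, hLA, hL, hLn⟩ := hA.1.exists_isCompact_sdiff_lt (measure_ne_top n A) hδ2
    refine ⟨K ∪ L, Set.union_subset hKA hLA, hK.union hL, ?_⟩
    have h1 : (m + n) A ≤ (m + n) (K ∪ L) + (m + n) (A \ (K ∪ L)) := by
      calc (m + n) A ≤ (m + n) ((K ∪ L) ∪ A \ (K ∪ L)) := measure_mono (by simp)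
        _ ≤ _ := measure_union_le _ _
    have h2 : (m + n) (A \ (K ∪ L)) < (m + n) A - r := by
      refine lt_of_le_of_lt ?_ hδ
      calc (m + n) (A \ (K ∪ L)) = m (A \ (K ∪ L)) + n (A \ (K ∪ L)) := rfl
        _ ≤ m (A \ K) + n (A \ L) := add_le_add
            (measure_mono (Set.sdiff_subset_sdiff_right Set.subset_union_left))
            (measure_mono (Set.sdiff_subset_sdiff_right Set.subset_union_right))
        _ ≤ δ / 2 + δ / 2 := add_le_add hKm.le hLn.le
        _ = δ := ENNReal.add_halves δ
    by_contra! h3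
    have h4 : (m + n) A < r + ((m + n) A - r) := by
      calc (m + n) A ≤ _ := h1
        _ < r + ((m + n) A - r) := ENNReal.add_lt_add_of_le_of_lt (measure_ne_top _ _) h3 h2
    rw [add_tsub_cancel_of_le hr.le] at h4
    exact lt_irrefl _ h4
  infer_instance

variable {𝕜 : Type*} [RCLike 𝕜]

/-- Finitely many directions suffice to compute the modulus up to a factor `1 + ε`. -/
theorem exists_finset_norm_le_re_mul (𝕜 : Type*) [RCLike 𝕜] {ε : ℝ} (hε : 0 < ε) :
    ∃ s : Finset 𝕜, (∀ t ∈ s, ‖t‖ = 1) ∧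
      ∀ z : 𝕜, ∃ t ∈ s, ‖z‖ ≤ (1 + ε) * RCLike.re (t * z) := by
  have hδ : 0 < ε / (1 + ε) := by positivity
  obtain ⟨s, hs, hc⟩ := (isCompact_sphere (0 : 𝕜) 1).elim_finite_subcover_image
    (b := sphere (0 : 𝕜) 1) (c := fun t => ball t (ε / (1 + ε))) (fun _ _ => isOpen_ball)
    (fun t ht => Set.mem_iUnion₂.2 ⟨t, ht, mem_ball_self hδ⟩)
  lift s to Finset 𝕜 using hc.1
  refine ⟨s, fun t ht => by simpa using hs ht, fun z => ?_⟩
  have key : ∀ u : 𝕜, ‖u‖ = 1 → RCLike.re (u * z) = ‖z‖ →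
      ∃ t ∈ s, ‖z‖ ≤ (1 + ε) * RCLike.re (t * z) := fun u hu hre => by
    obtain ⟨t, ht, htu⟩ := Set.mem_iUnion₂.1 (hc.2 (mem_sphere_zero_iff_norm.2 hu))
    refine ⟨t, ht, ?_⟩
    rw [mem_ball, dist_eq_norm] at htu
    have h1 : RCLike.re ((u - t) * z) ≤ ε / (1 + ε) * ‖z‖ :=
      (RCLike.re_le_norm _).trans ((norm_mul _ _).trans_le (by gcongr))
    rw [sub_mul, map_sub, hre] at h1
    have h2 : (1 + ε) * (ε / (1 + ε) * ‖z‖) = ε * ‖z‖ := by field_simp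
    nlinarith
  rcases eq_or_ne z 0 with rfl | hz
  · exact key 1 (by simp) (by simp)
  · have hz' : (‖z‖ : 𝕜) ≠ 0 := by simpa using hz
    refine key ((starRingEnd 𝕜) z / ‖z‖) (by simp [hz]) ?_
    rw [div_mul_eq_mul_div, RCLike.conj_mul, sq, mul_div_assoc, div_self hz', mul_one,
      RCLike.ofReal_re]

/-- A weak form of the Riesz representation of functionals on `C(B, 𝕜)` by measures with values in
`𝕜`: every functional is a finite combination of positive measures, with unimodular coefficients and
almost without excess mass. The directions `t` of `exists_finset_norm_le_re_mul` embed `C(B, 𝕜)`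
into a finite power of `C(B, ℝ)` through the functions `re (t f)`; the functional `re Φ` on its
range lies below a multiple of the norm of the positive part, so that the Hahn–Banach theorem
extends it to a positive functional. -/
theorem exists_measures_eq_sum (Φ : StrongDual 𝕜 C(B, 𝕜)) {ε : ℝ} (hε : 0 < ε) :
    ∃ (s : Finset 𝕜) (m : s → Measure B), (∀ c ∈ s, ‖c‖ = 1) ∧ (∀ c, IsFiniteMeasure (m c)) ∧
      (∀ c, (m c).Regular) ∧ ∑ c, (m c).real Set.univ ≤ (1 + ε) * ‖Φ‖ ∧
      ∀ f, Φ f = ∑ c : s, (c : 𝕜) * ∫ x, f x ∂(m c) := by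
  classical
  obtain ⟨s, hs1, hs⟩ := exists_finset_norm_le_re_mul 𝕜 hε
  let A : C(B, 𝕜) →ₗ[ℝ] (s → C(B, ℝ)) := LinearMap.pi fun t =>
    { toFun := fun f => ⟨fun x => RCLike.re ((t : 𝕜) * f x), by fun_prop⟩
      map_add' := fun f g => by ext x; simp [mul_add]
      map_smul' := fun c f => by ext x; simp [RCLike.smul_re] }
  have hA : ∀ f t x, A f t x = RCLike.re ((t : 𝕜) * f x) := fun _ _ _ => rfl
  let M := (1 + ε) * ‖Φ‖
  have hM : 0 ≤ M := by positivity
  let N : (s → C(B, ℝ)) → ℝ := fun F => M * ‖fun t => F t ⊔ 0‖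
  have hNle : ∀ F r, 0 ≤ r → (∀ t x, F t x ≤ r) → N F ≤ M * r := fun F r hr h => by
    refine mul_le_mul_of_nonneg_left ?_ hM
    refine (pi_norm_le_iff_of_nonneg hr).2 fun t => (ContinuousMap.norm_le _ hr).2 fun x => ?_
    rw [ContinuousMap.sup_apply, ContinuousMap.zero_apply, Real.norm_of_nonneg (le_max_right _ _)]
    exact sup_le (h t x) hr
  have hle : ∀ (F : s → C(B, ℝ)) t x, F t x ≤ ‖fun t => F t ⊔ 0‖ := fun F t x =>
    calc F t x ≤ (F t ⊔ 0) x := le_sup_left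
      _ ≤ ‖(F t ⊔ 0) x‖ := le_abs_self _
      _ ≤ ‖F t ⊔ 0‖ := ContinuousMap.norm_coe_le_norm _ _
      _ ≤ _ := norm_le_pi_norm (fun t => F t ⊔ 0) t
  have hinj : Function.Injective A := by
    refine (injective_iff_map_eq_zero A).2 fun f hf => ?_
    ext x
    obtain ⟨t, ht, h⟩ := hs (f x)
    have h0 := hA f ⟨t, ht⟩ x
    rw [hf] at h0
    simp only [Pi.zero_apply, ContinuousMap.zero_apply] at h0
    rw [← h0, mul_zero] at h
    simpa using h
  let reΦ : C(B, 𝕜) →ₗ[ℝ] ℝ :=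
    { toFun := fun f => RCLike.re (Φ f)
      map_add' := fun f g => by simp
      map_smul' := fun c f => by
        have : c • f = (c : 𝕜) • f := by ext x; simp [RCLike.real_smul_eq_coe_mul]
        rw [this]
        simp [RCLike.smul_re] }
  let p : (s → C(B, ℝ)) →ₗ.[ℝ] ℝ :=
    ⟨LinearMap.range A, reΦ ∘ₗ (LinearEquiv.ofInjective A hinj).symm.toLinearMap⟩
  obtain ⟨g, hgp, hgN⟩ := exists_extension_of_le_sublinear p N
    (fun c hc F => by
      have : (fun t => (c • F) t ⊔ 0) = c • fun t => F t ⊔ 0 := by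
        ext t x
        simp [mul_max_of_nonneg _ _ hc.le]
      simp only [N, this, norm_smul, Real.norm_of_nonneg hc.le]
      ring)
    (fun F G => by
      simp only [N, ← mul_add]
      refine hNle (F + G) _ (by positivity) fun t x => ?_
      exact add_le_add (hle F t x) (hle G t x))
    (by
      rintro ⟨_, f, rfl⟩
      have : (LinearEquiv.ofInjective A hinj).symm ⟨A f, f, rfl⟩ = f :=
        (LinearEquiv.symm_apply_eq _).2 rfl
      change RCLike.re (Φ ((LinearEquiv.ofInjective A hinj).symm ⟨A f, f, rfl⟩)) ≤ N (A f)
      rw [this]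
      calc RCLike.re (Φ f) ≤ ‖Φ f‖ := RCLike.re_le_norm _
        _ ≤ ‖Φ‖ * ‖f‖ := Φ.le_opNorm f
        _ ≤ ‖Φ‖ * ((1 + ε) * ‖fun t => A f t ⊔ 0‖) := by
            gcongr
            refine (ContinuousMap.norm_le _ (by positivity)).2 fun x => ?_
            obtain ⟨t, ht, h⟩ := hs (f x)
            refine h.trans ?_
            gcongr
            exact hle (A f) ⟨t, ht⟩ x
        _ = N (A f) := by simp only [N, M]; ring)
  have hgA : ∀ f, g (A f) = RCLike.re (Φ f) := fun f => by
    refine (hgp ⟨A f, f, rfl⟩).trans ?_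
    have : (LinearEquiv.ofInjective A hinj).symm ⟨A f, f, rfl⟩ = f :=
      (LinearEquiv.symm_apply_eq _).2 rfl
    exact congrArg reΦ this
  have hpos : ∀ t, ∀ f : C(B, ℝ), 0 ≤ f → 0 ≤ (g ∘ₗ LinearMap.single ℝ _ t) f := fun t f hf => by
    have h := (hgN (-(Pi.single t f))).trans (hNle _ 0 le_rfl fun t' x => ?_)
    · rw [map_neg, mul_zero] at h
      exact neg_nonpos.1 h
    · rcases eq_or_ne t' t with rfl | h
      · simpa using hf x
      · simp [Pi.single_eq_of_ne h]
  choose m hmf hmr hm using fun t => exists_regular_measure_of_nonneg _ (hpos t)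
  have hsum : ∀ F : s → C(B, ℝ), g F = ∑ t, ∫ x, F t x ∂(m t) := fun F => by
    conv_lhs => rw [← Finset.univ_sum_single F, map_sum]
    exact Finset.sum_congr rfl fun t _ => (hm t (F t)).symm
  refine ⟨s, m, hs1, hmf, hmr, ?_, fun f => ?_⟩
  · have h1 := hsum (fun _ => 1)
    simp only [ContinuousMap.one_apply, integral_const, smul_eq_mul, mul_one] at h1
    rw [← h1]
    simpa using (hgN _).trans (hNle _ 1 zero_le_one fun t x => le_rfl)
  · have hre : ∀ f, RCLike.re (Φ f) = RCLike.re (∑ c : s, (c : 𝕜) * ∫ x, f x ∂(m c)) := fun f => by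
      rw [← hgA, hsum, map_sum]
      refine Finset.sum_congr rfl fun t _ => ?_
      have hint : Integrable (fun x => (t : 𝕜) * f x) (m t) :=
        (Continuous.integrable_of_hasCompactSupport (by fun_prop)
          (HasCompactSupport.of_compactSpace _))
      rw [← integral_const_mul, ← integral_re hint]
      rfl
    refine RCLike.ext (hre f) ?_
    have h := hre ((RCLike.I : 𝕜) • f)
    have h2 : ∑ c : s, (c : 𝕜) * ∫ x, ((RCLike.I : 𝕜) • f) x ∂(m c) =
        RCLike.I * ∑ c : s, (c : 𝕜) * ∫ x, f x ∂(m c) := by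
      rw [Finset.mul_sum]
      refine Finset.sum_congr rfl fun t _ => ?_
      simp only [ContinuousMap.smul_apply, smul_eq_mul, integral_const_mul]
      ring
    rw [h2, map_smul, smul_eq_mul, RCLike.I_mul_re, RCLike.I_mul_re] at h
    exact neg_injective h

/-- The total variation of `h τ` is at most its norm as a functional on continuous functions: the
conjugate sign `σ` of `h` is approximated in `L¹(τ)` by a continuous function, which the radial
retraction `ρ` moves into the unit ball. -/
theorem integral_norm_le_of_forall_norm_integral_le {τ : Measure B} [IsFiniteMeasure τ]
    [τ.Regular] {h : B → 𝕜} (hh : Measurable h) {C : ℝ} (hC : ∀ x, ‖h x‖ ≤ C) {L : ℝ}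
    (hL : ∀ u : C(B, 𝕜), ‖u‖ ≤ 1 → ‖∫ x, h x * u x ∂τ‖ ≤ L) : ∫ x, ‖h x‖ ∂τ ≤ L := by
  let σ : B → 𝕜 := fun x => (starRingEnd 𝕜) (h x) / ‖h x‖
  have hσm : Measurable σ := by
    have := RCLike.continuous_conj (K := 𝕜)
    have h1 : Measurable fun x => (starRingEnd 𝕜) (h x) := this.measurable.comp hh
    exact h1.div (RCLike.measurable_ofReal.comp hh.norm)
  have hσ1 : ∀ x, ‖σ x‖ ≤ 1 := fun x => by
    simp only [σ, norm_div, RCLike.norm_conj, RCLike.norm_ofReal, abs_norm]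
    exact div_self_le_one _
  have hσh : ∀ x, h x * σ x = (‖h x‖ : 𝕜) := fun x => by
    simp only [σ]
    rcases eq_or_ne (h x) 0 with h0 | h0
    · simp [h0]
    · have hz' : (‖h x‖ : 𝕜) ≠ 0 := by simpa using h0
      rw [mul_div_assoc', RCLike.mul_conj, sq, mul_div_assoc, div_self hz', mul_one]
  have hσi : Integrable σ τ := Integrable.of_bound hσm.aestronglyMeasurable 1 (ae_of_all _ hσ1)
  refine le_of_forall_pos_le_add fun ε hε => ?_
  have hC' : 0 < |C| + 1 := by positivity
  obtain ⟨w, hw, hwi⟩ := hσi.exists_boundedContinuous_integral_sub_le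
    (show 0 < ε / (2 * (|C| + 1)) by positivity)
  let ρ : 𝕜 → 𝕜 := fun z => ((max 1 ‖z‖)⁻¹ : ℝ) • z
  have hm0 : ∀ z : 𝕜, 0 < max 1 ‖z‖ := fun z => by positivity
  have hρc : Continuous ρ := by
    refine Continuous.smul (Continuous.inv₀ (by fun_prop) fun z => (hm0 z).ne') continuous_id
  have hρ1 : ∀ z, ‖ρ z‖ ≤ 1 := fun z => by
    simp only [ρ, norm_smul, norm_inv, Real.norm_of_nonneg (hm0 z).le]
    rw [inv_mul_le_one₀ (hm0 z)]
    exact le_max_right _ _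
  have hρd : ∀ z y : 𝕜, ‖y‖ ≤ 1 → ‖y - ρ z‖ ≤ 2 * ‖y - z‖ := fun z y hy => by
    have h1 : ‖z - ρ z‖ ≤ ‖y - z‖ := by
      rcases le_total ‖z‖ 1 with h | h
      · simp [ρ, max_eq_left h]
      · have hz : 0 < ‖z‖ := by linarith
        have h2 : z - ρ z = (1 - ‖z‖⁻¹ : ℝ) • z := by simp [ρ, max_eq_right h, sub_smul]
        have h3 : 0 ≤ 1 - ‖z‖⁻¹ := sub_nonneg.2 (inv_le_one_of_one_le₀ h)
        rw [h2, norm_smul, Real.norm_of_nonneg h3, sub_mul, inv_mul_cancel₀ hz.ne', one_mul]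
        have := norm_sub_norm_le z y
        rw [norm_sub_rev] at this
        linarith
    calc ‖y - ρ z‖ = ‖(y - z) + (z - ρ z)‖ := by congr 1; ring
      _ ≤ _ := (norm_add_le _ _).trans (by linarith)
  let u : C(B, 𝕜) := ⟨fun x => ρ (w x), hρc.comp w.continuous⟩
  have hu1 : ∀ x, ‖u x‖ ≤ 1 := fun x => hρ1 _
  have hi1 : Integrable (fun x => h x * u x) τ :=
    Integrable.of_bound (hh.mul u.continuous.measurable).aestronglyMeasurable C
      (ae_of_all _ fun x => by
        rw [norm_mul]
        exact (mul_le_of_le_one_right (norm_nonneg _) (hu1 x)).trans (hC x))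
  have hi2 : Integrable (fun x => h x * (σ x - u x)) τ := by
    refine Integrable.of_bound (hh.mul (hσm.sub u.continuous.measurable)).aestronglyMeasurable
      (C * 2) (ae_of_all _ fun x => ?_)
    rw [norm_mul]
    refine mul_le_mul (hC x) ?_ (norm_nonneg _) ((norm_nonneg _).trans (hC x))
    exact (norm_sub_le _ _).trans (by linarith [hσ1 x, hu1 x])
  have hsplit : ((∫ x, ‖h x‖ ∂τ : ℝ) : 𝕜) = ∫ x, h x * u x ∂τ + ∫ x, h x * (σ x - u x) ∂τ := by
    rw [← integral_add hi1 hi2, ← integral_ofReal]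
    refine integral_congr_ae (ae_of_all _ fun x => ?_)
    simp only [← hσh]
    ring
  have hn : ‖((∫ x, ‖h x‖ ∂τ : ℝ) : 𝕜)‖ = ∫ x, ‖h x‖ ∂τ := by
    rw [RCLike.norm_ofReal, abs_of_nonneg (integral_nonneg fun x => norm_nonneg _)]
  rw [← hn, hsplit]
  refine (norm_add_le _ _).trans (add_le_add
    (hL u ((ContinuousMap.norm_le _ zero_le_one).2 hu1)) ?_)
  calc ‖∫ x, h x * (σ x - u x) ∂τ‖ ≤ ∫ x, 2 * (|C| + 1) * ‖σ x - w x‖ ∂τ := by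
        refine norm_integral_le_of_norm_le ((hσi.sub hwi).norm.const_mul _)
          (ae_of_all _ fun x => ?_)
        rw [norm_mul]
        calc ‖h x‖ * ‖σ x - u x‖ ≤ (|C| + 1) * (2 * ‖σ x - w x‖) := by
              refine mul_le_mul ?_ (hρd _ _ (hσ1 x)) (norm_nonneg _) hC'.le
              linarith [hC x, le_abs_self C]
          _ = _ := by ring
    _ = 2 * (|C| + 1) * ∫ x, ‖σ x - w x‖ ∂τ := integral_const_mul _ _
    _ ≤ 2 * (|C| + 1) * (ε / (2 * (|C| + 1))) := by gcongr
    _ = ε := by field_simp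

end RegularMeasures

/-! ### Selections of representing measures -/

section Selection

variable {B : Type*} [TopologicalSpace B] [CompactSpace B] [T2Space B] [MeasurableSpace B]
  [BorelSpace B] {𝕜 : Type*} [RCLike 𝕜] {V : Type*} [NormedAddCommGroup V] [NormedSpace 𝕜 V]

/-- A selection of representing measures for a self-adjoint subspace `V` of `C(B, 𝕜)`, given as the
range of an isometry `ι`: among all positive measures that agree with `m` on `V` it selects one,
`sel m`, depending on `m` only through its restriction to `V`, in a positively linear way, without
increase of mass, and such that the selected measures are hereditary downwards. -/
structure MeasureSelection (ι : V →ₗᵢ[𝕜] C(B, 𝕜)) where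
  /-- The selected measure that represents the same functional on `V`. -/
  sel : Measure B → Measure B
  isFiniteMeasure : ∀ (m : Measure B) [IsFiniteMeasure m] [m.Regular], IsFiniteMeasure (sel m)
  regular : ∀ (m : Measure B) [IsFiniteMeasure m] [m.Regular], (sel m).Regular
  mass_le : ∀ (m : Measure B) [IsFiniteMeasure m] [m.Regular], sel m Set.univ ≤ m Set.univ
  integral_eq : ∀ (m : Measure B) [IsFiniteMeasure m] [m.Regular] (v : V),
    ∫ x, ι v x ∂(sel m) = ∫ x, ι v x ∂m
  add : ∀ (m n : Measure B) [IsFiniteMeasure m] [m.Regular] [IsFiniteMeasure n] [n.Regular],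
    sel (m + n) = sel m + sel n
  smul : ∀ (c : ℝ≥0) (m : Measure B) [IsFiniteMeasure m] [m.Regular], sel (c • m) = c • sel m
  congr : ∀ (m n : Measure B) [IsFiniteMeasure m] [m.Regular] [IsFiniteMeasure n] [n.Regular],
    (∀ v, ∫ x, ι v x ∂m = ∫ x, ι v x ∂n) → sel m = sel n
  eq_self_of_le : ∀ (m n : Measure B) [IsFiniteMeasure m] [m.Regular], sel m = m → n ≤ m →
    sel n = n
  exists_conj : ∀ v, ∃ w, ∀ x, ι w x = (starRingEnd 𝕜) (ι v x)

omit [T2Space B] in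
theorem ContinuousMap.integrable_of_compactSpace {E : Type*} [NormedAddCommGroup E] (f : C(B, E))
    (m : Measure B) [IsFiniteMeasure m] : Integrable f m :=
  f.continuous.integrable_of_hasCompactSupport (HasCompactSupport.of_compactSpace _)

namespace MeasureSelection

variable {ι : V →ₗᵢ[𝕜] C(B, 𝕜)} (S : MeasureSelection ι)

omit [T2Space B] [BorelSpace B] in
theorem sel_sel (m : Measure B) [IsFiniteMeasure m] [m.Regular] : S.sel (S.sel m) = S.sel m := by
  have := S.isFiniteMeasure m
  have := S.regular m
  exact S.congr _ _ (S.integral_eq m)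

/-- A selection is compatible with nonnegative combinations; the first two parts provide the
instances that the third one needs. -/
theorem sel_sum {κ : Type*} (s : Finset κ) (a : κ → ℝ≥0) (m : κ → Measure B)
    (hf : ∀ l, IsFiniteMeasure (m l)) (hr : ∀ l, (m l).Regular) :
    IsFiniteMeasure (∑ l ∈ s, a l • m l) ∧ (∑ l ∈ s, a l • m l).Regular ∧
      S.sel (∑ l ∈ s, a l • m l) = ∑ l ∈ s, a l • S.sel (m l) := by
  classical
  induction s using Finset.induction_on with
  | empty =>
    simp only [Finset.sum_empty]
    refine ⟨inferInstance, inferInstance, ?_⟩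
    have := S.smul 0 0
    simpa using this
  | insert i s hi ih =>
    obtain ⟨h1, h2, h3⟩ := ih
    simp only [Finset.sum_insert hi]
    have := hr i
    have h4 : (a i • m i).Regular := inferInstance
    refine ⟨inferInstance, regular_add, ?_⟩
    rw [S.add, S.smul, h3]

/-- The pairs of functionals `(∑ cₗ mₗ, ∑ cₗ sel mₗ)`. -/
def pairs : Submodule 𝕜 ((C(B, 𝕜) → 𝕜) × (C(B, 𝕜) → 𝕜)) :=
  Submodule.span 𝕜 {p | ∃ m : Measure B, IsFiniteMeasure m ∧ m.Regular ∧
    p = (fun f => ∫ x, f x ∂m, fun f => ∫ x, f x ∂(S.sel m))}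

omit [T2Space B] [BorelSpace B] in
theorem mem_pairs (m : Measure B) [IsFiniteMeasure m] [m.Regular] :
    ((fun f => ∫ x, f x ∂m, fun f => ∫ x, f x ∂(S.sel m)) :
      (C(B, 𝕜) → 𝕜) × (C(B, 𝕜) → 𝕜)) ∈ S.pairs :=
  Submodule.subset_span ⟨m, inferInstance, inferInstance, rfl⟩

/-- A real combination of measures is split into its positive and its negative part. If it vanishes
on `V`, both parts agree on `V`, so that the same measure is selected for both. -/
theorem sum_ofReal_mul_eq_zero {κ : Type*} [Fintype κ] (m : κ → Measure B)
    (hf : ∀ l, IsFiniteMeasure (m l)) (hr : ∀ l, (m l).Regular) (r : κ → ℝ)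
    (h : ∀ v, ∑ l, (r l : 𝕜) * ∫ x, ι v x ∂(m l) = 0) (f : C(B, 𝕜)) :
    ∑ l, (r l : 𝕜) * ∫ x, f x ∂(S.sel (m l)) = 0 := by
  have hint : ∀ (n : κ → Measure B), (∀ l, IsFiniteMeasure (n l)) → ∀ (a : κ → ℝ≥0) (f : C(B, 𝕜)),
      ∫ x, f x ∂(∑ l, a l • n l) = ∑ l, ((a l : ℝ) : 𝕜) * ∫ x, f x ∂(n l) := fun n hn a f => by
    rw [integral_finsetSum_measure fun l _ => f.integrable_of_compactSpace _]
    refine Finset.sum_congr rfl fun l _ => ?_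
    rw [integral_smul_nnreal_measure, NNReal.smul_def, RCLike.real_smul_eq_coe_mul]
  obtain ⟨h1, h2, h3⟩ := S.sel_sum Finset.univ (fun l => (r l).toNNReal) m hf hr
  obtain ⟨h1', h2', h3'⟩ := S.sel_sum Finset.univ (fun l => (-r l).toNNReal) m hf hr
  have hr' : ∀ l, (r l : 𝕜) = (((r l).toNNReal : ℝ) : 𝕜) - (((-r l).toNNReal : ℝ) : 𝕜) :=
    fun l => by
      rw [← RCLike.ofReal_sub, Real.coe_toNNReal', Real.coe_toNNReal']
      congr 1
      rcases le_total (r l) 0 with h | h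
      · rw [max_eq_right h, max_eq_left (by linarith)]; ring
      · rw [max_eq_left h, max_eq_right (by linarith)]; ring
  have hs := fun l => S.isFiniteMeasure (m l)
  have key := S.congr _ _ fun v => by
    have := h v
    simp only [hr', sub_mul, Finset.sum_sub_distrib, ← hint m hf] at this
    exact sub_eq_zero.1 this
  rw [h3, h3'] at key
  simp only [hr', sub_mul, Finset.sum_sub_distrib, ← hint _ hs, key, sub_self]

/-- If a combination of measures vanishes on `V`, so does the combination of the selected measures
on all of `C(B, 𝕜)`. -/
theorem snd_eq_zero_of_mem_pairs {p : (C(B, 𝕜) → 𝕜) × (C(B, 𝕜) → 𝕜)} (hp : p ∈ S.pairs)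
    (h : ∀ v, p.1 (ι v) = 0) (f : C(B, 𝕜)) : p.2 f = 0 := by
  obtain ⟨n, c, g, rfl⟩ := Submodule.mem_span_set'.1 hp
  choose m hf hr hm using fun l => (g l).2
  have h1 : ∀ f, (∑ l, c l • (g l : (C(B, 𝕜) → 𝕜) × (C(B, 𝕜) → 𝕜))).1 f =
      ∑ l, c l * ∫ x, f x ∂(m l) := fun f => by simp [Prod.fst_sum, hm]
  have h2 : ∀ f, (∑ l, c l • (g l : (C(B, 𝕜) → 𝕜) × (C(B, 𝕜) → 𝕜))).2 f =
      ∑ l, c l * ∫ x, f x ∂(S.sel (m l)) := fun f => by simp [Prod.snd_sum, hm]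
  simp only [h1] at h
  have hconj : ∀ v, ∑ l, (starRingEnd 𝕜) (c l) * ∫ x, ι v x ∂(m l) = 0 := fun v => by
    obtain ⟨w, hw⟩ := S.exists_conj v
    have := congrArg (starRingEnd 𝕜) (h w)
    simpa only [hw, integral_conj, map_sum, map_mul, RCLike.conj_conj, map_zero] using this
  have hre := S.sum_ofReal_mul_eq_zero m hf hr (fun l => RCLike.re (c l)) (fun v => by
    simp only [RCLike.re_eq_add_conj, div_mul_eq_mul_div, add_mul, add_div, Finset.sum_add_distrib,
      ← Finset.sum_div, h, hconj, zero_div, add_zero]) f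
  have him := S.sum_ofReal_mul_eq_zero m hf hr (fun l => RCLike.im (c l)) (fun v => by
    simp only [RCLike.im_eq_conj_sub, div_mul_eq_mul_div, sub_mul, mul_sub, sub_div,
      mul_assoc,
      Finset.sum_sub_distrib, ← Finset.mul_sum, ← Finset.sum_div, h, hconj, zero_div, sub_zero,
      mul_zero]) f
  rw [h2]
  have : ∀ l, c l * ∫ x, f x ∂(S.sel (m l)) = (RCLike.re (c l) : 𝕜) * ∫ x, f x ∂(S.sel (m l)) +
      RCLike.I * ((RCLike.im (c l) : 𝕜) * ∫ x, f x ∂(S.sel (m l))) := fun l => by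
    conv_lhs => rw [← RCLike.re_add_im (c l)]
    ring
  simp only [this, Finset.sum_add_distrib, ← Finset.mul_sum, hre, him, mul_zero, add_zero]

/-- Measures with bounded density with respect to a selected measure are selected. -/
theorem sel_withDensity {m : Measure B} [IsFiniteMeasure m] [m.Regular] (hm : S.sel m = m)
    {h : B → ℝ} {C : ℝ} (hC : ∀ x, h x ≤ C) :
    IsFiniteMeasure (m.withDensity fun x => ENNReal.ofReal (h x)) ∧
    (m.withDensity fun x => ENNReal.ofReal (h x)).Regular ∧
    S.sel (m.withDensity fun x => ENNReal.ofReal (h x)) =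
      m.withDensity fun x => ENNReal.ofReal (h x) := by
  have hle : (m.withDensity fun x => ENNReal.ofReal (h x)) ≤ C.toNNReal • m := by
    calc (m.withDensity fun x => ENNReal.ofReal (h x)) ≤ m.withDensity fun _ => ENNReal.ofReal C :=
          withDensity_mono (ae_of_all _ fun x => ENNReal.ofReal_le_ofReal (hC x))
      _ = _ := withDensity_const _
  have hr : (C.toNNReal • m).Regular := inferInstance
  refine ⟨isFiniteMeasure_of_le _ hle, regular_of_le hle, S.eq_self_of_le _ _ ?_ hle⟩
  rw [S.smul, hm]

omit [TopologicalSpace B] [CompactSpace B] [T2Space B] [BorelSpace B] in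
theorem integral_withDensity_ofReal {m : Measure B} {h : B → ℝ} (hh : Measurable h)
    (h0 : ∀ x, 0 ≤ h x) (f : B → 𝕜) :
    ∫ x, f x ∂(m.withDensity fun x => ENNReal.ofReal (h x)) = ∫ x, (h x : 𝕜) * f x ∂m := by
  rw [integral_withDensity_eq_integral_toReal_smul hh.ennreal_ofReal (by simp)]
  refine integral_congr_ae (ae_of_all _ fun x => ?_)
  simp only [ENNReal.toReal_ofReal (h0 x), RCLike.real_smul_eq_coe_mul]

/-- Measures with bounded density, with values in `𝕜`, with respect to a selected measure are paired
with themselves. -/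
theorem mul_mem_pairs {m : Measure B} [IsFiniteMeasure m] [m.Regular] (hm : S.sel m = m)
    {g : B → 𝕜} (hg : Measurable g) {C : ℝ} (hC : ∀ x, ‖g x‖ ≤ C) :
    ((fun f => ∫ x, g x * f x ∂m, fun f => ∫ x, g x * f x ∂m) :
      (C(B, 𝕜) → 𝕜) × (C(B, 𝕜) → 𝕜)) ∈ S.pairs := by
  have hpos : ∀ h : B → ℝ, Measurable h → (∀ x, 0 ≤ h x) → (∀ x, h x ≤ C) →
      ((fun f => ∫ x, (h x : 𝕜) * f x ∂m, fun f => ∫ x, (h x : 𝕜) * f x ∂m) :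
      (C(B, 𝕜) → 𝕜) × (C(B, 𝕜) → 𝕜)) ∈ S.pairs := fun h hh h0 hC => by
    obtain ⟨h1, h2, h3⟩ := S.sel_withDensity hm hC
    have := S.mem_pairs (m.withDensity fun x => ENNReal.ofReal (h x))
    simpa only [h3, integral_withDensity_ofReal hh h0] using this
  have hreal : ∀ h : B → ℝ, Measurable h → (∀ x, |h x| ≤ C) →
      ((fun f => ∫ x, (h x : 𝕜) * f x ∂m, fun f => ∫ x, (h x : 𝕜) * f x ∂m) :
      (C(B, 𝕜) → 𝕜) × (C(B, 𝕜) → 𝕜)) ∈ S.pairs := fun h hh hC => by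
    have h1 := hpos (fun x => max (h x) 0) (hh.max measurable_const) (fun x => le_max_right _ _)
      fun x => max_le ((le_abs_self _).trans (hC x)) ((abs_nonneg _).trans (hC x))
    have h2 := hpos (fun x => max (-h x) 0) (hh.neg.max measurable_const)
      (fun x => le_max_right _ _)
      fun x => max_le ((neg_le_abs _).trans (hC x)) ((abs_nonneg _).trans (hC x))
    have hi : ∀ k : B → ℝ, Measurable k → (∀ x, |k x| ≤ C) → ∀ f : C(B, 𝕜),
        Integrable (fun x => (k x : 𝕜) * f x) m := fun k hk hkC f =>
      (f.integrable_of_compactSpace m).bdd_mul (c := C)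
        (RCLike.measurable_ofReal.comp hk).aestronglyMeasurable (ae_of_all _ fun x => by
          simpa using hkC x)
    have hb1 : ∀ x, |max (h x) 0| ≤ C := fun x => by
      rw [abs_of_nonneg (le_max_right _ _)]
      exact max_le ((le_abs_self _).trans (hC x)) ((abs_nonneg _).trans (hC x))
    have hb2 : ∀ x, |max (-h x) 0| ≤ C := fun x => by
      rw [abs_of_nonneg (le_max_right _ _)]
      exact max_le ((neg_le_abs _).trans (hC x)) ((abs_nonneg _).trans (hC x))
    have e : ∀ f : C(B, 𝕜), ∫ x, (h x : 𝕜) * f x ∂m =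
        ∫ x, ((max (h x) 0 : ℝ) : 𝕜) * f x ∂m - ∫ x, ((max (-h x) 0 : ℝ) : 𝕜) * f x ∂m :=
      fun f => by
        rw [← integral_sub (hi _ (hh.max measurable_const) hb1 f)
          (hi (fun x => max (-h x) 0) (hh.neg.max measurable_const) hb2 f)]
        refine integral_congr_ae (ae_of_all _ fun x => ?_)
        simp only [← sub_mul, ← RCLike.ofReal_sub]
        congr 2
        rcases le_total (h x) 0 with h | h
        · rw [max_eq_right h, max_eq_left (by linarith)]; ring
        · rw [max_eq_left h, max_eq_right (by linarith)]; ring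
    have := S.pairs.sub_mem h1 h2
    simp only [e]
    exact this
  have hre := hreal (fun x => RCLike.re (g x)) (RCLike.measurable_re.comp hg)
    fun x => (RCLike.abs_re_le_norm _).trans (hC x)
  have him := hreal (fun x => RCLike.im (g x)) (RCLike.measurable_im.comp hg)
    fun x => (RCLike.abs_im_le_norm _).trans (hC x)
  have e : ∀ f : C(B, 𝕜), ∫ x, g x * f x ∂m =
      ∫ x, (RCLike.re (g x) : 𝕜) * f x ∂m + RCLike.I * ∫ x, (RCLike.im (g x) : 𝕜) * f x ∂m :=
    fun f => by
      have h1 : Integrable (fun x => (RCLike.re (g x) : 𝕜) * f x) m :=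
        (f.integrable_of_compactSpace m).bdd_mul (c := C)
          (RCLike.measurable_ofReal.comp (RCLike.measurable_re.comp hg)).aestronglyMeasurable
          (ae_of_all _ fun x => by simpa using (RCLike.abs_re_le_norm _).trans (hC x))
      have h2 : Integrable (fun x => (RCLike.im (g x) : 𝕜) * f x) m :=
        (f.integrable_of_compactSpace m).bdd_mul (c := C)
          (RCLike.measurable_ofReal.comp (RCLike.measurable_im.comp hg)).aestronglyMeasurable
          (ae_of_all _ fun x => by simpa using (RCLike.abs_im_le_norm _).trans (hC x))
      rw [← integral_const_mul, ← integral_add h1 (h2.const_mul _)]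
      refine integral_congr_ae (ae_of_all _ fun x => ?_)
      conv_lhs => simp only []; rw [← RCLike.re_add_im (g x)]
      ring
  have := S.pairs.add_mem hre (S.pairs.smul_mem RCLike.I him)
  simp only [e]
  exact this

end MeasureSelection
end Selection

/-! ### The norm of functionals that are represented by selected measures -/

section DualOfSelection

variable {B : Type*} [TopologicalSpace B] [CompactSpace B] [T2Space B] [MeasurableSpace B]
  [BorelSpace B] {𝕜 : Type*} [RCLike 𝕜] {V : Type*} [NormedAddCommGroup V] [NormedSpace 𝕜 V]
  {ι : V →ₗᵢ[𝕜] C(B, 𝕜)} {J : Type*} {μ : J → Measure B}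

omit [TopologicalSpace B] [CompactSpace B] [T2Space B] [BorelSpace B] in
/-- Finitely many pairwise singular measures live on pairwise disjoint sets. -/
theorem exists_disjoint_carriers (hμ : ∀ i j, i ≠ j → μ i ⟂ₘ μ j) (s : Finset J) :
    ∃ E : J → Set B, (∀ j, MeasurableSet (E j)) ∧ (∀ j, μ j (E j)ᶜ = 0) ∧
      ∀ i ∈ s, ∀ j ∈ s, i ≠ j → Disjoint (E i) (E j) := by
  classical
  have h : ∀ i j, ∃ A : Set B, MeasurableSet A ∧ (i ≠ j → μ i A = 0 ∧ μ j Aᶜ = 0) := fun i j => by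
    by_cases hij : i = j
    · exact ⟨∅, MeasurableSet.empty, fun h => (h hij).elim⟩
    · obtain ⟨A, h1, h2, h3⟩ := hμ i j hij
      exact ⟨A, h1, fun _ => ⟨h2, h3⟩⟩
  choose A hA hA' using h
  refine ⟨fun j => ⋂ i ∈ s.erase j, A i j ∩ (A j i)ᶜ, fun j => ?_, fun j => ?_, ?_⟩
  · exact Finset.measurableSet_biInter _ fun i _ => (hA i j).inter (hA j i).compl
  · simp only [Set.compl_iInter, Set.compl_inter, compl_compl]
    refine (measure_biUnion_null_iff (s.erase j).countable_toSet).2 fun i hi => ?_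
    have hij := Finset.ne_of_mem_erase hi
    exact measure_union_null (hA' i j hij).2 (hA' j i hij.symm).1
  · intro i hi j hj hij
    refine Set.disjoint_left.2 fun x hx hx' => ?_
    have h1 := Set.mem_iInter₂.1 hx j (Finset.mem_erase.2 ⟨hij.symm, hj⟩)
    have h2 := Set.mem_iInter₂.1 hx' i (Finset.mem_erase.2 ⟨hij, hi⟩)
    exact h2.2 h1.1

omit [CompactSpace B] in
theorem regular_sum (hf : ∀ j, IsFiniteMeasure (μ j)) (hr : ∀ j, (μ j).Regular) (s : Finset J) :
    IsFiniteMeasure (∑ j ∈ s, μ j) ∧ (∑ j ∈ s, μ j).Regular := by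
  classical
  induction s using Finset.induction_on with
  | empty =>
    simp only [Finset.sum_empty]
    exact ⟨inferInstance, inferInstance⟩
  | insert i s hi ih =>
    obtain ⟨h1, h2⟩ := ih
    have := hr i
    rw [Finset.sum_insert hi]
    exact ⟨inferInstance, regular_add⟩

/-- Measures with densities with respect to pairwise singular measures live on disjoint sets, so that
the total variation of their sum is the sum of the total variations. -/
theorem sum_integral_norm_le_of_forall_norm_le (hf : ∀ j, IsFiniteMeasure (μ j))
    (hr : ∀ j, (μ j).Regular) (hμ : ∀ i j, i ≠ j → μ i ⟂ₘ μ j) (s : Finset J) {g : J → B → 𝕜}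
    (hg : ∀ j, Measurable (g j)) {C : ℝ} (hC : ∀ j x, ‖g j x‖ ≤ C) {L : ℝ}
    (hL : ∀ u : C(B, 𝕜), ‖u‖ ≤ 1 → ‖∑ j ∈ s, ∫ x, g j x * u x ∂(μ j)‖ ≤ L) :
    ∑ j ∈ s, ∫ x, ‖g j x‖ ∂(μ j) ≤ L := by
  obtain ⟨E, hE, hE0, hEd⟩ := exists_disjoint_carriers hμ s
  obtain ⟨h1, h2⟩ := regular_sum hf hr s
  let h : B → 𝕜 := fun x => ∑ j ∈ s, (E j).indicator (g j) x
  have hm : Measurable h := Finset.measurable_sum _ fun j _ => (hg j).indicator (hE j)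
  have hb : ∀ x, ‖h x‖ ≤ ∑ j ∈ s, C := fun x =>
    (norm_sum_le _ _).trans (Finset.sum_le_sum fun j _ =>
      (norm_indicator_le_norm_self _ _).trans (hC j x))
  have hae : ∀ j ∈ s, h =ᵐ[μ j] g j := fun j hj => by
    have : ∀ᵐ x ∂(μ j), x ∈ E j := by
      rw [ae_iff]
      exact hE0 j
    filter_upwards [this] with x hx
    refine (Finset.sum_eq_single_of_mem j hj fun i hi hij => ?_).trans
      (Set.indicator_of_mem hx _)
    exact Set.indicator_of_notMem (Set.disjoint_right.1 (hEd i hi j hj hij) hx) _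
  have hi : ∀ j ∈ s, Integrable h (μ j) := fun j _ =>
    Integrable.of_bound hm.aestronglyMeasurable _ (ae_of_all _ hb)
  have key := integral_norm_le_of_forall_norm_integral_le (τ := ∑ j ∈ s, μ j) hm hb (L := L)
    fun u hu => by
      have hui : ∀ j ∈ s, Integrable (fun x => h x * u x) (μ j) := fun j hj =>
        (u.integrable_of_compactSpace (μ j)).bdd_mul hm.aestronglyMeasurable (ae_of_all _ hb)
      rw [integral_finsetSum_measure hui]
      convert hL u hu using 2
      refine Finset.sum_congr rfl fun j hj => integral_congr_ae ?_
      filter_upwards [hae j hj] with x hx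
      rw [hx]
  rw [integral_finsetSum_measure fun j hj => (hi j hj).norm] at key
  refine (Finset.sum_congr rfl fun j hj => integral_congr_ae ?_).trans_le key
  filter_upwards [hae j hj] with x hx
  rw [hx]

omit [T2Space B] [MeasurableSpace B] [BorelSpace B] in
/-- The Hahn–Banach theorem along an isometry. -/
theorem exists_extension_along (ι : V →ₗᵢ[𝕜] C(B, 𝕜)) (Λ : StrongDual 𝕜 V) :
    ∃ Φ : StrongDual 𝕜 C(B, 𝕜), ‖Φ‖ ≤ ‖Λ‖ ∧ ∀ v, Φ (ι v) = Λ v := by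
  obtain ⟨Φ, h1, h2⟩ := exists_extension_norm_eq (LinearMap.range ι.toLinearMap)
    (Λ.comp ι.equivRange.symm.toContinuousLinearEquiv.toContinuousLinearMap)
  refine ⟨Φ, ?_, fun v => ?_⟩
  · rw [h2]
    refine ContinuousLinearMap.opNorm_le_bound _ (norm_nonneg _) fun x => ?_
    refine (Λ.le_opNorm _).trans_eq ?_
    congr 1
    exact ι.equivRange.symm.norm_map x
  · have := h1 (ι.equivRange v)
    refine this.trans ?_
    change Λ (ι.equivRange.symm (ι.equivRange v)) = Λ v
    rw [LinearIsometryEquiv.symm_apply_apply]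

/-- The norm of a functional on `V` which is represented by densities with respect to finitely many
selected measures is at least the total variation: the combination of measures of nearly minimal
mass that the Hahn–Banach theorem provides may be replaced by the selected measures, which have no
more mass, and by `snd_eq_zero_of_mem_pairs` these give back the densities. -/
theorem MeasureSelection.sum_integral_norm_le (S : MeasureSelection ι)
    (hf : ∀ j, IsFiniteMeasure (μ j)) (hr : ∀ j, (μ j).Regular) (hS : ∀ j, S.sel (μ j) = μ j)
    (hμ : ∀ i j, i ≠ j → μ i ⟂ₘ μ j) (s : Finset J) {g : J → B → 𝕜}
    (hg : ∀ j, Measurable (g j)) {C : ℝ} (hC : ∀ j x, ‖g j x‖ ≤ C) (Λ : StrongDual 𝕜 V)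
    (hΛ : ∀ v, Λ v = ∑ j ∈ s, ∫ x, g j x * ι v x ∂(μ j)) :
    ∑ j ∈ s, ∫ x, ‖g j x‖ ∂(μ j) ≤ ‖Λ‖ := by
  refine sum_integral_norm_le_of_forall_norm_le hf hr hμ s hg hC fun u hu => ?_
  obtain ⟨Φ, hΦ, hΦΛ⟩ := exists_extension_along ι Λ
  refine le_of_forall_pos_le_add fun δ hδ => ?_
  obtain ⟨t, m, ht, hmf, hmr, hmass, hm⟩ := exists_measures_eq_sum Φ
    (ε := δ / (‖Φ‖ + 1)) (by positivity)
  have hp := S.pairs.sub_mem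
    (S.pairs.sum_mem (t := Finset.univ) fun (c : t) _ => S.pairs.smul_mem (c : 𝕜) (S.mem_pairs (m c)))
    (S.pairs.sum_mem (t := s) fun j _ => S.mul_mem_pairs (hS j) (hg j) (hC j))
  have h0 := S.snd_eq_zero_of_mem_pairs hp (fun v => by
    simp only [Prod.fst_sub, Prod.fst_sum, Prod.smul_fst, Pi.sub_apply, Finset.sum_apply,
      Pi.smul_apply, smul_eq_mul, ← hm, ← hΛ, hΦΛ, sub_self]) u
  simp only [Prod.snd_sub, Prod.snd_sum, Prod.smul_snd, Pi.sub_apply, Finset.sum_apply,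
      Pi.smul_apply, smul_eq_mul] at h0
  rw [← sub_eq_zero.1 h0]
  calc ‖∑ c : t, (c : 𝕜) * ∫ x, u x ∂(S.sel (m c))‖
      ≤ ∑ c : t, (m c).real Set.univ := norm_sum_le_of_le _ fun c _ => by
        have := S.isFiniteMeasure (m c)
        rw [norm_mul, ht c c.2, one_mul]
        calc ‖∫ x, u x ∂(S.sel (m c))‖ ≤ 1 * (S.sel (m c)).real Set.univ :=
              norm_integral_le_of_norm_le_const
                (ae_of_all _ fun x => (u.norm_coe_le_norm x).trans hu)
          _ ≤ (m c).real Set.univ := by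
              rw [one_mul]
              exact ENNReal.toReal_mono (measure_ne_top _ _) (S.mass_le (m c))
    _ ≤ (1 + δ / (‖Φ‖ + 1)) * ‖Φ‖ := hmass
    _ = ‖Φ‖ + δ * (‖Φ‖ / (‖Φ‖ + 1)) := by ring
    _ ≤ ‖Λ‖ + δ := by
        refine add_le_add hΦ (mul_le_of_le_one_right hδ.le ?_)
        exact div_le_one_of_le₀ (by linarith) (by positivity)

/-! ### The disjoint union of a family of measures -/

section SumSpace

omit [TopologicalSpace B] [CompactSpace B] [T2Space B] [BorelSpace B]

theorem measurable_sigma_iff {J Y : Type*} [MeasurableSpace Y] {f : (Σ _ : J, B) → Y} :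
    Measurable f ↔ ∀ j, Measurable fun x => f ⟨j, x⟩ := by
  refine ⟨fun h j => h.comp (Measurable.of_le_map (iInf_le _ j)), fun h => ?_⟩
  intro A hA
  exact MeasurableSpace.measurableSet_iInf.2 fun j => h j hA

theorem measurable_sigma_mk {J : Type*} (j : J) : Measurable (fun x => ⟨j, x⟩ : B → Σ _ : J, B) :=
  Measurable.of_le_map (iInf_le _ j)

/-- The disjoint union of a family of measures. -/
noncomputable def sumMeasure (μ : J → Measure B) : Measure (Σ _ : J, B) :=
  Measure.sum fun j => (μ j).map fun x => ⟨j, x⟩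

theorem lintegral_sumMeasure {f : (Σ _ : J, B) → ℝ≥0∞} (hf : Measurable f) :
    ∫⁻ p, f p ∂(sumMeasure μ) = ∑' j, ∫⁻ x, f ⟨j, x⟩ ∂(μ j) := by
  rw [sumMeasure, lintegral_sum_measure]
  exact tsum_congr fun j => lintegral_map hf (measurable_sigma_mk j)

theorem integral_sumMeasure {E : Type*} [NormedAddCommGroup E] [NormedSpace ℝ E]
    {f : (Σ _ : J, B) → E} (hf : Integrable f (sumMeasure μ)) :
    ∫ p, f p ∂(sumMeasure μ) = ∑' j, ∫ x, f ⟨j, x⟩ ∂(μ j) := by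
  rw [sumMeasure, integral_sum_measure hf]
  exact tsum_congr fun j => integral_map (measurable_sigma_mk j).aemeasurable
    (hf.mono_measure (Measure.le_sum _ j)).aestronglyMeasurable

theorem integral_sumMeasure_of_support {E : Type*} [NormedAddCommGroup E] [NormedSpace ℝ E]
    {f : (Σ _ : J, B) → E} (hf : Integrable f (sumMeasure μ)) {s : Finset J}
    (hs : ∀ p : (Σ _ : J, B), p.1 ∉ s → f p = 0) :
    ∫ p, f p ∂(sumMeasure μ) = ∑ j ∈ s, ∫ x, f ⟨j, x⟩ ∂(μ j) := by
  rw [integral_sumMeasure hf]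
  refine tsum_eq_sum fun j hj => ?_
  simp [fun x => hs ⟨j, x⟩ hj]

/-- Bounded functions supported by finitely many summands are dense in `L¹` of a disjoint union. -/
theorem exists_bounded_finite_support (f : Lp 𝕜 1 (sumMeasure μ)) {ε : ℝ} (hε : 0 < ε) :
    ∃ (s : Finset J) (C : ℝ) (g : (Σ _ : J, B) → 𝕜) (hg : MemLp g 1 (sumMeasure μ)),
      Measurable g ∧ (∀ p, ‖g p‖ ≤ C) ∧ (∀ p : (Σ _ : J, B), p.1 ∉ s → g p = 0) ∧
      ‖f - hg.toLp g‖ ≤ ε := by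
  classical
  have hε2 : ENNReal.ofReal (ε / 2) ≠ 0 := by simpa using hε
  obtain ⟨g, hg, hgm⟩ := (Lp.memLp f).exists_simpleFunc_eLpNorm_sub_lt ENNReal.one_ne_top hε2
  obtain ⟨C, hC⟩ := g.exists_forall_norm_le
  have hfin : ∑' j, ∫⁻ x, ‖g ⟨j, x⟩‖ₑ ∂(μ j) ≠ ∞ := by
    have h1 := hgm.eLpNorm_lt_top
    rw [eLpNorm_one_eq_lintegral_enorm, lintegral_sumMeasure g.measurable.enorm] at h1
    exact h1.ne
  obtain ⟨s, hs⟩ := ((tendsto_order.1 (ENNReal.tendsto_tsum_compl_atTop_zero hfin)).2 _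
    (pos_iff_ne_zero.2 hε2)).exists
  let A : Set (Σ _ : J, B) := {p | p.1 ∈ s}
  have hA : MeasurableSet A := by
    refine MeasurableSpace.measurableSet_iInf.2 fun j => ?_
    change MeasurableSet {x : B | j ∈ s}
    exact MeasurableSet.const _
  have hGm : MemLp (A.indicator g) 1 (sumMeasure μ) := hgm.indicator hA
  refine ⟨s, C, A.indicator g, hGm, g.measurable.indicator hA,
    fun p => (norm_indicator_le_norm_self _ _).trans (hC p),
    fun p hp => Set.indicator_of_notMem (s := A) hp _, ?_⟩
  have h2 : eLpNorm (fun p => g p - A.indicator g p) 1 (sumMeasure μ) ≤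
      ENNReal.ofReal (ε / 2) := by
    rw [eLpNorm_one_eq_lintegral_enorm,
      lintegral_sumMeasure (f := fun p => ‖g p - A.indicator g p‖ₑ)
        (g.measurable.sub (g.measurable.indicator hA)).enorm]
    refine le_trans ?_ hs.le
    have : ∀ j, ∫⁻ x, ‖g ⟨j, x⟩ - A.indicator g ⟨j, x⟩‖ₑ ∂(μ j) =
        ({j | j ∉ s} : Set J).indicator (fun j => ∫⁻ x, ‖g ⟨j, x⟩‖ₑ ∂(μ j)) j := fun j => by
      by_cases hj : j ∈ s
      · have h : ∀ x, A.indicator g ⟨j, x⟩ = g ⟨j, x⟩ := fun x => Set.indicator_of_mem (s := A) hj _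
        simp [h, hj]
      · have h : ∀ x, A.indicator g ⟨j, x⟩ = 0 := fun x => Set.indicator_of_notMem (s := A) hj _
        simp [h, hj]
    simp only [this]
    rw [← tsum_subtype]
    rfl
  have h3 : eLpNorm (⇑(f - hGm.toLp (A.indicator g))) 1 (sumMeasure μ) ≤ ENNReal.ofReal ε := by
    have h4 : ⇑(f - hGm.toLp (A.indicator g)) =ᵐ[sumMeasure μ]
        (⇑f - ⇑g) + fun p => g p - A.indicator g p := by
      filter_upwards [Lp.coeFn_sub f (hGm.toLp _), hGm.coeFn_toLp] with p hp hp'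
      rw [hp, Pi.sub_apply, hp', Pi.add_apply, Pi.sub_apply]
      ring
    rw [eLpNorm_congr_ae h4]
    refine (eLpNorm_add_le ((Lp.aestronglyMeasurable f).sub g.aestronglyMeasurable)
      (g.aestronglyMeasurable.sub hGm.aestronglyMeasurable) le_rfl).trans ?_
    refine (add_le_add hg.le h2).trans_eq ?_
    rw [← ENNReal.ofReal_add (by positivity) (by positivity), add_halves]
  rw [Lp.norm_def]
  exact ENNReal.toReal_le_of_le_ofReal hε.le h3

end SumSpace

end DualOfSelection

/-! ### The dual of a space with a selection of representing measures -/

section DualIsometry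

variable {B : Type*} [TopologicalSpace B] [CompactSpace B] [T2Space B] [MeasurableSpace B]
  [BorelSpace B] {𝕜 : Type*} [RCLike 𝕜] {V : Type*} [NormedAddCommGroup V] [NormedSpace 𝕜 V]
  {J : Type*} {μ : J → Measure B}

omit [TopologicalSpace B] [CompactSpace B] [T2Space B] [BorelSpace B] in
theorem measurable_sigma_snd : Measurable (fun p : (Σ _ : J, B) => p.2) :=
  measurable_sigma_iff.2 fun _ => measurable_id

omit [T2Space B] in
theorem integrable_lOne_mul (f : Lp 𝕜 1 (sumMeasure μ)) (u : C(B, 𝕜)) :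
    Integrable (fun p => f p * u p.2) (sumMeasure μ) :=
  (L1.integrable_coeFn f).mul_bdd (c := ‖u‖)
    (u.continuous.measurable.comp measurable_sigma_snd).aestronglyMeasurable
    (ae_of_all _ fun p => u.norm_coe_le_norm p.2)

omit [T2Space B] [BorelSpace B] in
theorem norm_integral_lOne_mul_le (f : Lp 𝕜 1 (sumMeasure μ)) (u : C(B, 𝕜)) :
    ‖∫ p, f p * u p.2 ∂(sumMeasure μ)‖ ≤ ‖f‖ * ‖u‖ := by
  calc ‖∫ p, f p * u p.2 ∂(sumMeasure μ)‖ ≤ ∫ p, ‖f p‖ * ‖u‖ ∂(sumMeasure μ) := by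
        refine norm_integral_le_of_norm_le ((L1.integrable_coeFn f).norm.mul_const _)
          (ae_of_all _ fun p => ?_)
        rw [norm_mul]
        gcongr
        exact u.norm_coe_le_norm p.2
    _ = ‖f‖ * ‖u‖ := by rw [integral_mul_const, L1.norm_eq_integral_norm]

/-- An integrable function `f` on the disjoint union acts on `V` through the measures `f(j, ·) μⱼ`. -/
noncomputable def lOneToDual (ι : V →ₗᵢ[𝕜] C(B, 𝕜)) (μ : J → Measure B) :
    Lp 𝕜 1 (sumMeasure μ) →ₗ[𝕜] StrongDual 𝕜 V where
  toFun f := LinearMap.mkContinuous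
    { toFun := fun v => ∫ p, f p * ι v p.2 ∂(sumMeasure μ)
      map_add' := fun v w => by
        rw [← integral_add (integrable_lOne_mul f _) (integrable_lOne_mul f _)]
        simp [mul_add]
      map_smul' := fun c v => by
        rw [RingHom.id_apply, smul_eq_mul, ← integral_const_mul]
        simp [mul_left_comm] } ‖f‖ fun v => by
      exact (norm_integral_lOne_mul_le f (ι v)).trans_eq (by rw [ι.norm_map])
  map_add' f g := by
    ext v
    simp only [LinearMap.mkContinuous_apply, LinearMap.coe_mk, AddHom.coe_mk, _root_.add_apply]
    rw [← integral_add (integrable_lOne_mul f _) (integrable_lOne_mul g _)]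
    refine integral_congr_ae ?_
    filter_upwards [Lp.coeFn_add f g] with p hp
    rw [hp, Pi.add_apply, add_mul]
  map_smul' c f := by
    ext v
    simp only [LinearMap.mkContinuous_apply, LinearMap.coe_mk, AddHom.coe_mk, RingHom.id_apply,
      _root_.smul_apply, smul_eq_mul]
    rw [← integral_const_mul]
    refine integral_congr_ae ?_
    filter_upwards [Lp.coeFn_smul c f] with p hp
    rw [hp, Pi.smul_apply, smul_eq_mul, mul_assoc]

omit [T2Space B] in
theorem lOneToDual_apply (ι : V →ₗᵢ[𝕜] C(B, 𝕜)) (f : Lp 𝕜 1 (sumMeasure μ)) (v : V) :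
    lOneToDual ι μ f v = ∫ p, f p * ι v p.2 ∂(sumMeasure μ) := rfl

omit [T2Space B] in
theorem norm_lOneToDual_le (ι : V →ₗᵢ[𝕜] C(B, 𝕜)) (f : Lp 𝕜 1 (sumMeasure μ)) :
    ‖lOneToDual ι μ f‖ ≤ ‖f‖ :=
  ContinuousLinearMap.opNorm_le_bound _ (norm_nonneg _) fun v =>
    (norm_integral_lOne_mul_le f (ι v)).trans_eq (by rw [ι.norm_map])

variable {ι : V →ₗᵢ[𝕜] C(B, 𝕜)} (S : MeasureSelection ι)

/-- By density, this is reduced to `MeasureSelection.sum_integral_norm_le`. -/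
theorem MeasureSelection.norm_le_norm_lOneToDual
    (hf : ∀ j, IsFiniteMeasure (μ j)) (hr : ∀ j, (μ j).Regular) (hS : ∀ j, S.sel (μ j) = μ j)
    (hμ : ∀ i j, i ≠ j → μ i ⟂ₘ μ j) (f : Lp 𝕜 1 (sumMeasure μ)) :
    ‖f‖ ≤ ‖lOneToDual ι μ f‖ := by
  refine le_of_forall_pos_le_add fun ε hε => ?_
  obtain ⟨s, C, g, hgm, hg, hC, hs, hfg⟩ := exists_bounded_finite_support f (half_pos hε)
  have hgi : Integrable g (sumMeasure μ) := memLp_one_iff_integrable.1 hgm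
  have h1 : ‖hgm.toLp g‖ ≤ ‖lOneToDual ι μ (hgm.toLp g)‖ := by
    have h2 : ‖hgm.toLp g‖ = ∑ j ∈ s, ∫ x, ‖g ⟨j, x⟩‖ ∂(μ j) := by
      rw [L1.norm_eq_integral_norm, ← integral_sumMeasure_of_support hgi.norm
        fun p hp => by rw [hs p hp, norm_zero]]
      refine integral_congr_ae ?_
      filter_upwards [hgm.coeFn_toLp] with p hp
      rw [hp]
    rw [h2]
    refine S.sum_integral_norm_le hf hr hS hμ s (fun j => measurable_sigma_iff.1 hg j)
      (fun j x => hC ⟨j, x⟩) _ fun v => ?_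
    rw [lOneToDual_apply]
    have h3 : (fun p => hgm.toLp g p * ι v p.2) =ᵐ[sumMeasure μ] fun p => g p * ι v p.2 := by
      filter_upwards [hgm.coeFn_toLp] with p hp
      rw [hp]
    rw [integral_congr_ae h3]
    exact integral_sumMeasure_of_support ((integrable_lOne_mul _ _).congr h3)
      fun p hp => by rw [hs p hp, zero_mul]
  have h4 : ‖lOneToDual ι μ (hgm.toLp g)‖ ≤ ‖lOneToDual ι μ f‖ + ε / 2 := by
    have : lOneToDual ι μ (hgm.toLp g) =
        lOneToDual ι μ f - lOneToDual ι μ (f - hgm.toLp g) := by rw [map_sub]; abel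
    rw [this]
    exact (norm_sub_le _ _).trans (add_le_add le_rfl ((norm_lOneToDual_le ι _).trans hfg))
  calc ‖f‖ = ‖(f - hgm.toLp g) + hgm.toLp g‖ := by rw [sub_add_cancel]
    _ ≤ ε / 2 + (‖lOneToDual ι μ f‖ + ε / 2) :=
      (norm_add_le _ _).trans (add_le_add hfg (h1.trans h4))
    _ = _ := by ring

omit [TopologicalSpace B] [CompactSpace B] [T2Space B] [BorelSpace B] in
/-- The absolutely continuous parts of `m` with respect to pairwise singular measures add up to at
most `m`. -/
theorem sum_withDensity_rnDeriv_le (hf : ∀ j, IsFiniteMeasure (μ j))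
    (hμ : ∀ i j, i ≠ j → μ i ⟂ₘ μ j) (s : Finset J) (m : Measure B) [IsFiniteMeasure m] :
    ∑ j ∈ s, (μ j).withDensity (m.rnDeriv (μ j)) ≤ m := by
  classical
  induction s using Finset.induction_on generalizing m with
  | empty => exact Measure.zero_le _
  | insert a s ha ih =>
    rw [Finset.sum_insert ha]
    have hsum := m.haveLebesgueDecomposition_add (μ a)
    have : ∑ j ∈ s, (μ j).withDensity (m.rnDeriv (μ j)) =
        ∑ j ∈ s, (μ j).withDensity ((m.singularPart (μ a)).rnDeriv (μ j)) := by
      refine Finset.sum_congr rfl fun j hj => withDensity_congr_ae ?_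
      have hja : a ≠ j := fun h => ha (h ▸ hj)
      have h := Measure.rnDeriv_add_of_mutuallySingular (m.singularPart (μ a))
        ((μ a).withDensity (m.rnDeriv (μ a))) (μ j)
        ((hμ a j hja).mono_ac (withDensity_absolutelyContinuous _ _) Measure.AbsolutelyContinuous.rfl)
      rwa [← hsum] at h
    rw [this]
    calc _ ≤ (μ a).withDensity (m.rnDeriv (μ a)) + m.singularPart (μ a) :=
          add_le_add le_rfl (ih _)
      _ = m := by rw [add_comm, ← hsum]

/-- A selected measure is concentrated on a maximal family of pairwise singular selected measures. -/
theorem MeasureSelection.eq_sum_withDensity_rnDeriv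
    (hf : ∀ j, IsFiniteMeasure (μ j)) (hμ : ∀ i j, i ≠ j → μ i ⟂ₘ μ j)
    (hmax : ∀ m : Measure B, IsFiniteMeasure m → m.Regular → S.sel m = m → (∀ j, m ⟂ₘ μ j) → m = 0)
    (m : Measure B) [IsFiniteMeasure m] [m.Regular] (hm : S.sel m = m) :
    m = Measure.sum fun j => (μ j).withDensity (m.rnDeriv (μ j)) := by
  set P := Measure.sum fun j => (μ j).withDensity (m.rnDeriv (μ j)) with hP
  have hPm : P ≤ m := by
    refine Measure.le_iff.2 fun A hA => ?_
    rw [hP, Measure.sum_apply _ hA, ENNReal.tsum_eq_iSup_sum]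
    refine iSup_le fun s => ?_
    have := sum_withDensity_rnDeriv_le hf hμ s m A
    rwa [Measure.finsetSum_apply] at this
  have hPf := isFiniteMeasure_of_le m hPm
  have hadd := Measure.sub_add_cancel_of_le hPm
  have hle : m - P ≤ m := Measure.sub_le
  have h0 : m - P = 0 := by
    refine hmax _ (isFiniteMeasure_of_le m hle) (regular_of_le hle) (S.eq_self_of_le m _ hm hle)
      fun j => ?_
    refine (m.mutuallySingular_singularPart (μ j)).mono ?_ le_rfl
    refine Measure.le_iff.2 fun A _ => ?_
    have h1 : (m - P) A + (μ j).withDensity (m.rnDeriv (μ j)) A ≤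
        m.singularPart (μ j) A + (μ j).withDensity (m.rnDeriv (μ j)) A := by
      calc (m - P) A + (μ j).withDensity (m.rnDeriv (μ j)) A ≤ (m - P) A + P A :=
            add_le_add le_rfl (Measure.le_sum _ j A)
        _ = m A := by rw [← Measure.add_apply, hadd]
        _ = _ := by
          conv_lhs => rw [m.haveLebesgueDecomposition_add (μ j)]
          rfl
    refine (ENNReal.add_le_add_iff_right ?_).1 h1
    exact ((Measure.withDensity_rnDeriv_le m (μ j) A).trans_lt (measure_lt_top m A)).ne
  rw [← hadd, h0, zero_add]

/-- A functional on `V` is a combination of selected measures, and each of these is the sum of its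
absolutely continuous parts with respect to the members of a maximal family. -/
theorem MeasureSelection.surjective_lOneToDual
    (hf : ∀ j, IsFiniteMeasure (μ j)) (hμ : ∀ i j, i ≠ j → μ i ⟂ₘ μ j)
    (hmax : ∀ m : Measure B, IsFiniteMeasure m → m.Regular → S.sel m = m → (∀ j, m ⟂ₘ μ j) →
      m = 0) :
    Function.Surjective (lOneToDual ι μ) := by
  intro Λ
  obtain ⟨Φ, hΦ, hΦΛ⟩ := exists_extension_along ι Λ
  obtain ⟨t, m, ht, hmf, hmr, hmass, hm⟩ := exists_measures_eq_sum Φ zero_lt_one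
  suffices h : ∀ n : Measure B, IsFiniteMeasure n → n.Regular → S.sel n = n →
      ∃ f, ∀ v, lOneToDual ι μ f v = ∫ x, ι v x ∂n by
    choose f hfv using fun c : t => h _ (S.isFiniteMeasure (m c)) (S.regular (m c)) (S.sel_sel _)
    refine ⟨∑ c : t, (c : 𝕜) • f c, ?_⟩
    ext v
    rw [map_sum, _root_.sum_apply, ← hΦΛ, hm]
    refine Finset.sum_congr rfl fun c _ => ?_
    rw [map_smul, _root_.smul_apply, hfv, S.integral_eq, smul_eq_mul]
  intro n hn hnr hns
  have hsum := S.eq_sum_withDensity_rnDeriv hf hμ hmax n hns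
  let g : (Σ _ : J, B) → 𝕜 := fun p => ((n.rnDeriv (μ p.1) p.2).toReal : 𝕜)
  have hgm : Measurable g := measurable_sigma_iff.2 fun j =>
    RCLike.measurable_ofReal.comp (n.measurable_rnDeriv (μ j)).ennreal_toReal
  have hgL : MemLp g 1 (sumMeasure μ) := by
    refine ⟨hgm.aestronglyMeasurable, ?_⟩
    rw [eLpNorm_one_eq_lintegral_enorm, lintegral_sumMeasure hgm.enorm]
    calc ∑' j, ∫⁻ x, ‖g ⟨j, x⟩‖ₑ ∂(μ j) ≤
          ∑' j, (μ j).withDensity (n.rnDeriv (μ j)) Set.univ := by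
          refine ENNReal.tsum_le_tsum fun j => ?_
          rw [withDensity_apply _ MeasurableSet.univ, Measure.restrict_univ]
          refine lintegral_mono fun x => ?_
          simp only [g]
          rw [← ofReal_norm, RCLike.norm_ofReal, abs_of_nonneg ENNReal.toReal_nonneg]
          exact ENNReal.ofReal_toReal_le
      _ = n Set.univ := by
          conv_rhs => rw [hsum, Measure.sum_apply _ MeasurableSet.univ]
      _ < ∞ := measure_lt_top _ _
  refine ⟨hgL.toLp g, fun v => ?_⟩
  have h3 : (fun p => hgL.toLp g p * ι v p.2) =ᵐ[sumMeasure μ] fun p => g p * ι v p.2 := by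
    filter_upwards [hgL.coeFn_toLp] with p hp
    rw [hp]
  rw [lOneToDual_apply, integral_congr_ae h3,
    integral_sumMeasure ((integrable_lOne_mul _ _).congr h3)]
  have hint : Integrable (ι v) (Measure.sum fun j => (μ j).withDensity (n.rnDeriv (μ j))) := by
    rw [← hsum]
    exact (ι v).integrable_of_compactSpace n
  conv_rhs => rw [hsum, integral_sum_measure hint]
  refine tsum_congr fun j => ?_
  rw [integral_withDensity_eq_integral_toReal_smul (n.measurable_rnDeriv (μ j))
    (n.rnDeriv_lt_top (μ j))]
  simp only [g, RCLike.real_smul_eq_coe_mul]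

/-- The dual of a space that admits a selection of representing measures is an `L¹` space: it is the
`L¹` space of the disjoint union of a maximal family of pairwise singular selected measures. -/
theorem MeasureSelection.exists_dual_isometric.{a, b, c} {B : Type a} [TopologicalSpace B]
    [CompactSpace B] [T2Space B] [MeasurableSpace B] [BorelSpace B] {𝕜 : Type b} [RCLike 𝕜]
    {V : Type c} [NormedAddCommGroup V] [NormedSpace 𝕜 V] {ι : V →ₗᵢ[𝕜] C(B, 𝕜)}
    (S : MeasureSelection ι) :
    ∃ (α : Type (max a b)) (_ : MeasurableSpace α) (μ : Measure α),
      Nonempty (StrongDual 𝕜 V ≃ₗᵢ[𝕜] Lp 𝕜 1 μ) := by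
  let F : Set (Set (Measure B)) := {T | (∀ m ∈ T, IsFiniteMeasure m ∧ m.Regular ∧ S.sel m = m) ∧
    T.Pairwise fun m n => m ⟂ₘ n}
  obtain ⟨T, hT⟩ := zorn_subset F fun c hc hchain => by
    refine ⟨⋃₀ c, ⟨fun m hm => ?_, ?_⟩, fun s hs => Set.subset_sUnion_of_mem hs⟩
    · obtain ⟨s, hs, hm⟩ := hm
      exact (hc hs).1 m hm
    · exact (Set.pairwise_sUnion hchain.directedOn).2 fun s hs => (hc hs).2
  have hTF : T ∈ F := hT.prop
  -- the universe lift makes room for the universe of the scalar field in the index type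
  let μ : ULift.{b} T → Measure B := fun j => j.down
  have hμ : ∀ i j, i ≠ j → μ i ⟂ₘ μ j := fun i j hij =>
    hTF.2 i.down.2 j.down.2 fun h => hij (ULift.ext _ _ (Subtype.ext h))
  have hf : ∀ j, IsFiniteMeasure (μ j) := fun j => (hTF.1 _ j.down.2).1
  have hr : ∀ j, (μ j).Regular := fun j => (hTF.1 _ j.down.2).2.1
  have hS : ∀ j, S.sel (μ j) = μ j := fun j => (hTF.1 _ j.down.2).2.2
  have hmax : ∀ m : Measure B, IsFiniteMeasure m → m.Regular → S.sel m = m →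
      (∀ j, m ⟂ₘ μ j) → m = 0 := fun m h1 h2 h3 h4 => by
    have hins : insert m T ∈ F := by
      refine ⟨fun n hn => ?_, ?_⟩
      · rcases hn with rfl | hn
        · exact ⟨h1, h2, h3⟩
        · exact hTF.1 n hn
      · refine hTF.2.insert fun n hn _ => ?_
        exact ⟨h4 ⟨⟨n, hn⟩⟩, (h4 ⟨⟨n, hn⟩⟩).symm⟩
    have hmT : m ∈ T := hT.le_of_ge hins (Set.subset_insert _ _) (Set.mem_insert _ _)
    exact (Measure.MutuallySingular.self_iff m).1 (h4 ⟨⟨m, hmT⟩⟩)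
  let L : Lp 𝕜 1 (sumMeasure μ) →ₗᵢ[𝕜] StrongDual 𝕜 V :=
    ⟨lOneToDual ι μ, fun f =>
      le_antisymm (norm_lOneToDual_le ι f) (S.norm_le_norm_lOneToDual hf hr hS hμ f)⟩
  exact ⟨_, inferInstance, sumMeasure μ, ⟨(LinearIsometryEquiv.ofSurjective L
    (S.surjective_lOneToDual hf hμ hmax)).symm⟩⟩

end DualIsometry

/-! ### Functions vanishing at infinity -/

section ZeroAtInfty

variable {Ω : Type*} [TopologicalSpace Ω] [LocallyCompactSpace Ω] [T2Space Ω]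
  {𝕜 : Type*} [RCLike 𝕜]

/-- The extension by `0` of a function vanishing at infinity to the one-point compactification. -/
noncomputable def onePointExtension (𝕜 Ω : Type*) [RCLike 𝕜] [TopologicalSpace Ω] [T2Space Ω] :
    C₀(Ω, 𝕜) →ₗᵢ[𝕜] C(OnePoint Ω, 𝕜) where
  toFun f := OnePoint.continuousMapMk ⟨f, f.continuous⟩ 0
    (by rw [coclosedCompact_eq_cocompact]; exact f.zero_at_infty')
  map_add' f g := by
    ext x
    induction x using OnePoint.rec <;> simp [OnePoint.continuousMapMk]
  map_smul' c f := by
    ext x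
    induction x using OnePoint.rec <;> simp [OnePoint.continuousMapMk]
  norm_map' f := by
    refine le_antisymm ((ContinuousMap.norm_le _ (norm_nonneg _)).2 fun x => ?_) ?_
    · induction x using OnePoint.rec with
      | infty => simp [OnePoint.continuousMapMk]
      | coe x =>
        rw [← ZeroAtInftyContinuousMap.norm_toBCF_eq_norm]
        exact f.toBCF.norm_coe_le_norm x
    · have h : Tendsto (⇑(⟨f, f.continuous⟩ : C(Ω, 𝕜))) (coclosedCompact Ω) (𝓝 0) := by
        rw [coclosedCompact_eq_cocompact]; exact f.zero_at_infty'
      rw [← ZeroAtInftyContinuousMap.norm_toBCF_eq_norm]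
      exact (BoundedContinuousFunction.norm_le (norm_nonneg _)).2 fun x =>
        (OnePoint.continuousMapMk ⟨f, f.continuous⟩ 0 h).norm_coe_le_norm (x : OnePoint Ω)

omit [LocallyCompactSpace Ω] in
theorem onePointExtension_infty (f : C₀(Ω, 𝕜)) : onePointExtension 𝕜 Ω f OnePoint.infty = 0 := rfl

omit [LocallyCompactSpace Ω] in
theorem onePointExtension_coe (f : C₀(Ω, 𝕜)) (x : Ω) : onePointExtension 𝕜 Ω f x = f x := rfl

omit [LocallyCompactSpace Ω] in
theorem exists_onePointExtension_eq (F : C(OnePoint Ω, 𝕜)) (hF : F OnePoint.infty = 0) :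
    ∃ f : C₀(Ω, 𝕜), onePointExtension 𝕜 Ω f = F := by
  refine ⟨⟨⟨fun x => F x, F.continuous.comp OnePoint.continuous_coe⟩, ?_⟩, ?_⟩
  · have h := (F.continuous.tendsto OnePoint.infty).comp (OnePoint.tendsto_coe_infty (X := Ω))
    rw [hF, coclosedCompact_eq_cocompact] at h
    exact h
  · ext x
    induction x using OnePoint.rec with
    | infty => exact hF.symm
    | coe x => rfl

variable [MeasurableSpace (OnePoint Ω)] [BorelSpace (OnePoint Ω)]

omit [LocallyCompactSpace Ω] [BorelSpace (OnePoint Ω)] in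
theorem integral_onePointExtension_restrict (m : Measure (OnePoint Ω)) (f : C₀(Ω, 𝕜)) :
    ∫ x, onePointExtension 𝕜 Ω f x ∂(m.restrict {OnePoint.infty}ᶜ) =
      ∫ x, onePointExtension 𝕜 Ω f x ∂m := by
  refine setIntegral_eq_integral_of_forall_compl_eq_zero fun x hx => ?_
  rw [Set.notMem_compl_iff, Set.mem_singleton_iff] at hx
  rw [hx, onePointExtension_infty]

/-- The functions in `C₀(Ω, 𝕜)` determine the mass of compact sets away from the point at infinity,
by Urysohn's lemma. -/
theorem measure_isCompact_le_of_integral_eq {m n : Measure (OnePoint Ω)} [IsFiniteMeasure m]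
    [IsFiniteMeasure n] [n.Regular]
    (h : ∀ f : C₀(Ω, 𝕜), ∫ x, onePointExtension 𝕜 Ω f x ∂m = ∫ x, onePointExtension 𝕜 Ω f x ∂n)
    {K : Set (OnePoint Ω)} (hK : IsCompact K) (hK0 : OnePoint.infty ∉ K) : m K ≤ n K := by
  rw [Set.measure_eq_iInf_isOpen K n]
  refine le_iInf₂ fun U hKU => le_iInf fun hU => ?_
  let W := U ∩ {OnePoint.infty}ᶜ
  have hW : IsOpen W := hU.inter isOpen_compl_singleton
  have hKW : K ⊆ W := fun x hx => ⟨hKU hx, fun h => hK0 (h ▸ hx)⟩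
  refine le_trans ?_ (measure_mono (Set.inter_subset_left : W ⊆ U))
  obtain ⟨g, hg0, hg1, hg⟩ := exists_continuous_zero_one_of_isClosed hW.isClosed_compl hK.isClosed
    (Set.disjoint_left.2 fun x hx hx' => hx (hKW hx'))
  let F : C(OnePoint Ω, 𝕜) := ⟨fun x => (g x : 𝕜), by fun_prop⟩
  obtain ⟨f, hf⟩ := exists_onePointExtension_eq F (by
    have : g OnePoint.infty = 0 := hg0 (fun h : _ ∈ W => h.2 rfl)
    simp [F, this])
  have hint := h f
  rw [hf] at hint
  have hint' : ∫ x, g x ∂m = ∫ x, g x ∂n := by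
    have h1 : ∀ k : Measure (OnePoint Ω), ∫ x, F x ∂k = ((∫ x, g x ∂k : ℝ) : 𝕜) := fun k =>
      integral_ofReal
    rw [h1, h1] at hint
    exact_mod_cast hint
  have hm : m.real K ≤ ∫ x, g x ∂m := by
    rw [← integral_indicator_one hK.measurableSet]
    refine integral_mono ((integrable_const 1).indicator hK.measurableSet)
      (g.integrable_of_compactSpace m) fun x => ?_
    by_cases hx : x ∈ K
    · rw [Set.indicator_of_mem hx, hg1 hx]
    · rw [Set.indicator_of_notMem hx]
      exact (hg x).1
  have hn : ∫ x, g x ∂n ≤ n.real W := by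
    rw [← integral_indicator_one hW.measurableSet]
    refine integral_mono (g.integrable_of_compactSpace n)
      ((integrable_const 1).indicator hW.measurableSet) fun x => ?_
    by_cases hx : x ∈ W
    · rw [Set.indicator_of_mem hx]
      exact (hg x).2
    · rw [Set.indicator_of_notMem hx, hg0 hx]
      rfl
  exact (ENNReal.toReal_le_toReal (measure_ne_top _ _) (measure_ne_top _ _)).1
    (hm.trans (hint'.trans_le hn))

/-- The selection for `C₀(Ω, 𝕜)`, as a subspace of the continuous functions on the one-point
compactification: the mass at infinity is removed. -/
noncomputable def zeroAtInftySelection (𝕜 Ω : Type*) [RCLike 𝕜] [TopologicalSpace Ω]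
    [LocallyCompactSpace Ω] [T2Space Ω] [MeasurableSpace (OnePoint Ω)] [BorelSpace (OnePoint Ω)] :
    MeasureSelection (onePointExtension 𝕜 Ω) where
  sel m := m.restrict {OnePoint.infty}ᶜ
  isFiniteMeasure _ := inferInstance
  regular _ := regular_of_le Measure.restrict_le_self
  mass_le _ := Measure.restrict_le_self _
  integral_eq m _ _ f := integral_onePointExtension_restrict m f
  add m n := Measure.restrict_add m n _
  smul c m := Measure.restrict_smul c m _
  congr m n _ _ _ _ h := by
    refine Measure.ext fun A hA => ?_
    have hA' : MeasurableSet (A ∩ {OnePoint.infty}ᶜ) :=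
      hA.inter (measurableSet_singleton _).compl
    rw [Measure.restrict_apply hA, Measure.restrict_apply hA,
      hA'.measure_eq_iSup_isCompact_of_ne_top (measure_ne_top m _),
      hA'.measure_eq_iSup_isCompact_of_ne_top (measure_ne_top n _)]
    refine iSup_congr fun K => iSup_congr fun hKA => iSup_congr fun hK => ?_
    have hK0 : OnePoint.infty ∉ K := fun hx => (hKA hx).2 rfl
    exact le_antisymm (measure_isCompact_le_of_integral_eq h hK hK0)
      (measure_isCompact_le_of_integral_eq (fun f => (h f).symm) hK hK0)
  eq_self_of_le m n _ _ hm hle := by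
    refine Measure.restrict_eq_self_of_ae_mem ?_
    have h0 : m {OnePoint.infty} = 0 := by
      rw [← hm, Measure.restrict_apply (measurableSet_singleton _)]
      simp
    rw [ae_iff]
    simpa using le_antisymm ((hle _).trans h0.le) zero_le
  exists_conj f := by
    refine ⟨star f, fun x => ?_⟩
    induction x using OnePoint.rec with
    | infty => simp [onePointExtension_infty]
    | coe x => simp [onePointExtension_coe]

theorem isL1Predual_zeroAtInfty.{a, b} (𝕜 : Type b) [RCLike 𝕜] (Ω : Type a) [TopologicalSpace Ω]
    [LocallyCompactSpace Ω] [T2Space Ω] : IsL1Predual.{max a b} 𝕜 C₀(Ω, 𝕜) where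
  complete := inferInstance
  dual_isometric := by
    let _ : MeasurableSpace (OnePoint Ω) := borel _
    have : BorelSpace (OnePoint Ω) := ⟨rfl⟩
    exact (zeroAtInftySelection 𝕜 Ω).exists_dual_isometric

end ZeroAtInfty

/-! ### The cone over a simplex and upper envelopes -/

section Cone

variable {E : Type*} [AddCommGroup E] [Module ℝ E] {K : Set E}

theorem zero_mem_coneOver (hne : K.Nonempty) : (0 : E × ℝ) ∈ coneOver K := by
  obtain ⟨x, hx⟩ := hne
  exact ⟨0, le_rfl, x, hx, by ext <;> simp⟩

theorem add_mem_coneOver (hK : Convex ℝ K) {p q : E × ℝ} (hp : p ∈ coneOver K)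
    (hq : q ∈ coneOver K) : p + q ∈ coneOver K := by
  obtain ⟨s, hs, x, hx, rfl⟩ := hp
  obtain ⟨t, ht, y, hy, rfl⟩ := hq
  rcases (add_nonneg hs ht).eq_or_lt with h | h
  · obtain rfl : s = 0 := by linarith
    obtain rfl : t = 0 := by linarith
    exact ⟨0, le_rfl, x, hx, by simp⟩
  · refine ⟨s + t, h.le, (s / (s + t)) • x + (t / (s + t)) • y,
      hK hx hy (by positivity) (by positivity) (by field_simp), ?_⟩
    rw [Prod.mk_add_mk, smul_add, smul_smul, smul_smul, mul_div_cancel₀ _ h.ne',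
      mul_div_cancel₀ _ h.ne']

theorem smul_mem_coneOver {p : E × ℝ} (hp : p ∈ coneOver K) {c : ℝ} (hc : 0 ≤ c) :
    c • p ∈ coneOver K := by
  obtain ⟨s, hs, x, hx, rfl⟩ := hp
  exact ⟨c * s, by positivity, x, hx, by simp [smul_smul]⟩

theorem snd_nonneg_of_mem_coneOver {p : E × ℝ} (hp : p ∈ coneOver K) : 0 ≤ p.2 := by
  obtain ⟨s, hs, x, hx, rfl⟩ := hp
  exact hs

theorem eq_zero_of_mem_coneOver {p : E × ℝ} (hp : p ∈ coneOver K) (h : p.2 = 0) : p = 0 := by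
  obtain ⟨s, hs, x, hx, rfl⟩ := hp
  obtain rfl : s = 0 := h
  simp

theorem list_sum_mem_coneOver (hK : Convex ℝ K) (hne : K.Nonempty) {L : List (E × ℝ)}
    (hL : ∀ q ∈ L, q ∈ coneOver K) : L.sum ∈ coneOver K := by
  induction L with
  | nil => exact zero_mem_coneOver hne
  | cons q L ih =>
    rw [List.sum_cons]
    exact add_mem_coneOver hK (hL q List.mem_cons_self)
      (ih fun r hr => hL r (List.mem_cons_of_mem _ hr))

/-- The Riesz decomposition property of the cone over a simplex. -/
theorem QuantDP.IsSimplex.exists_decomposition (hK : IsSimplex K) {p q r s : E × ℝ}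
    (hp : p ∈ coneOver K) (hq : q ∈ coneOver K) (hr : r ∈ coneOver K) (hs : s ∈ coneOver K)
    (h : p + q = r + s) :
    ∃ a ∈ coneOver K, ∃ b ∈ coneOver K, ∃ c ∈ coneOver K, ∃ d ∈ coneOver K,
      p = a + b ∧ q = c + d ∧ r = a + c ∧ s = b + d := by
  obtain ⟨σ, hσ, h1, h2, h3⟩ := hK.exists_sup p hp r hr
  have h4 := h3 (p + r) (add_mem_coneOver hK.convex hp hr) (by simpa) (by simpa)
  have h5 := h3 (p + q) (add_mem_coneOver hK.convex hp hq) (by simpa) (by simpa [h])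
  refine ⟨p + r - σ, h4, σ - r, h2, σ - p, h1, p + q - σ, h5, by abel, by abel, by abel, ?_⟩
  rw [h]
  abel

variable [TopologicalSpace E]

/-- The positively homogeneous function on the cone over `K` that extends the function `f` on the
base `K × {1}`. Outside the cone its value is immaterial. -/
noncomputable def coneExtend (f : C(K, ℝ)) (p : E × ℝ) : ℝ :=
  open scoped Classical in
  p.2 * if h : p.2⁻¹ • p.1 ∈ K then f ⟨p.2⁻¹ • p.1, h⟩ else 0

theorem coneExtend_mk (f : C(K, ℝ)) (t : ℝ) (x : K) :
    coneExtend f (t • (x : E), t) = t * f x := by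
  rcases eq_or_ne t 0 with rfl | ht
  · simp [coneExtend]
  · have h : t⁻¹ • t • (x : E) = x := by rw [smul_smul, inv_mul_cancel₀ ht, one_smul]
    simp [coneExtend, h]

theorem coneExtend_zero (f : C(K, ℝ)) : coneExtend f 0 = 0 := by simp [coneExtend]

theorem coneExtend_add_fun (f g : C(K, ℝ)) (p : E × ℝ) :
    coneExtend (f + g) p = coneExtend f p + coneExtend g p := by
  unfold coneExtend
  split_ifs
  · simp [mul_add]
  · simp

theorem coneExtend_smul_fun (c : ℝ) (f : C(K, ℝ)) (p : E × ℝ) :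
    coneExtend (c • f) p = c * coneExtend f p := by
  unfold coneExtend
  split_ifs
  · simp [mul_left_comm]
  · simp

theorem coneExtend_smul (f : C(K, ℝ)) {c : ℝ} {p : E × ℝ} (hp : p ∈ coneOver K) :
    coneExtend f (c • p) = c * coneExtend f p := by
  obtain ⟨s, hs, x, hx, rfl⟩ := hp
  have h1 := coneExtend_mk f s ⟨x, hx⟩
  have h2 := coneExtend_mk f (c * s) ⟨x, hx⟩
  simp only [Prod.smul_mk, smul_smul, smul_eq_mul] at h1 h2 ⊢
  rw [h1, h2, mul_assoc]

theorem coneExtend_mono {f g : C(K, ℝ)} (h : f ≤ g) {p : E × ℝ} (hp : p ∈ coneOver K) :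
    coneExtend f p ≤ coneExtend g p := by
  obtain ⟨s, hs, x, hx, rfl⟩ := hp
  rw [coneExtend_mk f s ⟨x, hx⟩, coneExtend_mk g s ⟨x, hx⟩]
  exact mul_le_mul_of_nonneg_left (h _) hs

theorem coneExtend_const (c : ℝ) {p : E × ℝ} (hp : p ∈ coneOver K) :
    coneExtend (ContinuousMap.const K c) p = c * p.2 := by
  obtain ⟨s, hs, x, hx, rfl⟩ := hp
  rw [coneExtend_mk _ s ⟨x, hx⟩, ContinuousMap.const_apply, mul_comm]

/-- The continuous function `f` on `K` is convex. -/
def IsConvexFun (f : C(K, ℝ)) : Prop :=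
  ∀ (x y z : K) (a b : ℝ), 0 ≤ a → 0 ≤ b → a + b = 1 → (z : E) = a • (x : E) + b • (y : E) →
    f z ≤ a * f x + b * f y

theorem IsConvexFun.add {f g : C(K, ℝ)} (hf : IsConvexFun f) (hg : IsConvexFun g) :
    IsConvexFun (f + g) := fun x y z a b ha hb hab h => by
  have h1 := hf x y z a b ha hb hab h
  have h2 := hg x y z a b ha hb hab h
  simp only [ContinuousMap.add_apply]
  linarith

theorem IsConvexFun.smul {f : C(K, ℝ)} (hf : IsConvexFun f) {c : ℝ} (hc : 0 ≤ c) :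
    IsConvexFun (c • f) := fun x y z a b ha hb hab h => by
  have h1 := mul_le_mul_of_nonneg_left (hf x y z a b ha hb hab h) hc
  simp only [ContinuousMap.smul_apply, smul_eq_mul]
  linarith

theorem IsConvexFun.sup {f g : C(K, ℝ)} (hf : IsConvexFun f) (hg : IsConvexFun g) :
    IsConvexFun (f ⊔ g) := fun x y z a b ha hb hab h => by
  simp only [ContinuousMap.sup_apply]
  refine max_le ((hf x y z a b ha hb hab h).trans ?_) ((hg x y z a b ha hb hab h).trans ?_)
  · gcongr <;> exact le_max_left _ _
  · gcongr <;> exact le_max_right _ _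

theorem isConvexFun_of_mem_affineFunctions {f : C(K, ℝ)} (hf : f ∈ affineFunctions ℝ K) :
    IsConvexFun f := fun x y z a b ha hb hab h => (hf x y z a b ha hb hab h).le

theorem const_mem_affineFunctions (c : ℝ) :
    ContinuousMap.const K c ∈ affineFunctions ℝ K := fun x y z a b ha hb hab h => by
  simp only [ContinuousMap.const_apply, RCLike.ofReal_real_eq_id, id]
  rw [← add_mul, hab, one_mul]

theorem isConvexFun_zero : IsConvexFun (0 : C(K, ℝ)) := fun x y z a b ha hb hab h => by simp

theorem IsConvexFun.coneExtend_add_le (hK : Convex ℝ K) {f : C(K, ℝ)} (hf : IsConvexFun f)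
    {p q : E × ℝ} (hp : p ∈ coneOver K) (hq : q ∈ coneOver K) :
    coneExtend f (p + q) ≤ coneExtend f p + coneExtend f q := by
  obtain ⟨s, hs, x, hx, rfl⟩ := hp
  obtain ⟨t, ht, y, hy, rfl⟩ := hq
  rcases (add_nonneg hs ht).eq_or_lt with h | h
  · obtain rfl : s = 0 := by linarith
    obtain rfl : t = 0 := by linarith
    simp [coneExtend]
  · have hz : (s / (s + t)) • x + (t / (s + t)) • y ∈ K :=
      hK hx hy (by positivity) (by positivity) (by field_simp)
    have h1 : ((s • x, s) + (t • y, t) : E × ℝ) =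
        ((s + t) • ((s / (s + t)) • x + (t / (s + t)) • y), s + t) := by
      rw [Prod.mk_add_mk, smul_add, smul_smul, smul_smul, mul_div_cancel₀ _ h.ne',
        mul_div_cancel₀ _ h.ne']
    rw [h1, coneExtend_mk f _ ⟨_, hz⟩, coneExtend_mk f s ⟨x, hx⟩, coneExtend_mk f t ⟨y, hy⟩]
    have := mul_le_mul_of_nonneg_left (hf ⟨x, hx⟩ ⟨y, hy⟩ ⟨_, hz⟩ (s / (s + t)) (t / (s + t))
      (by positivity) (by positivity) (by field_simp) rfl) h.le
    refine this.trans_eq ?_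
    field_simp

theorem isConvexFun_neg_of_mem_affineFunctions {f : C(K, ℝ)} (hf : f ∈ affineFunctions ℝ K) :
    IsConvexFun (-f) :=
  isConvexFun_of_mem_affineFunctions ((affineFunctions ℝ K).neg_mem hf)

theorem coneExtend_add_of_affine (hK : Convex ℝ K) {f : C(K, ℝ)} (hf : f ∈ affineFunctions ℝ K)
    {p q : E × ℝ} (hp : p ∈ coneOver K) (hq : q ∈ coneOver K) :
    coneExtend f (p + q) = coneExtend f p + coneExtend f q := by
  refine le_antisymm ((isConvexFun_of_mem_affineFunctions hf).coneExtend_add_le hK hp hq) ?_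
  have h := (isConvexFun_neg_of_mem_affineFunctions hf).coneExtend_add_le hK hp hq
  rw [← neg_one_smul ℝ f] at h
  simp only [coneExtend_smul_fun] at h
  linarith

theorem IsConvexFun.coneExtend_sum_le (hK : Convex ℝ K) (hne : K.Nonempty) {f : C(K, ℝ)}
    (hf : IsConvexFun f) {L : List (E × ℝ)} (hL : ∀ q ∈ L, q ∈ coneOver K) :
    coneExtend f L.sum ≤ (L.map (coneExtend f)).sum := by
  induction L with
  | nil => simp [coneExtend_zero]
  | cons q L ih =>
    have hL' : ∀ r ∈ L, r ∈ coneOver K := fun r hr => hL r (List.mem_cons_of_mem _ hr)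
    rw [List.sum_cons, List.map_cons, List.sum_cons]
    exact (hf.coneExtend_add_le hK (hL q List.mem_cons_self)
      (list_sum_mem_coneOver hK hne hL')).trans (add_le_add le_rfl (ih hL'))

theorem coneExtend_sum_of_affine (hK : Convex ℝ K) (hne : K.Nonempty) {f : C(K, ℝ)}
    (hf : f ∈ affineFunctions ℝ K) {L : List (E × ℝ)} (hL : ∀ q ∈ L, q ∈ coneOver K) :
    (L.map (coneExtend f)).sum = coneExtend f L.sum := by
  induction L with
  | nil => simp [coneExtend_zero]
  | cons q L ih =>
    have hL' : ∀ r ∈ L, r ∈ coneOver K := fun r hr => hL r (List.mem_cons_of_mem _ hr)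
    rw [List.sum_cons, List.map_cons, List.sum_cons, ih hL',
      coneExtend_add_of_affine hK hf (hL q List.mem_cons_self) (list_sum_mem_coneOver hK hne hL')]

/-- A list of cone elements with sum `p + q` splits into lists with sums `p` and `q`; by
subadditivity this does not decrease the sum of a convex function. -/
theorem QuantDP.IsSimplex.exists_list_decomposition (hK : IsSimplex K) (hne : K.Nonempty)
    {f : C(K, ℝ)} (hf : IsConvexFun f) {L : List (E × ℝ)} (hL : ∀ q ∈ L, q ∈ coneOver K)
    {p q : E × ℝ} (hp : p ∈ coneOver K) (hq : q ∈ coneOver K) (h : L.sum = p + q) :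
    ∃ L₁ L₂ : List (E × ℝ), (∀ r ∈ L₁, r ∈ coneOver K) ∧ (∀ r ∈ L₂, r ∈ coneOver K) ∧
      L₁.sum = p ∧ L₂.sum = q ∧
      (L.map (coneExtend f)).sum ≤ (L₁.map (coneExtend f)).sum + (L₂.map (coneExtend f)).sum := by
  induction L generalizing p q with
  | nil =>
    have h2 : p.2 + q.2 = 0 := by rw [← Prod.snd_add, ← h]; simp
    have hp0 := eq_zero_of_mem_coneOver hp
      (by linarith [snd_nonneg_of_mem_coneOver hp, snd_nonneg_of_mem_coneOver hq])
    have hq0 := eq_zero_of_mem_coneOver hq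
      (by linarith [snd_nonneg_of_mem_coneOver hp, snd_nonneg_of_mem_coneOver hq])
    exact ⟨[], [], by simp, by simp, by simp [hp0], by simp [hq0], by simp⟩
  | cons x L ih =>
    have hL' : ∀ r ∈ L, r ∈ coneOver K := fun r hr => hL r (List.mem_cons_of_mem _ hr)
    rw [List.sum_cons] at h
    obtain ⟨a, ha, b, hb, c, hc, d, hd, h1, h2, h3, h4⟩ := hK.exists_decomposition
      (hL x List.mem_cons_self) (list_sum_mem_coneOver hK.convex hne hL') hp hq h
    obtain ⟨L₁, L₂, h5, h6, h7, h8, h9⟩ := ih hL' hc hd h2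
    refine ⟨a :: L₁, b :: L₂, ?_, ?_, by simp [h7, h3], by simp [h8, h4], ?_⟩
    · intro r hr
      rcases List.mem_cons.1 hr with rfl | hr
      exacts [ha, h5 r hr]
    · intro r hr
      rcases List.mem_cons.1 hr with rfl | hr
      exacts [hb, h6 r hr]
    · simp only [List.map_cons, List.sum_cons]
      have := hf.coneExtend_add_le hK.convex ha hb
      rw [← h1] at this
      linarith

/-- The supremum of the sums `∑ f(qᵢ)` over all decompositions `p = ∑ qᵢ` in the cone over `K`;
for a convex function `f` on a simplex it is the value of the upper envelope of `f`. -/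
noncomputable def decompSup (f : C(K, ℝ)) (p : E × ℝ) : ℝ :=
  sSup {r | ∃ L : List (E × ℝ), (∀ q ∈ L, q ∈ coneOver K) ∧ L.sum = p ∧
    (L.map (coneExtend f)).sum = r}

theorem sum_coneExtend_le_of_le {f : C(K, ℝ)} {c : ℝ} (h : ∀ x, f x ≤ c) {L : List (E × ℝ)}
    (hL : ∀ q ∈ L, q ∈ coneOver K) : (L.map (coneExtend f)).sum ≤ c * L.sum.2 := by
  induction L with
  | nil => simp
  | cons q L ih =>
    have hq : q ∈ coneOver K := hL q List.mem_cons_self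
    simp only [List.map_cons, List.sum_cons, Prod.snd_add, mul_add]
    refine add_le_add ?_ (ih fun r hr => hL r (List.mem_cons_of_mem _ hr))
    rw [← coneExtend_const c hq]
    exact coneExtend_mono h hq

variable [CompactSpace K]

theorem le_decompSup (f : C(K, ℝ)) {L : List (E × ℝ)} (hL : ∀ q ∈ L, q ∈ coneOver K) :
    (L.map (coneExtend f)).sum ≤ decompSup f L.sum := by
  refine le_csSup ⟨‖f‖ * L.sum.2, ?_⟩ ⟨L, hL, rfl, rfl⟩
  rintro _ ⟨L', hL', h, rfl⟩
  rw [← h]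
  exact sum_coneExtend_le_of_le (fun x => (le_abs_self _).trans (f.norm_coe_le_norm x)) hL'

omit [CompactSpace K] in
theorem decompSup_le {f : C(K, ℝ)} {p : E × ℝ} (hp : p ∈ coneOver K) {c : ℝ}
    (h : ∀ L : List (E × ℝ), (∀ q ∈ L, q ∈ coneOver K) → L.sum = p →
      (L.map (coneExtend f)).sum ≤ c) : decompSup f p ≤ c := by
  refine csSup_le ⟨_, [p], by simpa using hp, by simp, rfl⟩ ?_
  rintro _ ⟨L, hL, h', rfl⟩
  exact h L hL h'

theorem coneExtend_le_decompSup (f : C(K, ℝ)) {p : E × ℝ} (hp : p ∈ coneOver K) :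
    coneExtend f p ≤ decompSup f p := by
  have := le_decompSup f (L := [p]) (by simpa using hp)
  simpa using this

theorem decompSup_mono {f g : C(K, ℝ)} (h : f ≤ g) {p : E × ℝ} (hp : p ∈ coneOver K) :
    decompSup f p ≤ decompSup g p := by
  refine decompSup_le hp fun L hL hs => ?_
  rw [← hs]
  refine le_trans ?_ (le_decompSup g hL)
  exact List.sum_le_sum fun q hq => coneExtend_mono h (hL q hq)

theorem decompSup_add_fun_le (f g : C(K, ℝ)) {p : E × ℝ} (hp : p ∈ coneOver K) :
    decompSup (f + g) p ≤ decompSup f p + decompSup g p := by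
  refine decompSup_le hp fun L hL hs => ?_
  have h1 := le_decompSup f hL
  have h2 := le_decompSup g hL
  rw [hs] at h1 h2
  have : (L.map (coneExtend (f + g))).sum =
      (L.map (coneExtend f)).sum + (L.map (coneExtend g)).sum := by
    rw [← List.sum_map_add]
    simp only [← coneExtend_add_fun]
  linarith

theorem decompSup_smul_fun (f : C(K, ℝ)) {c : ℝ} (hc : 0 < c) {p : E × ℝ} (hp : p ∈ coneOver K) :
    decompSup (c • f) p = c * decompSup f p := by
  have key : ∀ (f : C(K, ℝ)) {c : ℝ}, 0 < c → decompSup (c • f) p ≤ c * decompSup f p :=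
    fun f c hc => decompSup_le hp fun L hL hs => by
      have h1 := mul_le_mul_of_nonneg_left (le_decompSup f hL) hc.le
      rw [hs, ← List.sum_map_mul_left] at h1
      have h2 : (L.map (coneExtend (c • f))).sum = (L.map fun q => c * coneExtend f q).sum := by
        simp only [← coneExtend_smul_fun]
      exact h2.trans_le h1
  refine le_antisymm (key f hc) ?_
  have h := key (c • f) (inv_pos.2 hc)
  rw [smul_smul, inv_mul_cancel₀ hc.ne', one_smul] at h
  calc c * decompSup f p ≤ c * (c⁻¹ * decompSup (c • f) p) := by gcongr
    _ = _ := by rw [mul_inv_cancel_left₀ hc.ne']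

omit [CompactSpace K] in
theorem decompSup_le_of_le {f : C(K, ℝ)} {c : ℝ} (h : ∀ x, f x ≤ c) {p : E × ℝ}
    (hp : p ∈ coneOver K) : decompSup f p ≤ c * p.2 :=
  decompSup_le hp fun _ hL hs => hs ▸ sum_coneExtend_le_of_le h hL

theorem decompSup_smul (f : C(K, ℝ)) {c : ℝ} (hc : 0 ≤ c) {p : E × ℝ} (hp : p ∈ coneOver K) :
    decompSup f (c • p) = c * decompSup f p := by
  have key : ∀ {c : ℝ} {p : E × ℝ}, 0 < c → p ∈ coneOver K →
      c * decompSup f p ≤ decompSup f (c • p) := fun {c p} hc hp => by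
    rw [← le_div_iff₀' hc]
    refine decompSup_le hp fun L hL hs => ?_
    rw [le_div_iff₀' hc]
    have h1 := le_decompSup f (L := L.map (c • ·)) (by
      intro q hq
      obtain ⟨r, hr, rfl⟩ := List.mem_map.1 hq
      exact smul_mem_coneOver (hL r hr) hc.le)
    rw [← List.smul_sum, hs] at h1
    refine le_trans (le_of_eq ?_) h1
    rw [← List.sum_map_mul_left, List.map_map]
    congr 1
    refine List.map_congr_left fun q hq => ?_
    exact (coneExtend_smul f (hL q hq)).symm
  rcases hc.eq_or_lt with rfl | hc
  · rw [zero_smul, zero_mul]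
    have h0 : (0 : E × ℝ) ∈ coneOver K := by simpa using smul_mem_coneOver hp le_rfl
    refine le_antisymm ?_ ?_
    · have := decompSup_le_of_le (f := f) (c := ‖f‖)
        (fun x => (le_abs_self _).trans (f.norm_coe_le_norm x)) h0
      simpa using this
    · have := coneExtend_le_decompSup f h0
      rwa [coneExtend_zero] at this
  · refine le_antisymm ?_ (key hc hp)
    have h := key (inv_pos.2 hc) (smul_mem_coneOver hp hc.le)
    rw [smul_smul, inv_mul_cancel₀ hc.ne', one_smul] at h
    calc decompSup f (c • p) = c * (c⁻¹ * decompSup f (c • p)) := by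
          rw [mul_inv_cancel_left₀ hc.ne']
      _ ≤ _ := by gcongr

/-- On a simplex, the upper envelope of a convex function is additive on the cone. -/
theorem QuantDP.IsSimplex.decompSup_add (hK : IsSimplex K) (hne : K.Nonempty) {f : C(K, ℝ)}
    (hf : IsConvexFun f) {p q : E × ℝ} (hp : p ∈ coneOver K) (hq : q ∈ coneOver K) :
    decompSup f (p + q) = decompSup f p + decompSup f q := by
  refine le_antisymm (decompSup_le (add_mem_coneOver hK.convex hp hq) fun L hL hs => ?_) ?_
  · obtain ⟨L₁, L₂, h1, h2, h3, h4, h5⟩ := hK.exists_list_decomposition hne hf hL hp hq hs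
    have h6 := le_decompSup f h1
    have h7 := le_decompSup f h2
    rw [h3] at h6
    rw [h4] at h7
    linarith
  · rw [← le_sub_iff_add_le]
    refine decompSup_le hp fun L hL hs => ?_
    rw [le_sub_comm]
    refine decompSup_le hq fun L' hL' hs' => ?_
    have := le_decompSup f (L := L ++ L') fun r hr => (List.mem_append.1 hr).elim (hL r) (hL' r)
    rw [List.sum_append, hs, hs', List.map_append, List.sum_append] at this
    linarith

theorem QuantDP.IsSimplex.decompSup_sum (hK : IsSimplex K) (hne : K.Nonempty) {f : C(K, ℝ)}
    (hf : IsConvexFun f) {L : List (E × ℝ)} (hL : ∀ q ∈ L, q ∈ coneOver K) :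
    (L.map (decompSup f)).sum = decompSup f L.sum := by
  induction L with
  | nil =>
    have := decompSup_smul f le_rfl (zero_mem_coneOver hne)
    simpa using this.symm
  | cons q L ih =>
    have hL' : ∀ r ∈ L, r ∈ coneOver K := fun r hr => hL r (List.mem_cons_of_mem _ hr)
    rw [List.sum_cons, List.map_cons, List.sum_cons, ih hL',
      hK.decompSup_add hne hf (hL q List.mem_cons_self) (list_sum_mem_coneOver hK.convex hne hL')]

/-- On a simplex, the upper envelope is additive as a function of the convex function. -/
theorem QuantDP.IsSimplex.decompSup_add_fun (hK : IsSimplex K) (hne : K.Nonempty) {f g : C(K, ℝ)}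
    (hf : IsConvexFun f) (hg : IsConvexFun g) {p : E × ℝ} (hp : p ∈ coneOver K) :
    decompSup (f + g) p = decompSup f p + decompSup g p := by
  refine le_antisymm (decompSup_add_fun_le f g hp) ?_
  have key : ∀ q ∈ coneOver K, coneExtend f q + decompSup g q ≤ decompSup (f + g) q :=
    fun q hq => by
      rw [← le_sub_iff_add_le']
      refine decompSup_le hq fun L hL hs => ?_
      rw [le_sub_iff_add_le', ← hs]
      refine le_trans ?_ (le_decompSup (f + g) hL)
      have h1 := hf.coneExtend_sum_le hK.convex hne hL
      have : (L.map (coneExtend (f + g))).sum =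
          (L.map (coneExtend f)).sum + (L.map (coneExtend g)).sum := by
        rw [← List.sum_map_add]
        simp only [← coneExtend_add_fun]
      linarith
  rw [← le_sub_iff_add_le]
  refine decompSup_le hp fun L hL hs => ?_
  rw [le_sub_iff_add_le, ← hs, ← hK.decompSup_sum hne hg hL,
    ← hK.decompSup_sum hne (hf.add hg) hL, ← List.sum_map_add]
  exact List.sum_le_sum fun q hq => key q (hL q hq)

theorem decompSup_of_affine (hK : Convex ℝ K) (hne : K.Nonempty) {f : C(K, ℝ)}
    (hf : f ∈ affineFunctions ℝ K) {p : E × ℝ} (hp : p ∈ coneOver K) :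
    decompSup f p = coneExtend f p := by
  refine le_antisymm (decompSup_le hp fun L hL hs => ?_) (coneExtend_le_decompSup f hp)
  rw [coneExtend_sum_of_affine hK hne hf hL, hs]

end Cone

/-! ### Resultants of measures on compact convex sets -/

section Resultant

variable {E : Type*} [AddCommGroup E] [Module ℝ E] [TopologicalSpace E] {K : Set E}
  [CompactSpace K] [MeasurableSpace K] [BorelSpace K]

/-- The cone element `p` is the resultant of the measure `m` on `K`: it has the same value as `m` on
every continuous affine function. -/
def IsResultant (m : Measure K) (p : E × ℝ) : Prop :=
  p ∈ coneOver K ∧ ∀ a ∈ affineFunctions ℝ K, ∫ x, a x ∂m = coneExtend a p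

/-- A measure on `K` concentrated on a closed convex set has its barycenter in that set. -/
theorem exists_barycenter (hK : Convex ℝ K) {D : Set E} (hD : IsClosed D) (hDc : Convex ℝ D)
    (hne : (Subtype.val ⁻¹' D : Set K).Nonempty) (m : Measure K) [IsFiniteMeasure m]
    (hm : ∀ᵐ x : K ∂m, (x : E) ∈ D) :
    ∃ y : K, (y : E) ∈ D ∧ ∀ a ∈ affineFunctions ℝ K, ∫ x, a x ∂m = m.real Set.univ * a y := by
  have hD' : IsClosed (Subtype.val ⁻¹' D : Set K) := hD.preimage continuous_subtype_val
  obtain ⟨y, hyD, hy⟩ := hD'.isCompact.inter_iInter_nonempty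
    (fun a : affineFunctions ℝ K =>
      {y : K | ∫ x, (a : C(K, ℝ)) x ∂m = m.real Set.univ * (a : C(K, ℝ)) y})
    (fun a => isClosed_eq continuous_const (continuous_const.mul (a : C(K, ℝ)).continuous))
    (fun u => by
      rcases eq_or_ne m 0 with rfl | hm0
      · obtain ⟨y, hy⟩ := hne
        exact ⟨y, hy, by simp⟩
      have : NeZero m := ⟨hm0⟩
      let A : K → (u → ℝ) := fun y a => (a : C(K, ℝ)) y
      have hAc : Continuous A := continuous_pi fun a => (a : C(K, ℝ)).continuous
      have hconv : Convex ℝ (A '' (Subtype.val ⁻¹' D)) := by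
        rintro _ ⟨x, hx, rfl⟩ _ ⟨y, hy, rfl⟩ s t hs ht hst
        refine ⟨⟨s • (x : E) + t • (y : E), hK x.2 y.2 hs ht hst⟩, hDc hx hy hs ht hst, ?_⟩
        funext a
        exact (a : affineFunctions ℝ K).2 x y _ s t hs ht hst rfl
      have hint : ∀ a : u, Integrable (fun y => A y a) m := fun a =>
        ContinuousMap.integrable_of_compactSpace (a : C(K, ℝ)) m
      have hmem := hconv.average_mem (hD'.isCompact.image hAc).isClosed
        (hm.mono fun x hx => Set.mem_image_of_mem A hx) (Integrable.of_eval hint)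
      obtain ⟨y, hyD, hy⟩ := hmem
      refine ⟨y, hyD, Set.mem_iInter₂.2 fun a ha => ?_⟩
      have h1 := congrFun hy ⟨a, ha⟩
      rw [average_eq, Pi.smul_apply, eval_integral hint, smul_eq_mul] at h1
      have h2 : m.real Set.univ ≠ 0 := by simp [Measure.real, ENNReal.toReal_eq_zero_iff, hm0]
      change ∫ x, (a : C(K, ℝ)) x ∂m = m.real Set.univ * A y ⟨a, ha⟩
      rw [h1, mul_inv_cancel_left₀ h2])
  exact ⟨y, hyD, fun a ha => Set.mem_iInter.1 hy ⟨a, ha⟩⟩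

variable [IsTopologicalAddGroup E] [ContinuousSMul ℝ E] [LocallyConvexSpace ℝ E]

/-- A measure on `K` is approximated, from above on `f`, by a discrete measure that acts on affine
functions in the same way: split it along a partition of `K` into sets whose closed convex hulls
are small, and replace each piece by a point mass at its barycenter. -/
theorem exists_list_integral_le (hK : Convex ℝ K) (f : C(K, ℝ)) {ε : ℝ} (hε : 0 < ε)
    (m : Measure K) [IsFiniteMeasure m] :
    ∃ L : List (E × ℝ), (∀ q ∈ L, q ∈ coneOver K) ∧
      (∀ a ∈ affineFunctions ℝ K, ∫ x, a x ∂m = (L.map (coneExtend a)).sum) ∧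
      ∫ x, f x ∂m ≤ (L.map (coneExtend f)).sum + ε * m.real Set.univ := by
  classical
  have hnhds : ∀ x : K, ∃ D : Set E, IsClosed D ∧ Convex ℝ D ∧ (x : E) ∈ D ∧
      (Subtype.val ⁻¹' D : Set K) ∈ 𝓝 x ∧ ∀ y : K, (y : E) ∈ D → |f y - f x| ≤ ε / 2 := fun x => by
    have h1 : {y : K | |f y - f x| < ε / 2} ∈ 𝓝 x := by
      have := f.continuous.tendsto x
      exact (Metric.tendsto_nhds.1 this (ε / 2) (half_pos hε))
    obtain ⟨W, hW, hWs⟩ := mem_nhds_subtype K x _ |>.1 h1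
    obtain ⟨W', ⟨hW', hW'c⟩, hW'W⟩ := (closed_nhds_basis (x : E)).mem_iff.1 hW
    obtain ⟨U, ⟨hU, hUc⟩, hUW'⟩ := (LocallyConvexSpace.convex_basis (𝕜 := ℝ) (x : E)).mem_iff.1 hW'
    have hUx : closure U ∈ 𝓝 (x : E) := mem_of_superset hU subset_closure
    refine ⟨closure U, isClosed_closure, hUc.closure, mem_of_mem_nhds hUx,
      continuous_subtype_val.continuousAt hUx, fun y hy => ?_⟩
    exact (hWs (hW'W (closure_minimal hUW' hW'c hy))).le
  choose D hDc hDconv hDx hDn hDf using hnhds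
  obtain ⟨t, ht⟩ := CompactSpace.elim_nhds_subcover (fun x => Subtype.val ⁻¹' D x) hDn
  suffices h : ∀ (t : Finset K) (m : Measure K), IsFiniteMeasure m →
      (∀ᵐ y : K ∂m, ∃ x ∈ t, (y : E) ∈ D x) →
      ∃ L : List (E × ℝ), (∀ q ∈ L, q ∈ coneOver K) ∧
      (∀ a ∈ affineFunctions ℝ K, ∫ x, a x ∂m = (L.map (coneExtend a)).sum) ∧
      ∫ x, f x ∂m ≤ (L.map (coneExtend f)).sum + ε * m.real Set.univ from
    h t m inferInstance (ae_of_all _ fun y => by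
      have : y ∈ ⋃ x ∈ t, Subtype.val ⁻¹' D x := by rw [ht]; trivial
      simpa using this)
  intro t
  induction t using Finset.induction_on with
  | empty =>
    intro m _ h
    have h0 : m = 0 := by
      rw [← ae_eq_bot, ← Filter.eventually_false_iff_eq_bot]
      simpa using h
    subst h0
    exact ⟨[], by simp, by simp, by simp⟩
  | insert x t hx ih =>
    intro m _ h
    let A : Set K := Subtype.val ⁻¹' D x
    have hA : MeasurableSet A := ((hDc x).preimage continuous_subtype_val).measurableSet
    obtain ⟨L, hL, hLa, hLf⟩ := ih (m.restrict Aᶜ) inferInstance (by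
      rw [ae_restrict_iff' hA.compl]
      filter_upwards [h] with y hy hyA
      obtain ⟨z, hz, hyz⟩ := hy
      rcases Finset.mem_insert.1 hz with rfl | hz
      · exact (hyA hyz).elim
      · exact ⟨z, hz, hyz⟩)
    have hAae : ∀ᵐ y : K ∂(m.restrict A), (y : E) ∈ D x := ae_restrict_mem hA
    obtain ⟨y, hyD, hy⟩ := exists_barycenter hK (hDc x) (hDconv x) ⟨x, hDx x⟩ (m.restrict A) hAae
    let c := (m.restrict A).real Set.univ
    have hc : 0 ≤ c := measureReal_nonneg
    refine ⟨(c • (y : E), c) :: L, ?_, fun a ha => ?_, ?_⟩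
    · intro q hq
      rcases List.mem_cons.1 hq with rfl | hq
      exacts [⟨c, hc, y, y.2, rfl⟩, hL q hq]
    · rw [List.map_cons, List.sum_cons, coneExtend_mk, ← hLa a ha, ← hy a ha,
        integral_add_compl hA (a.integrable_of_compactSpace m)]
    · rw [List.map_cons, List.sum_cons, coneExtend_mk,
        ← integral_add_compl hA (f.integrable_of_compactSpace m)]
      have h1 : ∫ z in A, f z ∂m ≤ c * f y + ε * c := by
        calc ∫ z in A, f z ∂m ≤ ∫ z in A, (f y + ε) ∂m := by
              refine integral_mono_ae (f.integrable_of_compactSpace _) (integrable_const _) ?_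
              filter_upwards [hAae] with z hz
              have h1 := abs_le.1 (hDf x z hz)
              have h2 := abs_le.1 (hDf x y hyD)
              linarith [h1.2, h2.1]
          _ = c * f y + ε * c := by
              rw [integral_const, smul_eq_mul]
              ring
      have h2 : m.real Set.univ = c + (m.restrict Aᶜ).real Set.univ := by
        simp only [c, measureReal_restrict_apply_univ]
        exact (measureReal_add_measureReal_compl hA).symm
      rw [h2, mul_add]
      linarith

theorem exists_isResultant (hK : Convex ℝ K) (hne : K.Nonempty) (m : Measure K)
    [IsFiniteMeasure m] : ∃ p, IsResultant m p := by
  obtain ⟨L, hL, hLa, -⟩ := exists_list_integral_le hK 0 one_pos m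
  exact ⟨L.sum, list_sum_mem_coneOver hK hne hL, fun a ha => by
    rw [hLa a ha, coneExtend_sum_of_affine hK hne ha hL]⟩

omit [CompactSpace K] [MeasurableSpace K] [BorelSpace K] in
/-- Elements of the cone are determined by the continuous affine functions. -/
theorem eq_of_coneExtend_eq [T2Space E] {p q : E × ℝ} (hp : p ∈ coneOver K) (hq : q ∈ coneOver K)
    (h : ∀ a ∈ affineFunctions ℝ K, coneExtend a p = coneExtend a q) : p = q := by
  obtain ⟨s, hs, x, hx, rfl⟩ := hp
  obtain ⟨t, ht, y, hy, rfl⟩ := hq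
  have h1 := h _ (const_mem_affineFunctions 1)
  rw [coneExtend_mk _ s ⟨x, hx⟩, coneExtend_mk _ t ⟨y, hy⟩] at h1
  refine Prod.ext ?_ (by simpa using h1)
  by_contra hne
  obtain ⟨φ, hφ⟩ := SeparatingDual.exists_separating_of_ne (R := ℝ) hne
  refine hφ ?_
  have h2 := h ⟨fun z : K => φ z, by fun_prop⟩ fun x y z a b ha hb hab hz => by
    simp only [ContinuousMap.coe_mk, hz, map_add, map_smul, smul_eq_mul,
      RCLike.ofReal_real_eq_id, id]
  rw [coneExtend_mk _ s ⟨x, hx⟩, coneExtend_mk _ t ⟨y, hy⟩] at h2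
  simpa using h2

omit [CompactSpace K] [BorelSpace K] in
theorem IsResultant.unique [T2Space E] {m : Measure K} {p q : E × ℝ} (hp : IsResultant m p)
    (hq : IsResultant m q) : p = q :=
  eq_of_coneExtend_eq hp.1 hq.1 fun a ha => by rw [← hp.2 a ha, ← hq.2 a ha]

/-- The easy half of the description of the upper envelope: among the measures with resultant `p`
none has a larger integral of `f`, by approximation with discrete measures. -/
theorem IsResultant.integral_le_decompSup [T2Space E] (hK : Convex ℝ K) (hne : K.Nonempty)
    {m : Measure K} [IsFiniteMeasure m] {p : E × ℝ} (hp : IsResultant m p) (f : C(K, ℝ)) :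
    ∫ x, f x ∂m ≤ decompSup f p := by
  refine le_of_forall_pos_le_add fun ε hε => ?_
  obtain ⟨L, hL, hLa, hLf⟩ := exists_list_integral_le hK f
    (ε := ε / (m.real Set.univ + 1)) (by positivity) m
  have hLp : L.sum = p := IsResultant.unique (m := m)
    ⟨list_sum_mem_coneOver hK hne hL, fun a ha => by
      rw [hLa a ha, coneExtend_sum_of_affine hK hne ha hL]⟩ hp
  refine hLf.trans (add_le_add ?_ ?_)
  · rw [← hLp]
    exact le_decompSup f hL
  · rw [div_mul_eq_mul_div, div_le_iff₀ (by positivity)]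
    gcongr
    linarith

omit [IsTopologicalAddGroup E] [ContinuousSMul ℝ E] [LocallyConvexSpace ℝ E] in
/-- On a simplex, the upper envelope at a given element of the cone is additive on convex functions,
and hence given there by the integral with respect to a measure. -/
theorem QuantDP.IsSimplex.exists_measure_eq_decompSup [T2Space E] (hK : IsSimplex K)
    (hne : K.Nonempty) {p : E × ℝ} (hp : p ∈ coneOver K) :
    ∃ n : Measure K, IsFiniteMeasure n ∧ n.Regular ∧
      ∀ f : C(K, ℝ), IsConvexFun f → ∫ x, f x ∂n = decompSup f p := by
  -- This sublinear functional lies below the upper envelope, and its value at `-f` is minus the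
  -- upper envelope of `f` for convex `f`, so that it determines its linear minorants there.
  let N : C(K, ℝ) → ℝ := fun h =>
    ⨅ f : {f : C(K, ℝ) // IsConvexFun f}, decompSup (h + (f : C(K, ℝ))) p - decompSup (f : C(K, ℝ)) p
  have hnon : Nonempty {f : C(K, ℝ) // IsConvexFun f} := ⟨⟨0, isConvexFun_zero⟩⟩
  have hbdd : ∀ h : C(K, ℝ), BddBelow (Set.range fun f : {f : C(K, ℝ) // IsConvexFun f} =>
      decompSup (h + (f : C(K, ℝ))) p - decompSup (f : C(K, ℝ)) p) := fun h => by
    refine ⟨-decompSup (-h) p, ?_⟩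
    rintro _ ⟨f, rfl⟩
    have := decompSup_add_fun_le (h + (f : C(K, ℝ))) (-h) hp
    rw [show h + (f : C(K, ℝ)) + -h = f by abel] at this
    simp only
    linarith
  have hN : ∀ (h f : C(K, ℝ)), IsConvexFun f → N h ≤ decompSup (h + f) p - decompSup f p :=
    fun h f hf => ciInf_le (hbdd h) ⟨f, hf⟩
  have hhom : ∀ c : ℝ, 0 < c → ∀ h, N (c • h) ≤ c * N h := fun c hc h => by
    rw [← div_le_iff₀' hc]
    refine le_ciInf fun f => ?_
    rw [div_le_iff₀' hc]
    refine (hN _ _ (f.2.smul hc.le)).trans_eq ?_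
    rw [← smul_add, decompSup_smul_fun _ hc hp, decompSup_smul_fun _ hc hp]
    ring
  have h0 : decompSup (0 : C(K, ℝ)) p = 0 := by
    have h1 := decompSup_smul_fun (0 : C(K, ℝ)) (c := 2) two_pos hp
    rw [smul_zero] at h1
    linarith
  have hNle : ∀ h, N h ≤ decompSup h p := fun h => by
    have := hN h 0 isConvexFun_zero
    rwa [add_zero, h0, sub_zero] at this
  obtain ⟨g, -, hg⟩ := exists_extension_of_le_sublinear ⟨⊥, 0⟩ N
    (fun c hc h => by
      refine le_antisymm (hhom c hc h) ?_
      have := hhom c⁻¹ (inv_pos.2 hc) (c • h)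
      rw [smul_smul, inv_mul_cancel₀ hc.ne', one_smul] at this
      calc c * N h ≤ c * (c⁻¹ * N (c • h)) := by gcongr
        _ = _ := by rw [mul_inv_cancel_left₀ hc.ne'])
    (fun x y => by
      refine le_ciInf_add_ciInf fun f f' => ?_
      refine (hN (x + y) _ (f.2.add f'.2)).trans ?_
      rw [hK.decompSup_add_fun hne f.2 f'.2 hp,
        show x + y + ((f : C(K, ℝ)) + (f' : C(K, ℝ))) = (x + f) + (y + f') by abel]
      have := decompSup_add_fun_le (x + (f : C(K, ℝ))) (y + (f' : C(K, ℝ))) hp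
      linarith)
    (by
      rintro ⟨x, hx⟩
      obtain rfl := (Submodule.mem_bot ℝ).1 hx
      refine le_ciInf fun f => ?_
      simp)
  obtain ⟨n, hn1, hn2, hn⟩ := exists_regular_measure_of_nonneg g fun f hf => by
    have h1 := (hg (-f)).trans (hNle _)
    have h2 := decompSup_mono (neg_nonpos.2 hf) hp
    rw [map_neg] at h1
    rw [h0] at h2
    linarith
  refine ⟨n, hn1, hn2, fun f hf => ?_⟩
  rw [hn]
  refine le_antisymm ((hg f).trans (hNle f)) ?_
  have h1 := (hg (-f)).trans (hN (-f) f hf)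
  rw [map_neg, neg_add_cancel, h0] at h1
  linarith

omit [MeasurableSpace K] [BorelSpace K] in
/-- Differences of continuous convex functions are a lattice that separates points, hence dense by
the Stone–Weierstrass theorem. -/
theorem dense_sub_convex [T2Space E] :
    closure {u : C(K, ℝ) | ∃ f g, IsConvexFun f ∧ IsConvexFun g ∧ u = f - g} = ⊤ := by
  refine ContinuousMap.sublattice_closure_eq_top _
    ⟨0, 0, 0, isConvexFun_zero, isConvexFun_zero, by simp⟩ ?_ ?_ ?_
  · rintro _ ⟨f₁, g₁, hf₁, hg₁, rfl⟩ _ ⟨f₂, g₂, hf₂, hg₂, rfl⟩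
    refine ⟨f₁ + f₂, (g₁ + f₂) ⊔ (g₂ + f₁), hf₁.add hf₂, (hg₁.add hf₂).sup (hg₂.add hf₁), ?_⟩
    ext x
    simp only [ContinuousMap.inf_apply, ContinuousMap.sub_apply, ContinuousMap.add_apply,
      ContinuousMap.sup_apply]
    rcases le_total (f₁ x - g₁ x) (f₂ x - g₂ x) with h | h
    · rw [min_eq_left h, max_eq_left (by linarith)]; ring
    · rw [min_eq_right h, max_eq_right (by linarith)]; ring
  · rintro _ ⟨f₁, g₁, hf₁, hg₁, rfl⟩ _ ⟨f₂, g₂, hf₂, hg₂, rfl⟩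
    refine ⟨(f₁ + g₂) ⊔ (f₂ + g₁), g₁ + g₂, (hf₁.add hg₂).sup (hf₂.add hg₁), hg₁.add hg₂, ?_⟩
    ext x
    simp only [ContinuousMap.sub_apply, ContinuousMap.add_apply, ContinuousMap.sup_apply]
    rcases le_total (f₁ x - g₁ x) (f₂ x - g₂ x) with h | h
    · rw [max_eq_right h, max_eq_right (by linarith)]; ring
    · rw [max_eq_left h, max_eq_left (by linarith)]; ring
  · intro v x y
    rcases eq_or_ne x y with rfl | hxy
    · exact ⟨ContinuousMap.const K (v x), ⟨ContinuousMap.const K (v x), 0,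
        isConvexFun_of_mem_affineFunctions (const_mem_affineFunctions _), isConvexFun_zero,
        by simp⟩, rfl, rfl⟩
    · obtain ⟨φ, hφ⟩ := SeparatingDual.exists_separating_of_ne (R := ℝ)
        (Subtype.coe_injective.ne hxy)
      have hφ' : φ (x : E) - φ y ≠ 0 := sub_ne_zero.2 hφ
      let u : C(K, ℝ) :=
        ⟨fun z => v y + (v x - v y) / (φ (x : E) - φ y) * (φ (z : E) - φ y), by fun_prop⟩
      refine ⟨u, ⟨u, 0, isConvexFun_of_mem_affineFunctions ?_, isConvexFun_zero, by simp⟩, ?_, ?_⟩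
      · intro x' y' z a b ha hb hab hz
        simp only [u, ContinuousMap.coe_mk, hz, map_add, map_smul, smul_eq_mul,
          RCLike.ofReal_real_eq_id, id]
        obtain rfl : b = 1 - a := by linarith
        ring
      · simp only [u, ContinuousMap.coe_mk]
        field_simp
        ring
      · simp [u]

theorem measure_ext_of_convex [T2Space E] {m n : Measure K} [IsFiniteMeasure m] [IsFiniteMeasure n]
    [m.Regular] [n.Regular] (h : ∀ f : C(K, ℝ), IsConvexFun f → ∫ x, f x ∂m = ∫ x, f x ∂n) :
    m = n := by
  have hcont : ∀ k : Measure K, IsFiniteMeasure k → Continuous fun u : C(K, ℝ) => ∫ x, u x ∂k :=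
    fun k _ => by
      let ℓ : C(K, ℝ) →ₗ[ℝ] ℝ :=
        { toFun := fun u => ∫ x, u x ∂k
          map_add' := fun u v => integral_add (u.integrable_of_compactSpace k)
            (v.integrable_of_compactSpace k)
          map_smul' := fun c u => integral_const_mul c _ }
      exact (ℓ.mkContinuous (k.real Set.univ) fun u => by
        rw [mul_comm]
        exact norm_integral_le_of_norm_le_const (ae_of_all _ fun x => u.norm_coe_le_norm x)).continuous
  refine Measure.ext_of_integral_continuousMap fun u => ?_
  have hcl : IsClosed {u : C(K, ℝ) | ∫ x, u x ∂m = ∫ x, u x ∂n} :=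
    isClosed_eq (hcont m inferInstance) (hcont n inferInstance)
  refine hcl.closure_subset_iff.2 ?_ (show u ∈ closure _ by rw [dense_sub_convex (K := K)]; trivial)
  rintro _ ⟨f, g, hf, hg, rfl⟩
  simp only [Set.mem_ofPred_eq, ContinuousMap.sub_apply]
  rw [integral_sub (f.integrable_of_compactSpace m) (g.integrable_of_compactSpace m),
    integral_sub (f.integrable_of_compactSpace n) (g.integrable_of_compactSpace n), h f hf, h g hg]

end Resultant

/-! ### Maximal measures on simplices -/

section Simplex

variable {E : Type*} [AddCommGroup E] [Module ℝ E] [TopologicalSpace E] {K : Set E}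
  [CompactSpace K] [MeasurableSpace K] [BorelSpace K]

/-- The measure `n` is the maximal measure on the simplex `K` with the same resultant as `m`: on
convex functions it is given by their upper envelopes. -/
def IsMaximalVersion (m n : Measure K) : Prop :=
  IsFiniteMeasure n ∧ n.Regular ∧ ∃ p, IsResultant m p ∧
    ∀ f : C(K, ℝ), IsConvexFun f → ∫ x, f x ∂n = decompSup f p

omit [BorelSpace K] in
theorem IsResultant.add (hK : Convex ℝ K) {m n : Measure K} [IsFiniteMeasure m]
    [IsFiniteMeasure n] [OpensMeasurableSpace K] {p q : E × ℝ} (hp : IsResultant m p)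
    (hq : IsResultant n q) : IsResultant (m + n) (p + q) := by
  refine ⟨add_mem_coneOver hK hp.1 hq.1, fun a ha => ?_⟩
  have h1 : Integrable a m :=
    a.continuous.integrable_of_hasCompactSupport (HasCompactSupport.of_compactSpace _)
  have h2 : Integrable a n :=
    a.continuous.integrable_of_hasCompactSupport (HasCompactSupport.of_compactSpace _)
  rw [integral_add_measure h1 h2, hp.2 a ha, hq.2 a ha, coneExtend_add_of_affine hK ha hp.1 hq.1]

omit [CompactSpace K] [BorelSpace K] in
theorem IsResultant.smul {m : Measure K} {p : E × ℝ} (hp : IsResultant m p) (c : ℝ≥0) :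
    IsResultant (c • m) ((c : ℝ) • p) := by
  refine ⟨smul_mem_coneOver hp.1 c.2, fun a ha => ?_⟩
  rw [integral_smul_nnreal_measure, hp.2 a ha, coneExtend_smul a hp.1]
  rfl

variable [IsTopologicalAddGroup E] [ContinuousSMul ℝ E] [LocallyConvexSpace ℝ E] [T2Space E]

theorem QuantDP.IsSimplex.exists_isMaximalVersion (hK : IsSimplex K) (hne : K.Nonempty)
    (m : Measure K) [IsFiniteMeasure m] : ∃ n, IsMaximalVersion m n := by
  obtain ⟨p, hp⟩ := exists_isResultant hK.convex hne m
  obtain ⟨n, h1, h2, h3⟩ := hK.exists_measure_eq_decompSup hne hp.1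
  exact ⟨n, h1, h2, p, hp, h3⟩

theorem IsMaximalVersion.unique {m n n' : Measure K} (h : IsMaximalVersion m n)
    (h' : IsMaximalVersion m n') : n = n' := by
  obtain ⟨h1, h2, p, hp, h3⟩ := h
  obtain ⟨h1', h2', p', hp', h3'⟩ := h'
  obtain rfl := hp.unique hp'
  exact measure_ext_of_convex fun f hf => (h3 f hf).trans (h3' f hf).symm

omit [IsTopologicalAddGroup E] [ContinuousSMul ℝ E] [LocallyConvexSpace ℝ E] [T2Space E]
  [CompactSpace K] [MeasurableSpace K] [BorelSpace K] in
theorem ofReal_mem_affineFunctions (𝕜 : Type*) [RCLike 𝕜] {a : C(K, ℝ)}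
    (ha : a ∈ affineFunctions ℝ K) :
    (⟨fun x => (a x : 𝕜), by fun_prop⟩ : C(K, 𝕜)) ∈ affineFunctions 𝕜 K := by
  intro x y z s t hs ht hst h
  have := ha x y z s t hs ht hst h
  simp only [ContinuousMap.coe_mk, this]
  push_cast
  rfl

omit [IsTopologicalAddGroup E] [ContinuousSMul ℝ E] [LocallyConvexSpace ℝ E] [T2Space E]
  [CompactSpace K] [MeasurableSpace K] [BorelSpace K] in
theorem re_mem_affineFunctions {𝕜 : Type*} [RCLike 𝕜] {v : C(K, 𝕜)} (hv : v ∈ affineFunctions 𝕜 K) :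
    (⟨fun x => RCLike.re (v x), by fun_prop⟩ : C(K, ℝ)) ∈ affineFunctions ℝ K := by
  intro x y z s t hs ht hst h
  simp [hv x y z s t hs ht hst h]

omit [IsTopologicalAddGroup E] [ContinuousSMul ℝ E] [LocallyConvexSpace ℝ E] [T2Space E]
  [CompactSpace K] [MeasurableSpace K] [BorelSpace K] in
theorem im_mem_affineFunctions {𝕜 : Type*} [RCLike 𝕜] {v : C(K, 𝕜)} (hv : v ∈ affineFunctions 𝕜 K) :
    (⟨fun x => RCLike.im (v x), by fun_prop⟩ : C(K, ℝ)) ∈ affineFunctions ℝ K := by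
  intro x y z s t hs ht hst h
  simp [hv x y z s t hs ht hst h]

/-- Each measure on a simplex has the same resultant as exactly one maximal measure. The downward
heredity of maximality holds since measures are bounded above, on convex functions, by the upper
envelopes at their resultants, so that equality for a sum of two measures forces equality for
both. -/
theorem QuantDP.IsSimplex.nonempty_measureSelection (𝕜 : Type*) [RCLike 𝕜] (hK : IsSimplex K)
    (hne : K.Nonempty) : Nonempty (MeasureSelection (affineFunctions 𝕜 K).subtypeₗᵢ) := by
  classical
  let sel : Measure K → Measure K := fun m =>
    if h : ∃ n, IsMaximalVersion m n then h.choose else m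
  have hsel : ∀ (m : Measure K) [IsFiniteMeasure m], IsMaximalVersion m (sel m) := fun m _ => by
    have h := hK.exists_isMaximalVersion hne m
    simp only [sel, dif_pos h]
    exact h.choose_spec
  have haff : ∀ (m : Measure K) [IsFiniteMeasure m], ∀ a ∈ affineFunctions ℝ K,
      ∫ x, a x ∂(sel m) = ∫ x, a x ∂m := fun m _ a ha => by
    obtain ⟨-, -, p, hp, h⟩ := hsel m
    rw [h a (isConvexFun_of_mem_affineFunctions ha), decompSup_of_affine hK.convex hne ha hp.1,
      hp.2 a ha]
  exact ⟨{
    sel := sel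
    isFiniteMeasure := fun m _ _ => (hsel m).1
    regular := fun m _ _ => (hsel m).2.1
    mass_le := fun m _ _ => by
      have := (hsel m).1
      have h := haff m _ (const_mem_affineFunctions 1)
      simp only [ContinuousMap.const_apply, integral_const, smul_eq_mul, mul_one] at h
      exact ((ENNReal.toReal_eq_toReal_iff' (measure_ne_top _ _) (measure_ne_top _ _)).1 h).le
    integral_eq := fun m _ _ v => by
      have := (hsel m).1
      obtain ⟨v, hv⟩ := v
      have hre := haff m _ (re_mem_affineFunctions hv)
      have him := haff m _ (im_mem_affineFunctions hv)
      change ∫ x, v x ∂(sel m) = ∫ x, v x ∂m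
      refine RCLike.ext ?_ ?_
      · rw [← integral_re (v.integrable_of_compactSpace _),
          ← integral_re (v.integrable_of_compactSpace _)]
        exact hre
      · rw [← integral_im (v.integrable_of_compactSpace _),
          ← integral_im (v.integrable_of_compactSpace _)]
        exact him
    add := fun m n _ _ _ _ => by
      obtain ⟨h1, h2, p, hp, h3⟩ := hsel m
      obtain ⟨h1', h2', p', hp', h3'⟩ := hsel n
      refine (hsel (m + n)).unique
        ⟨inferInstance, regular_add, p + p', hp.add hK.convex hp', fun f hf => ?_⟩
      rw [integral_add_measure (f.integrable_of_compactSpace _) (f.integrable_of_compactSpace _),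
        h3 f hf, h3' f hf, hK.decompSup_add hne hf hp.1 hp'.1]
    smul := fun c m _ _ => by
      obtain ⟨h1, h2, p, hp, h3⟩ := hsel m
      refine (hsel (c • m)).unique ⟨inferInstance, inferInstance, _, hp.smul c, fun f hf => ?_⟩
      rw [integral_smul_nnreal_measure, h3 f hf]
      exact (decompSup_smul f c.2 hp.1).symm
    congr := fun m n _ _ _ _ h => by
      obtain ⟨h1, h2, p, hp, h3⟩ := hsel m
      refine IsMaximalVersion.unique ⟨h1, h2, p, ⟨hp.1, fun a ha => ?_⟩, h3⟩ (hsel n)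
      rw [← hp.2 a ha]
      have h4 := h ⟨_, ofReal_mem_affineFunctions 𝕜 ha⟩
      have h5 : ∀ k : Measure K, ∫ x, (a x : 𝕜) ∂k = ((∫ x, a x ∂k : ℝ) : 𝕜) := fun k =>
        integral_ofReal
      have h6 : ∫ x, (a x : 𝕜) ∂m = ∫ x, (a x : 𝕜) ∂n := h4
      rw [h5, h5] at h6
      exact_mod_cast h6.symm
    eq_self_of_le := fun m n _ _ hm hle => by
      have := isFiniteMeasure_of_le m hle
      have := regular_of_le hle
      have hle' : m - n ≤ m := Measure.sub_le
      have := isFiniteMeasure_of_le m hle'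
      have hadd := Measure.sub_add_cancel_of_le hle
      obtain ⟨p, hp⟩ := exists_isResultant hK.convex hne n
      obtain ⟨q, hq⟩ := exists_isResultant hK.convex hne (m - n)
      have hpq := hq.add hK.convex hp
      rw [hadd] at hpq
      obtain ⟨-, -, r, hr, h3⟩ := hsel m
      obtain rfl := hpq.unique hr
      refine (hsel n).unique ⟨inferInstance, inferInstance, p, hp, fun f hf => ?_⟩
      -- the two upper bounds add up to an equality, hence both are attained
      have h1 := hp.integral_le_decompSup hK.convex hne f
      have h2 := hq.integral_le_decompSup hK.convex hne f
      have h4 := h3 f hf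
      rw [hm, hK.decompSup_add hne hf hq.1 hp.1] at h4
      have h5 : ∫ x, f x ∂m = ∫ x, f x ∂(m - n) + ∫ x, f x ∂n := by
        conv_lhs => rw [← hadd]
        exact integral_add_measure (f.integrable_of_compactSpace _) (f.integrable_of_compactSpace _)
      linarith
    exists_conj := fun ⟨v, hv⟩ => by
      refine ⟨⟨⟨fun x => (starRingEnd 𝕜) (v x), RCLike.continuous_conj.comp v.continuous⟩, ?_⟩,
        fun x => rfl⟩
      intro x y z s t hs ht hst h
      simp [hv x y z s t hs ht hst h] }⟩

omit [IsTopologicalAddGroup E] [ContinuousSMul ℝ E] [LocallyConvexSpace ℝ E] [T2Space E]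
  [BorelSpace K] in
/-- The empty set is a simplex as well; its space of affine functions is trivial. -/
theorem nonempty_measureSelection_of_isEmpty (𝕜 : Type*) [RCLike 𝕜] (hne : IsEmpty K) :
    Nonempty (MeasureSelection (affineFunctions 𝕜 K).subtypeₗᵢ) := by
  have h0 : ∀ m n : Measure K, m = n := fun m n => by
    rw [Measure.eq_zero_of_isEmpty m, Measure.eq_zero_of_isEmpty n]
  exact ⟨{
    sel := id
    isFiniteMeasure := fun m _ _ => ‹_›
    regular := fun m _ _ => ‹_›
    mass_le := fun m _ _ => le_rfl
    integral_eq := fun m _ _ v => rfl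
    add := fun m n _ _ _ _ => rfl
    smul := fun c m _ _ => rfl
    congr := fun m n _ _ _ _ _ => h0 _ _
    eq_self_of_le := fun m n _ _ _ _ => rfl
    exists_conj := fun v => ⟨v, fun x => isEmptyElim x⟩ }⟩

omit [CompactSpace K] [MeasurableSpace K] [BorelSpace K] [IsTopologicalAddGroup E]
  [ContinuousSMul ℝ E] [LocallyConvexSpace ℝ E] [T2Space E] in
theorem isClosed_affineFunctions (𝕜 : Type*) [RCLike 𝕜] :
    IsClosed (affineFunctions 𝕜 K : Set C(K, 𝕜)) := by
  have : (affineFunctions 𝕜 K : Set C(K, 𝕜)) = ⋂ (x : K) (y : K) (z : K) (a : ℝ) (b : ℝ)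
      (_ : 0 ≤ a) (_ : 0 ≤ b) (_ : a + b = 1) (_ : (z : E) = a • (x : E) + b • (y : E)),
      {f : C(K, 𝕜) | f z = (a : 𝕜) * f x + (b : 𝕜) * f y} := by
    ext f
    simp only [Set.mem_iInter]
    rfl
  rw [this]
  refine isClosed_iInter fun x => isClosed_iInter fun y => isClosed_iInter fun z =>
    isClosed_iInter fun a => isClosed_iInter fun b => isClosed_iInter fun _ =>
    isClosed_iInter fun _ => isClosed_iInter fun _ => isClosed_iInter fun _ => ?_
  exact isClosed_eq (by fun_prop) (by fun_prop)

end Simplex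

theorem isL1Predual_affineFunctions.{a, b} (𝕜 : Type b) [RCLike 𝕜] {E : Type a} [AddCommGroup E]
    [Module ℝ E] [TopologicalSpace E] [IsTopologicalAddGroup E] [ContinuousSMul ℝ E]
    [LocallyConvexSpace ℝ E] [T2Space E] {K : Set E} [CompactSpace K] (hK : IsSimplex K) :
    IsL1Predual.{max a b} 𝕜 (affineFunctions 𝕜 K) where
  complete := (isClosed_affineFunctions 𝕜).completeSpace_coe
  dual_isometric := by
    let _ : MeasurableSpace K := borel _
    have : BorelSpace K := ⟨rfl⟩
    have hS : Nonempty (MeasureSelection (affineFunctions 𝕜 K).subtypeₗᵢ) := by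
      rcases K.eq_empty_or_nonempty with h | h
      · exact nonempty_measureSelection_of_isEmpty 𝕜 (Set.isEmpty_coe_sort.2 h)
      · exact hK.nonempty_measureSelection 𝕜 h
    exact hS.some.exists_dual_isometric

theorem theorem7p1 (𝕜 : Type v) [RCLike 𝕜] :
    (∀ (X : Type u) [NormedAddCommGroup X] [NormedSpace 𝕜 X], IsL1Predual.{z} 𝕜 X →
      (∀ (Y : Type w) [NormedAddCommGroup Y] [NormedSpace 𝕜 Y] [CompleteSpace Y]
        (T : X →L[𝕜] Y),
        wkOp T ≤ 2 * wkOp (dualOp T) ∧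
        2 * wkOp (dualOp T) ≤ 2 * deBlasiOp (dualOp T) ∧
        2 * deBlasiOp (dualOp T) = 2 * wkOp (dualOp T) ∧
        2 * wkOp (dualOp T) ≤ 4 * wkOp T ∧
        4 * wkOp T ≤ 4 * deBlasiOp T ∧
        cc T ≤ 2 * deBlasiOp (dualOp T)) ∧
      HasDirectQuantDPP.{w} 𝕜 X) ∧
    (∀ (Ω : Type u) [TopologicalSpace Ω] [LocallyCompactSpace Ω] [T2Space Ω],
      IsL1Predual.{max u v} 𝕜 C₀(Ω, 𝕜)) ∧
    (∀ (E : Type u) [AddCommGroup E] [Module ℝ E] [TopologicalSpace E] [IsTopologicalAddGroup E]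
      [ContinuousSMul ℝ E] [LocallyConvexSpace ℝ E] [T2Space E] (K : Set E) [CompactSpace K],
      IsSimplex K → IsL1Predual.{max u v} 𝕜 (affineFunctions 𝕜 K)) := by
  exact ⟨fun X _ _ hX => ⟨fun Y _ _ _ T => hX.quantitative_inequalities T, hX.hasDirectQuantDPP⟩,
    fun Ω _ _ _ => isL1Predual_zeroAtInfty 𝕜 Ω,
    fun E _ _ _ _ _ _ _ K _ hK => isL1Predual_affineFunctions 𝕜 hK⟩
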